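/- Theorem 3.1. Let $G$ be a countable discrete group and $\mu$ a probability measure on $G$ that is admissible (its support generates $G$ as a semigroup) and has finite entropy $H(\mu)<\infty$, where $H(\omega)=-\sum_w\omega(\{w\})\log\omega(\{w\})$ for a probability measure $\omega$ on a countable set. Let $\mathrm{Sub}_G\subset 2^G$ be the compact space of subgroups of $G$, and let $\lambda$ be a Borel probability measure on $\mathrm{Sub}_G$ that is invariant under conjugation. For $K\in\mathrm{Sub}_G$ and $n\ge 0$ let $\mu_K^n$ be the image of the $n$-fold convolution power $\mu^n$ (with $\mu^0=\delta_e$) under the map $G\to K\backslash G$, $g\mapsto Kg$. Let $\widetilde{\mathrm{Sub}}_G$ be the space of sequences $(K;Kg_0,Kg_1,\dots)$ with $K\in\mathrm{Sub}_G$ and $g_i\in G$, with the action $\gamma(K;Kg_0,Kg_1,\dots)=(\gamma K\gamma^{-1};\gamma Kg_0,\gamma Kg_1,\dots)$ of $G$ and the shift $\tilde\sigma(K;Kg_0,Kg_1,\dots)=(K;Kg_1,Kg_2,\dots)$. Let $\mathbb P_\lambda$ be the law of $(K;K,KX_1,KX_1X_2,\dots)$, where $K$ has law $\lambda$, the $X_i$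 have law $\mu$, and $K,X_1,X_2,\dots$ are independent. Call a measurable subset of $\widetilde{\mathrm{Sub}}_G$ null if it is null for $g_*\mathbb P_\lambda$ for every $g\in G$ (equivalently, null for the walk on the random coset space started at $Kg$, for every $g$). A Poisson boundary of the random walk on the random coset space is a standard Borel space $B$ with a Borel action of $G$, a probability measure $\nu_\lambda$ on $B$ and a Borel map $\mathrm{bnd}:\widetilde{\mathrm{Sub}}_G\to B$ such that $\mathrm{bnd}_*\mathbb P_\lambda=\nu_\lambda$, $\mathrm{bnd}(gx)=g\,\mathrm{bnd}(x)$ for each $g\in G$ outside a null set of $x$, and the pullback of the Borel $\sigma$-algebra of $B$ under $\mathrm{bnd}$ equals the $\sigma$-algebra of $\tilde\sigma$-invariant Borel sets modulo null sets. Then a Poisson boundary exists. All $H(\mu_K^n)$ are finite and $K\mapsto H(\mu_K^n)$ is $\lambda$-integrable for every $n\ge 0$. For every Poisson boundary $(B,\nu_\lambda)$, the action of $G$ is nonsingular, $\nu_\lambda$ is $\mu$-stationary, the function $(g,b)\mapsto-\log\frac{d\nu_\lambda\circ g}{d\nu_\lambda}(b)$ is $\mu\times\nu_\lambda$-integrable,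 and the Furstenberg entropy $$h_\mu(B,\nu_\lambda)=\iint-\log\frac{d\nu_\lambda\circ g}{d\nu_\lambda}(b)\,d\nu_\lambda(b)\,d\mu(g)$$ satisfies $$h_\mu(B,\nu_\lambda)=\lim_{n\to\infty}\frac1n\int H(\mu_K^n)\,d\lambda(K)=\inf_{n\ge1}\frac1n\int H(\mu_K^n)\,d\lambda(K)$$ $$=\lim_{n\to\infty}\int\bigl(H(\mu_K^n)-H(\mu_K^{n-1})\bigr)\,d\lambda(K)=\inf_{n\ge1}\int\bigl(H(\mu_K^n)-H(\mu_K^{n-1})\bigr)\,d\lambda(K).$$ -/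

import Mathlib

open MeasureTheory Filter Topology
open scoped Pointwise ENNReal

universe u v

namespace CosetWalk

/-! Throughout, `G` is a countable discrete group: every subset of `G` is measurable. -/

/-- The Borel σ-algebra of the space of subgroups `Sub_G ⊆ 2^G`.  For countable discrete `G` the
topology of uniform convergence on compact (that is, finite) sets is the product topology of `2^G`,
and its Borel σ-algebra is the product σ-algebra, generated by the sets `{K | g ∈ K}`. -/
instance instMeasurableSpaceSubgroup {G : Type u} [Group G] : MeasurableSpace (Subgroup G) :=
  MeasurableSpace.comap (fun K : Subgroup G => (K : Set G)) inferInstance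

/-- `μ` is admissible: its support generates `G` as a semigroup.  (Absolute continuity of a
convolution power with respect to Haar measure is automatic here, since Haar measure on a discrete
group is a multiple of counting measure.) -/
def Admissible {G : Type u} [Group G] [MeasurableSpace G] (μ : Measure G) : Prop :=
  Subsemigroup.closure {g : G | μ {g} ≠ 0} = ⊤

/-- `lam` is invariant under the action of `G` on its subgroups by conjugation. -/
def ConjInvariant {G : Type u} [Group G] (lam : Measure (Subgroup G)) : Prop :=
  ∀ g : G, lam.map (fun K : Subgroup G => MulAut.conj g • K) = lam

/-- The Shannon entropy `H(ω) = -∑ ω({w}) log ω({w}) ∈ [0, ∞]` of a probability measure on a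
countable set. -/
noncomputable def entropy {W : Type u} [MeasurableSpace W] (ω : Measure W) : ℝ≥0∞ :=
  ∑' w : W, ENNReal.ofReal (Real.negMulLog (ω.real {w}))

/-- The `n`-fold convolution power of `μ`. -/
noncomputable def convPow {G : Type u} [Group G] [MeasurableSpace G] (μ : Measure G) :
    ℕ → Measure G
  | 0 => Measure.dirac 1
  | n + 1 => Measure.mconv (convPow μ n) μ

/-- The set `K \ G` of cosets `Kg`. -/
abbrev CosetSpace {G : Type u} [Group G] (K : Subgroup G) : Type u :=
  Quotient (QuotientGroup.rightRel K)

/-- The measure `μ_K^n` on `K \ G`: the image of the `n`-fold convolution power of `μ` under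
`g ↦ Kg`. -/
noncomputable def cosetLaw {G : Type u} [Group G] [MeasurableSpace G] (μ : Measure G)
    (K : Subgroup G) (n : ℕ) : Measure (CosetSpace K) :=
  (convPow μ n).map (Quotient.mk (QuotientGroup.rightRel K))

/-- The real number `H(μ_K^n)`. -/
noncomputable def cosetEntropy {G : Type u} [Group G] [MeasurableSpace G] (μ : Measure G)
    (n : ℕ) (K : Subgroup G) : ℝ :=
  (entropy (cosetLaw μ K n)).toReal

/-- The space of all sequences `(K; Kg₀, Kg₁, …)`, with its σ-algebra as a subspace of
`Sub_G × (2^G)^ℕ`. -/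
abbrev CosetPath (G : Type u) [Group G] : Type u :=
  {p : Subgroup G × (ℕ → Set G) // ∀ n, ∃ g : G, p.2 n = MulOpposite.op g • (p.1 : Set G)}

/-- `γ (K; Kg₀, Kg₁, …) = (γKγ⁻¹; γKg₀, γKg₁, …)`. -/
instance instMulActionCosetPath {G : Type u} [Group G] : MulAction G (CosetPath G) where
  smul γ p := ⟨(MulAut.conj γ • p.1.1, fun n => γ • p.1.2 n), fun n => by
    obtain ⟨g, hg⟩ := p.2 n
    refine ⟨γ * g, ?_⟩
    ext x
    simp only [hg, Set.mem_smul_set_iff_inv_smul_mem, smul_eq_mul, SetLike.mem_coe,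
      Subgroup.mem_pointwise_smul_iff_inv_smul_mem, ← map_inv, MulAut.smul_def, MulAut.conj_apply,
      inv_inv, ← MulOpposite.op_inv, op_smul_eq_mul, mul_inv_rev]
    simp only [mul_assoc, inv_mul_cancel, mul_one]⟩
  one_smul p := by
    apply Subtype.ext
    apply Prod.ext
    · change MulAut.conj (1 : G) • p.1.1 = p.1.1
      rw [map_one, one_smul]
    · funext n
      exact one_smul G (p.1.2 n)
  mul_smul a b p := by
    apply Subtype.ext
    apply Prod.ext
    · change MulAut.conj (a * b) • p.1.1 = MulAut.conj a • MulAut.conj b • p.1.1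
      rw [map_mul, mul_smul]
    · funext n
      exact mul_smul a b (p.1.2 n)

/-- The time shift `(K; Kg₀, Kg₁, …) ↦ (K; Kg₁, Kg₂, …)`. -/
def shift {G : Type u} [Group G] (p : CosetPath G) : CosetPath G :=
  ⟨(p.1.1, fun n => p.1.2 (n + 1)), fun n => p.2 (n + 1)⟩

/-- The position `Z_n = X₁ X₂ ⋯ X_n` of the random walk with increments `X_{i+1} = x i`. -/
def position {G : Type u} [Group G] (x : ℕ → G) : ℕ → G
  | 0 => 1
  | n + 1 => position x n * x n

/-- The path `(K; KZ₀, KZ₁, KZ₂, …)`. -/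
def toCosetPath {G : Type u} [Group G] (q : Subgroup G × (ℕ → G)) : CosetPath G :=
  ⟨(q.1, fun n => MulOpposite.op (position q.2 n) • (q.1 : Set G)),
    fun n => ⟨position q.2 n, rfl⟩⟩

/-- The law `ℙ_lam` of `(K; K, KX₁, KX₁X₂, …)`, where `K` has law `lam` and, independently of `K`,
the `X_i` are independent with law `μ`. -/
noncomputable def pathLaw {G : Type u} [Group G] [MeasurableSpace G] (μ : Measure G)
    [IsProbabilityMeasure μ] (lam : Measure (Subgroup G)) : Measure (CosetPath G) :=
  (lam.prod (Measure.infinitePi (fun _ : ℕ => μ))).map toCosetPath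

/-- The sum of the translates `g_* ℙ_lam`.  By conjugation invariance of `lam`, the translate
`g_* ℙ_lam` is the law of the walk on the random coset space started at `Kg`, so the null sets of
this measure are the sets that are null from every starting point.  They form the smallest
`G`-invariant class of null sets determined by the walk; `ℙ_lam` by itself is not quasi-invariant
under `G`, as it is carried by the paths that start at `K`. -/
noncomputable def pathClass {G : Type u} [Group G] [MeasurableSpace G] (μ : Measure G)
    [IsProbabilityMeasure μ] (lam : Measure (Subgroup G)) : Measure (CosetPath G) :=
  Measure.sum (fun g : G => (pathLaw μ lam).map (fun p => g • p))

/-- `(B, ν)`, with the boundary map `bnd`, is a Poisson boundary `(B(Sub_G), ν_lam)` of the random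
walk on the random coset space: `bnd` is a measurable, almost everywhere `G`-equivariant map with
`bnd_* ℙ_lam = ν`, and the pullback of the σ-algebra of `B` under `bnd` is, modulo null sets, the
σ-algebra of shift-invariant sets. -/
structure IsPoissonBoundary {G : Type u} [Group G] [MeasurableSpace G] (μ : Measure G)
    [IsProbabilityMeasure μ] (lam : Measure (Subgroup G)) {B : Type v} [MeasurableSpace B]
    [MulAction G B] (ν : Measure B) (bnd : CosetPath G → B) : Prop where
  measurable : Measurable bnd
  equivariant : ∀ g : G, ∀ᵐ p ∂(pathClass μ lam), bnd (g • p) = g • bnd p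
  map_eq : (pathLaw μ lam).map bnd = ν
  preimage_invariant : ∀ E : Set B, MeasurableSet E →
    ∃ A : Set (CosetPath G), MeasurableSet[MeasurableSpace.invariants shift] A ∧
      bnd ⁻¹' E =ᵐ[pathClass μ lam] A
  invariant_preimage : ∀ A : Set (CosetPath G),
    MeasurableSet[MeasurableSpace.invariants shift] A →
    ∃ E : Set B, MeasurableSet E ∧ bnd ⁻¹' E =ᵐ[pathClass μ lam] A

section Furstenberg

/-- The measure `η ∘ g : E ↦ η (gE)`, that is, the image of `η` under `g⁻¹`. -/
noncomputable def translate {G : Type u} [Group G] {B : Type v} [MeasurableSpace B] [MulAction G B]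
    (η : Measure B) (g : G) : Measure B :=
  η.map (fun b => g⁻¹ • b)

/-- The action of `G` on `(B, η)` is nonsingular. -/
def Nonsingular (G : Type u) [Group G] {B : Type v} [MeasurableSpace B] [MulAction G B]
    (η : Measure B) : Prop :=
  ∀ g : G, translate η g ≪ η

/-- `η` is `μ`-stationary: `η = ∫ g_* η dμ(g)`. -/
def Stationary {G : Type u} [Group G] [MeasurableSpace G] (μ : Measure G) {B : Type v}
    [MeasurableSpace B] [MulAction G B] (η : Measure B) : Prop :=
  ∀ E : Set B, MeasurableSet E → η E = ∫⁻ g : G, η.map (fun b => g • b) E ∂μ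

/-- The function `-log (dη∘g / dη) (b)` of `(g, b)`. -/
noncomputable def logDensity {G : Type u} [Group G] {B : Type v} [MeasurableSpace B] [MulAction G B]
    (η : Measure B) (p : G × B) : ℝ :=
  -Real.log (((translate η p.1).rnDeriv η p.2).toReal)

/-- The Furstenberg entropy `h_μ(B, η) = ∬ -log (dη∘g / dη)(b) dη(b) dμ(g)`.  It is meaningful
if the action is nonsingular and `logDensity η` is integrable for `μ × η`. -/
noncomputable def furstenbergEntropy {G : Type u} [Group G] [MeasurableSpace G] (μ : Measure G)
    {B : Type v} [MeasurableSpace B] [MulAction G B] (η : Measure B) : ℝ :=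
  ∫ g : G, ∫ b : B, logDensity η (g, b) ∂η ∂μ

end Furstenberg

end CosetWalk

open CosetWalk

set_option linter.unusedSectionVars false

/-! Every term measures the information that the first increment X_1 shares with the later walk on
K\G. Write a_n for the integral of H(μ_K^n) over `lam`, Z_n for the position, h for the Furstenberg
entropy. The chain rule for the pair (X_1, K Z_{n+1}), averaged with conjugation invariance, gives
H(X_1 | K, K Z_{n+1}) = H(μ) - (a_{n+1} - a_n) (`hasSum_backEntropy`). By the Markov property the
conditional probabilities of {X_1 = g} given K and K Z_{n+1} (`backMartingale`) behave like a
reversed martingale in n. Jensen then makes the conditional entropies increase, so the increments of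
a_n decrease to a limit l, which is also the limit and infimum of a_n / n.

On the boundary side, g_*ν is the hitting law of the walk started at Kg, so the conditional
probability of {X_1 = g} given the boundary point is μ(g) times the density of g_*ν with respect to
ν. The entropy of this conditional law is H(μ) - h (`integral_negMulLog_mul_density`,
`hasSum_furstenbergEntropy`). Since this is also a projection of each backward probability, Jensen
gives h ≤ a_{n+1} - a_n for every n (`furstenbergEntropy_le`).

The converse l ≤ h meets an obstacle: the limit of the backward probabilities is a tail function of
the path, while the boundary sees only shift-invariant ones, and periodicity can separate the two.
The remedy is the lazy measure (δ_1 + μ)/2. Binomial laws with n and n + 1 trials differ by O(1/√n),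
so expectations of bounded tail functionals of the lazy walk do not depend on time, and these
functionals are boundary values of functions harmonic for μ itself (`startExp_lazy_tail`,
`exists_harmonic_of_tail`). Along μ-paths such a function converges to an invariant limit, which its
integrals over invariant events identify with the boundary density (`exists_harmonic_of_lazy`,
`pathLimsup_ae_eq`). So no boundary of the lazy walk is needed. It follows that the limit l' of the
lazy increments satisfies l' ≤ h/2 (`limit_lazy_le`). Concavity of entropy, and the fact that n lazy
steps contain n/2 true steps on average, give l/2 ≤ l'. Hence l = h (`entropy_formula`).

For existence, the invariant σ-algebra is generated modulo null sets by countably many sets;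
recording which of them contain each translate of a path gives an equivariant map to a standard
Borel translation space (`exists_isPoissonBoundary`). -/

namespace CosetWalk

/-! ### Increment sequences, the Markov property and martingale convergence -/

section GroupWalk

variable {G : Type u}

/-- The sequence that agrees with `x` before time `j` and continues with `y` from then on. -/
def glue (j : ℕ) (x y : ℕ → G) : ℕ → G := fun i => if i < j then x i else y (i - j)

variable [MeasurableSpace G]

lemma measurable_glue (j : ℕ) :
    Measurable (fun p : (ℕ → G) × (ℕ → G) => glue j p.1 p.2) := by
  refine measurable_pi_lambda _ fun i => ?_
  unfold glue
  split_ifs <;> fun_prop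

/-- Resampling the future of an i.i.d. sequence does not change its law. This is the form in which
the Markov property is used below; it is checked on finite boxes, whose index set splits at `j`. -/
lemma map_glue (μ : Measure G) [IsProbabilityMeasure μ] (j : ℕ) :
    ((Measure.infinitePi (fun _ : ℕ => μ)).prod (Measure.infinitePi (fun _ : ℕ => μ))).map
      (fun p => glue j p.1 p.2) = Measure.infinitePi (fun _ : ℕ => μ) := by
  classical
  refine Measure.eq_infinitePi _ fun s t ht => ?_
  rw [Measure.map_apply (measurable_glue j)
    (MeasurableSet.pi s.countable_toSet fun i _ => ht i)]
  have hset : (fun p : (ℕ → G) × (ℕ → G) => glue j p.1 p.2) ⁻¹' (Set.pi s t) =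
      (Set.pi (s.filter (· < j) : Finset ℕ) t) ×ˢ
        (Set.pi (((s.filter (fun i => ¬ i < j)).image (· - j) : Finset ℕ) : Set ℕ)
          (fun i => t (j + i))) := by
    ext ⟨x, y⟩
    simp only [Set.mem_preimage, Set.mem_pi, Set.mem_prod, Finset.mem_coe, Finset.mem_filter,
      Finset.mem_image]
    constructor
    · intro h
      refine ⟨fun i hi => ?_, ?_⟩
      · simpa [glue, hi.2] using h i hi.1
      · rintro _ ⟨i, hi, rfl⟩
        have := h i hi.1
        simp only [glue, hi.2, if_false] at this
        rwa [show j + (i - j) = i by have := hi.2; omega]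
    · rintro ⟨h1, h2⟩ i hi
      by_cases hij : i < j
      · simpa [glue, hij] using h1 i ⟨hi, hij⟩
      · have := h2 (i - j) ⟨i, ⟨hi, hij⟩, rfl⟩
        rw [show j + (i - j) = i by omega] at this
        simpa [glue, hij] using this
  rw [hset, Measure.prod_prod, Measure.infinitePi_pi _ (fun i _ => ht i),
    Measure.infinitePi_pi _ (fun i _ => ht _), Finset.prod_image,
    ← Finset.prod_filter_mul_prod_filter_not s (· < j)]
  · congr 1
    refine Finset.prod_congr rfl fun i hi => ?_
    rw [show j + (i - j) = i by have := (Finset.mem_filter.1 hi).2; omega]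
  · intro a ha b hb hab
    have h1 := (Finset.mem_filter.1 ha).2
    have h2 := (Finset.mem_filter.1 hb).2
    simp only at hab
    omega

lemma integral_glue (μ : Measure G) [IsProbabilityMeasure μ] (j : ℕ) {f : (ℕ → G) → ℝ}
    (hf : Integrable f (Measure.infinitePi (fun _ : ℕ => μ))) :
    ∫ x, f x ∂(Measure.infinitePi (fun _ : ℕ => μ)) =
      ∫ x, ∫ y, f (glue j x y) ∂(Measure.infinitePi (fun _ : ℕ => μ))
        ∂(Measure.infinitePi (fun _ : ℕ => μ)) := by
  have h := map_glue μ j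
  rw [← h] at hf
  have hi := (integrable_map_measure hf.1 (measurable_glue j).aemeasurable).1 hf
  conv_lhs => rw [← h]
  rw [integral_map (measurable_glue j).aemeasurable hf.1]
  exact integral_prod _ hi

variable [Group G]

/-- The sequence `x` with the terms from time `j` on replaced by `1`. -/
def cut (j : ℕ) (x : ℕ → G) : ℕ → G := glue j x (fun _ => 1)

lemma measurable_cut (j : ℕ) : Measurable (cut j : (ℕ → G) → ℕ → G) :=
  (measurable_glue j).comp (measurable_id.prodMk measurable_const)

lemma cut_glue (j : ℕ) (x y : ℕ → G) : cut j (glue j x y) = cut j x := by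
  funext i
  by_cases h : i < j <;> simp [cut, glue, h]

lemma cut_cut {i j : ℕ} (hij : i ≤ j) (x : ℕ → G) : cut i (cut j x) = cut i x := by
  funext k
  by_cases h : k < i
  · have : k < j := by omega
    simp [cut, glue, h, this]
  · simp [cut, glue, h]

/-- The filtration of the increments. -/
def stepFiltration (G : Type u) [Group G] [MeasurableSpace G] :
    Filtration ℕ (inferInstance : MeasurableSpace (ℕ → G)) where
  seq j := MeasurableSpace.comap (cut j) inferInstance
  mono' i j hij := by
    rintro _ ⟨s, hs, rfl⟩
    refine ⟨cut i ⁻¹' s, measurable_cut i hs, ?_⟩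
    ext x
    simp [cut_cut hij]
  le' j := (measurable_cut j).comap_le

lemma iSup_stepFiltration :
    (⨆ j, stepFiltration G j) = (inferInstance : MeasurableSpace (ℕ → G)) := by
  refine le_antisymm (iSup_le fun j => (stepFiltration G).le j) ?_
  refine iSup_le fun i => ?_
  refine le_trans ?_ (le_iSup _ (i + 1))
  rintro _ ⟨s, hs, rfl⟩
  refine ⟨(fun x => x i) ⁻¹' s, measurable_pi_apply i hs, ?_⟩
  ext x
  simp [cut, glue]

/-- Averaging over a resampled future is conditioning on the past, because events of the past are
unaffected by the resampling (`cut_glue`). -/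
lemma condExp_stepFiltration (μ : Measure G) [IsProbabilityMeasure μ] (j : ℕ)
    {f : (ℕ → G) → ℝ} (hf : Measurable f) {C : ℝ} (hC : ∀ x, |f x| ≤ C) :
    (fun x => ∫ y, f (glue j x y) ∂(Measure.infinitePi (fun _ : ℕ => μ)))
      =ᵐ[Measure.infinitePi (fun _ : ℕ => μ)]
      (Measure.infinitePi (fun _ : ℕ => μ))[f | stepFiltration G j] := by
  have hm : Measurable (fun p : (ℕ → G) × (ℕ → G) => f (glue j p.1 p.2)) :=
    hf.comp (measurable_glue j)
  have hsm : StronglyMeasurable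
      (fun x => ∫ y, f (glue j x y) ∂(Measure.infinitePi (fun _ : ℕ => μ))) :=
    hm.stronglyMeasurable.integral_prod_right
  have hb : ∀ x, ‖∫ y, f (glue j x y) ∂(Measure.infinitePi (fun _ : ℕ => μ))‖ ≤ C := fun x => by
    refine (norm_integral_le_of_norm_le_const (C := C) (ae_of_all _ fun y => hC _)).trans ?_
    simp
  have hfi : Integrable f (Measure.infinitePi (fun _ : ℕ => μ)) :=
    Integrable.of_bound hf.aestronglyMeasurable C (ae_of_all _ hC)
  have hgi : Integrable (fun x => ∫ y, f (glue j x y) ∂(Measure.infinitePi (fun _ : ℕ => μ)))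
      (Measure.infinitePi (fun _ : ℕ => μ)) :=
    Integrable.of_bound hsm.aestronglyMeasurable C (ae_of_all _ hb)
  refine ae_eq_condExp_of_forall_setIntegral_eq ((stepFiltration G).le j) hfi
    (fun s _ _ => hgi.integrableOn) ?_ ?_
  · rintro _ ⟨s, hs, rfl⟩ -
    have hs' : MeasurableSet (cut j ⁻¹' s) := measurable_cut j hs
    rw [← integral_indicator hs', ← integral_indicator hs', integral_glue μ j (hfi.indicator hs')]
    refine integral_congr_ae (ae_of_all _ fun x => ?_)
    by_cases hx : cut j x ∈ s
    · simp [Set.indicator, cut_glue, hx]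
    · simp [Set.indicator, cut_glue, hx]
  · refine StronglyMeasurable.aestronglyMeasurable (Measurable.stronglyMeasurable ?_)
    have : (fun x => ∫ y, f (glue j x y) ∂(Measure.infinitePi (fun _ : ℕ => μ))) =
        (fun x => ∫ y, f (glue j x y) ∂(Measure.infinitePi (fun _ : ℕ => μ))) ∘ cut j := by
      funext x
      refine integral_congr_ae (ae_of_all _ fun y => ?_)
      change f (glue j x y) = f (glue j (cut j x) y)
      congr 1
      funext i
      by_cases h : i < j <;> simp [cut, glue, h]
    rw [this]
    exact hsm.measurable.comp (comap_measurable (cut j))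

lemma position_glue (j m : ℕ) (x y : ℕ → G) :
    position (glue j x y) (j + m) = position x j * position y m := by
  have h : ∀ k ≤ j, position (glue j x y) k = position x k := by
    intro k hk
    induction k with
    | zero => rfl
    | succ k ih => simp [position, ih (by omega), glue, show k < j by omega]
  induction m with
  | zero => simp [position, h j le_rfl]
  | succ m ih =>
    rw [← add_assoc, position, ih, position, mul_assoc]
    simp [glue]

variable [Countable G] [DiscreteMeasurableSpace G]

lemma measurable_position (n : ℕ) : Measurable (fun x : ℕ → G => position x n) := by
  induction n with
  | zero => exact measurable_const
  | succ n ih => exact ih.mul (measurable_pi_apply n)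

lemma measurable_position' : Measurable (fun x : ℕ → G => position x) :=
  measurable_pi_lambda _ measurable_position

instance isProbabilityMeasure_convPow (μ : Measure G) [IsProbabilityMeasure μ] (n : ℕ) :
    IsProbabilityMeasure (convPow μ n) := by
  induction n with
  | zero => rw [convPow]; infer_instance
  | succ n ih => rw [convPow]; infer_instance

lemma map_position (μ : Measure G) [IsProbabilityMeasure μ] (n : ℕ) :
    (Measure.infinitePi (fun _ : ℕ => μ)).map (fun x => position x n) = convPow μ n := by
  induction n with
  | zero => simp [position, convPow, Measure.map_const]
  | succ n ih =>
    have h0 : (Measure.infinitePi (fun _ : ℕ => μ)).map (fun x => x 0) = μ :=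
      Measure.infinitePi_map_eval _ 0
    have h1 : (convPow μ n).prod μ = ((Measure.infinitePi (fun _ : ℕ => μ)).prod
        (Measure.infinitePi (fun _ : ℕ => μ))).map
          (Prod.map (fun x => position x n) (fun x => x 0)) := by
      rw [← Measure.map_prod_map _ _ (measurable_position n) (measurable_pi_apply 0), ih, h0]
    have h2 : Measurable (Prod.map (fun x : ℕ → G => position x n) (fun x : ℕ → G => x 0)) :=
      (measurable_position n).prodMap (measurable_pi_apply 0)
    rw [convPow, Measure.mconv, h1, Measure.map_map measurable_mul h2]
    conv_lhs => rw [← map_glue μ n]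
    rw [Measure.map_map (measurable_position _) (measurable_glue n)]
    congr 1
    funext p
    change position (glue n p.1 p.2) (n + 1) = position p.1 n * p.2 0
    rw [position_glue]
    simp [position]

lemma convPow_succ' (μ : Measure G) [IsProbabilityMeasure μ] (n : ℕ) :
    convPow μ (n + 1) = Measure.mconv μ (convPow μ n) := by
  induction n with
  | zero => simp [convPow]
  | succ n ih =>
    conv_lhs => rw [convPow, ih]
    rw [Measure.mconv_assoc]
    rfl

lemma integrable_of_abs_le {α : Type*} [MeasurableSpace α] (m : Measure α) [IsFiniteMeasure m]
    {f : α → ℝ} (hf : Measurable f) {C : ℝ} (hC : ∀ x, |f x| ≤ C) : Integrable f m :=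
  Integrable.of_bound hf.aestronglyMeasurable C (ae_of_all _ hC)

lemma abs_integral_le_of_abs_le {α : Type*} [MeasurableSpace α] (m : Measure α)
    [IsProbabilityMeasure m] {f : α → ℝ} {C : ℝ} (hC : ∀ x, |f x| ≤ C) : |∫ x, f x ∂m| ≤ C := by
  refine (norm_integral_le_of_norm_le_const (μ := m) (f := f) (C := C)
    (ae_of_all _ fun y => hC y)).trans ?_
  simp

lemma integral_mconv_of_bdd (μ ν : Measure G) [IsProbabilityMeasure μ] [IsProbabilityMeasure ν]
    {f : G → ℝ} {C : ℝ} (hC : ∀ x, |f x| ≤ C) :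
    ∫ x, f x ∂(Measure.mconv μ ν) = ∫ x, ∫ y, f (x * y) ∂ν ∂μ := by
  rw [Measure.mconv, integral_map measurable_mul.aemeasurable
    (Measurable.of_discrete).aestronglyMeasurable]
  exact integral_prod _ (integrable_of_abs_le _ Measurable.of_discrete fun x => hC _)

/-- Lévy's zero-one law for tail functionals of the random walk. -/
lemma tendsto_tail (μ : Measure G) [IsProbabilityMeasure μ] (ψ : ℕ → (ℕ → G) → ℝ)
    (hψm : ∀ j, Measurable (ψ j)) {C : ℝ} (hC : ∀ j z, |ψ j z| ≤ C)
    (hψ : ∀ j z, ψ 0 z = ψ j (fun i => z (j + i))) :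
    ∀ᵐ x ∂(Measure.infinitePi (fun _ : ℕ => μ)),
      Tendsto (fun j => ∫ y, ψ j (fun i => position x j * position y i)
        ∂(Measure.infinitePi (fun _ : ℕ => μ))) atTop (𝓝 (ψ 0 (position x))) := by
  have hf : Measurable (fun x : ℕ → G => ψ 0 (position x)) := (hψm 0).comp measurable_position'
  have h1 := Integrable.tendsto_ae_condExp (ℱ := stepFiltration G)
    (integrable_of_abs_le (Measure.infinitePi (fun _ : ℕ => μ)) hf fun x => hC 0 _)
    (by rw [iSup_stepFiltration]; exact hf.stronglyMeasurable)
  have h2 := ae_all_iff.2 fun j => condExp_stepFiltration μ j hf fun x => hC 0 _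
  filter_upwards [h1, h2] with x hx1 hx2
  refine hx1.congr fun j => ?_
  rw [← hx2 j]
  refine integral_congr_ae (ae_of_all _ fun y => ?_)
  -- After `j` steps the tail functional sees only the path from time `j` on, which is a fresh walk
  -- started at `position x j`.
  simp only [hψ j, position_glue]

/-- Bounded harmonic functions converge along almost every path. -/
lemma exists_tendsto_harmonic (μ : Measure G) [IsProbabilityMeasure μ] (w : G → ℝ) {C : ℝ}
    (hC : ∀ z, |w z| ≤ C) (hw : ∀ z, ∫ g, w (z * g) ∂μ = w z) :
    ∀ᵐ x ∂(Measure.infinitePi (fun _ : ℕ => μ)),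
      ∃ l, Tendsto (fun j => w (position x j)) atTop (𝓝 l) := by
  have hwm : ∀ j, Measurable (fun x : ℕ → G => w (position x j)) := fun j =>
    (Measurable.of_discrete (f := w)).comp (measurable_position j)
  have hsm : ∀ j, StronglyMeasurable[stepFiltration G j] (fun x : ℕ → G => w (position x j)) := by
    intro j
    have : (fun x : ℕ → G => w (position x j)) = (fun x : ℕ → G => w (position x j)) ∘ cut j := by
      funext x
      simp only [Function.comp, cut]
      rw [show position (glue j x fun _ => 1) j = position x j by
        simpa [position] using position_glue j 0 x (fun _ => 1)]
    rw [this]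
    exact ((hwm j).comp (comap_measurable (cut j))).stronglyMeasurable
  have hmart : Martingale (fun j (x : ℕ → G) => w (position x j)) (stepFiltration G)
      (Measure.infinitePi (fun _ : ℕ => μ)) := by
    refine martingale_nat (fun j => hsm j)
      (fun j => integrable_of_abs_le _ (hwm j) fun x => hC _) fun j => ?_
    refine EventuallyEq.trans (ae_of_all _ fun x => ?_)
      (condExp_stepFiltration μ j (hwm (j + 1)) fun x => hC _)
    change w (position x j) = ∫ y, w (position (glue j x y) (j + 1)) ∂_
    have hp : ∀ y : ℕ → G, position (glue j x y) (j + 1) = position x j * y 0 := fun y => by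
      rw [position_glue]
      simp [position]
    simp only [hp]
    rw [← hw]
    conv_lhs => rw [← Measure.infinitePi_map_eval (fun _ : ℕ => μ) 0]
    rw [integral_map (measurable_pi_apply 0).aemeasurable
      (Measurable.of_discrete).aestronglyMeasurable]
  have hb : ∀ j, eLpNorm (fun x : ℕ → G => w (position x j)) 1
      (Measure.infinitePi (fun _ : ℕ => μ)) ≤ (Real.toNNReal C : ℝ≥0∞) := fun j => by
    refine (eLpNorm_le_of_ae_bound (C := C) (ae_of_all _ fun x => hC _)).trans ?_
    simp [ENNReal.ofReal]
  filter_upwards [hmart.submartingale.ae_tendsto_limitProcess hb] with x hx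
  exact ⟨_, hx⟩

end GroupWalk

/-! ### Binomial averages and the lazy measure -/

section Lazy

lemma sum_choose_div_two_pow (n : ℕ) :
    ∑ k ∈ Finset.range (n + 1), (n.choose k : ℝ) / 2 ^ n = 1 := by
  rw [← Finset.sum_div]
  have := Nat.sum_range_choose n
  rw [div_eq_one_iff_eq (by positivity)]
  exact_mod_cast this

/-- The binomial variance, read off from `bernsteinPolynomial.variance` at 1/2; the factor 4 comes
from doubling the centred variable. -/
lemma sum_sq_choose_div_two_pow (n : ℕ) :
    ∑ k ∈ Finset.range (n + 1), (2 * (k : ℝ) - n) ^ 2 * ((n.choose k : ℝ) / 2 ^ n) = (n : ℝ) := by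
  have h := congrArg (Polynomial.eval (1 / 2 : ℝ)) (bernsteinPolynomial.variance ℝ n)
  simp only [bernsteinPolynomial, Polynomial.eval_finsetSum, Polynomial.eval_mul,
    Polynomial.eval_pow, Polynomial.eval_sub, Polynomial.eval_X,
    Polynomial.eval_natCast, Polynomial.eval_one, nsmul_eq_mul] at h
  have h2 : ∑ k ∈ Finset.range (n + 1), (2 * (k : ℝ) - n) ^ 2 * ((n.choose k : ℝ) / 2 ^ n) =
      4 * ∑ k ∈ Finset.range (n + 1), ((n : ℝ) * (1 / 2) - k) ^ 2 *
        ((n.choose k : ℝ) * (1 / 2) ^ k * (1 - 1 / 2) ^ (n - k)) := by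
    rw [Finset.mul_sum]
    refine Finset.sum_congr rfl fun k hk => ?_
    have hk' : k ≤ n := by simpa [Nat.lt_succ_iff] using hk
    have : (1 / 2 : ℝ) ^ k * (1 - 1 / 2) ^ (n - k) = 1 / 2 ^ n := by
      rw [show (1 - 1 / 2 : ℝ) = 1 / 2 by norm_num, ← pow_add, Nat.add_sub_cancel' hk', one_div_pow]
    rw [mul_assoc (n.choose k : ℝ), this]
    ring
  rw [h2, h]
  ring

/-- With N = n + 1, the two binomial weights differ by the weight for N trials times (2k - N)/N.
Thus the difference is at most C times the mean of |2S - N| / N for a binomial S, and the variance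
bounds that mean by √N / N. -/
lemma abs_sum_choose_sub_le (n : ℕ) (c : ℕ → ℝ) {C : ℝ} (hc : ∀ k, |c k| ≤ C) :
    |∑ k ∈ Finset.range (n + 1 + 1), ((n + 1).choose k : ℝ) / 2 ^ (n + 1) * c k -
      ∑ k ∈ Finset.range (n + 1), (n.choose k : ℝ) / 2 ^ n * c k| ≤ C / √(n + 1 : ℝ) := by
  have hC : 0 ≤ C := (abs_nonneg _).trans (hc 0)
  set N : ℝ := (n + 1 : ℝ) with hN
  have hNpos : 0 < N := by positivity
  have hs : 0 < √N := Real.sqrt_pos.2 hNpos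
  have hss : √N * √N = N := Real.mul_self_sqrt hNpos.le
  have h1 : ∑ k ∈ Finset.range (n + 1), (n.choose k : ℝ) / 2 ^ n * c k =
      ∑ k ∈ Finset.range (n + 1 + 1), (n.choose k : ℝ) / 2 ^ n * c k := by
    rw [Finset.sum_range_succ _ (n + 1)]
    simp
  rw [h1, ← Finset.sum_sub_distrib]
  have h2 : ∀ k ∈ Finset.range (n + 1 + 1),
      ((n + 1).choose k : ℝ) / 2 ^ (n + 1) * c k - (n.choose k : ℝ) / 2 ^ n * c k =
      ((n + 1).choose k : ℝ) / 2 ^ (n + 1) * ((2 * k - N) / N * c k) := by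
    intro k hk
    have hk' : k ≤ n + 1 := by simpa [Nat.lt_succ_iff] using hk
    have h := Nat.choose_mul_succ_eq n k
    have h' : (n.choose k : ℝ) * N = ((n + 1).choose k : ℝ) * (N - k) := by
      have := congrArg (Nat.cast : ℕ → ℝ) h
      push_cast [Nat.cast_sub hk'] at this
      exact this
    have h'' : (n.choose k : ℝ) = ((n + 1).choose k : ℝ) * (N - k) / N := by
      rw [eq_div_iff hNpos.ne', h']
    rw [h'']
    field_simp
    ring
  rw [Finset.sum_congr rfl h2]
  have h3 : ∀ k ∈ Finset.range (n + 1 + 1),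
      |((n + 1).choose k : ℝ) / 2 ^ (n + 1) * ((2 * k - N) / N * c k)| ≤
      C / (2 * N * √N) * ((2 * (k : ℝ) - (n + 1 : ℕ)) ^ 2 * (((n + 1).choose k : ℝ) / 2 ^ (n + 1))) +
      C * √N / (2 * N) * (((n + 1).choose k : ℝ) / 2 ^ (n + 1)) := by
    intro k _
    have hb : 0 ≤ ((n + 1).choose k : ℝ) / 2 ^ (n + 1) := by positivity
    rw [abs_mul, abs_of_nonneg hb, abs_mul, abs_div, abs_of_pos hNpos]
    push_cast
    rw [← hN]
    -- AM-GM with weight √N: since (2S - N)² has mean N, the two terms contribute equally and sum to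
    -- √N.
    have ht : |2 * (k : ℝ) - N| ≤ (2 * k - N) ^ 2 / (2 * √N) + √N / 2 := by
      have hq := sq_nonneg (|2 * (k : ℝ) - N| - √N)
      have ha := sq_abs (2 * (k : ℝ) - N)
      rw [div_add_div _ _ (by positivity) (by norm_num), le_div_iff₀ (by positivity)]
      nlinarith
    calc ((n + 1).choose k : ℝ) / 2 ^ (n + 1) * (|2 * (k : ℝ) - N| / N * |c k|)
        ≤ ((n + 1).choose k : ℝ) / 2 ^ (n + 1) *
          (((2 * k - N) ^ 2 / (2 * √N) + √N / 2) / N * C) := by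
          gcongr
          exact hc k
      _ = _ := by
          field_simp
  refine (Finset.abs_sum_le_sum_abs _ _).trans ((Finset.sum_le_sum h3).trans ?_)
  rw [Finset.sum_add_distrib, ← Finset.mul_sum, ← Finset.mul_sum, sum_sq_choose_div_two_pow,
    sum_choose_div_two_pow]
  push_cast
  rw [← hN]
  refine le_of_eq ?_
  have : N = √N ^ 2 := by rw [sq, hss]
  field_simp
  rw [← this]
  ring

lemma tendsto_choose_div_two_pow (k : ℕ) :
    Tendsto (fun n : ℕ => (n.choose k : ℝ) / 2 ^ n) atTop (𝓝 0) := by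
  refine squeeze_zero (fun n => by positivity) (fun n => ?_)
    (tendsto_pow_const_div_const_pow_of_one_lt k (one_lt_two : (1 : ℝ) < 2))
  gcongr
  exact_mod_cast Nat.choose_le_pow n k

/-- Binomial averaging is a regular summation method: the weights sum to one and each fixed weight
tends to zero. -/
lemma tendsto_sum_choose_mul (c : ℕ → ℝ) {l : ℝ} (hc : Tendsto c atTop (𝓝 l)) :
    Tendsto (fun n : ℕ => ∑ k ∈ Finset.range (n + 1), (n.choose k : ℝ) / 2 ^ n * c k)
      atTop (𝓝 l) := by
  have h0 : ∀ n : ℕ, ∑ k ∈ Finset.range (n + 1), (n.choose k : ℝ) / 2 ^ n * c k - l =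
      ∑ k ∈ Finset.range (n + 1), (n.choose k : ℝ) / 2 ^ n * (c k - l) := by
    intro n
    simp only [mul_sub, Finset.sum_sub_distrib]
    rw [← Finset.sum_mul, sum_choose_div_two_pow, one_mul]
  rw [← tendsto_sub_nhds_zero_iff]
  simp only [h0]
  rw [Metric.tendsto_atTop]
  intro ε hε
  obtain ⟨N, hN⟩ := Metric.tendsto_atTop.1 hc (ε / 2) (by positivity)
  have h1 : Tendsto (fun n : ℕ => ∑ k ∈ Finset.range N, (n.choose k : ℝ) / 2 ^ n * |c k - l|)
      atTop (𝓝 0) := by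
    have : Tendsto (fun n : ℕ => ∑ k ∈ Finset.range N, (n.choose k : ℝ) / 2 ^ n * |c k - l|)
        atTop (𝓝 (∑ k ∈ Finset.range N, 0 * |c k - l|)) :=
      tendsto_finsetSum _ fun k _ => (tendsto_choose_div_two_pow k).mul_const _
    simpa using this
  obtain ⟨M, hM⟩ := Metric.tendsto_atTop.1 h1 (ε / 2) (by positivity)
  refine ⟨M, fun n hn => ?_⟩
  have h2 := hM n hn
  rw [Real.dist_eq, sub_zero] at h2 ⊢
  have h3 : ∀ k ∈ Finset.range (n + 1), |(n.choose k : ℝ) / 2 ^ n * (c k - l)| ≤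
      (if k < N then (n.choose k : ℝ) / 2 ^ n * |c k - l| else 0) +
        (n.choose k : ℝ) / 2 ^ n * (ε / 2) := by
    intro k _
    have hb : 0 ≤ (n.choose k : ℝ) / 2 ^ n := by positivity
    rw [abs_mul, abs_of_nonneg hb]
    split_ifs with h
    · nlinarith
    · have := hN k (not_lt.1 h)
      rw [Real.dist_eq] at this
      rw [zero_add]
      gcongr
  have h4 : ∑ k ∈ Finset.range (n + 1),
      (if k < N then (n.choose k : ℝ) / 2 ^ n * |c k - l| else 0) ≤
      ∑ k ∈ Finset.range N, (n.choose k : ℝ) / 2 ^ n * |c k - l| := by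
    rw [← Finset.sum_filter]
    refine Finset.sum_le_sum_of_subset_of_nonneg (fun k hk => ?_) fun k _ _ => by positivity
    simpa using (Finset.mem_filter.1 hk).2
  refine (Finset.abs_sum_le_sum_abs _ _).trans_lt ((Finset.sum_le_sum h3).trans_lt ?_)
  rw [Finset.sum_add_distrib, ← Finset.sum_mul, sum_choose_div_two_pow]
  have := le_abs_self (∑ k ∈ Finset.range N, (n.choose k : ℝ) / 2 ^ n * |c k - l|)
  linarith

/-- Pascal's rule, read as conditioning on one additional fair coin. -/
lemma sum_choose_succ_div_two_pow (n : ℕ) (c : ℕ → ℝ) :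
    ∑ k ∈ Finset.range (n + 1 + 1), ((n + 1).choose k : ℝ) / 2 ^ (n + 1) * c k =
      (∑ k ∈ Finset.range (n + 1), (n.choose k : ℝ) / 2 ^ n * c k +
        ∑ k ∈ Finset.range (n + 1), (n.choose k : ℝ) / 2 ^ n * c (k + 1)) / 2 := by
  rw [Finset.sum_range_succ']
  simp only [Nat.choose_succ_succ', Nat.choose_zero_right, Nat.cast_add, add_div, add_mul,
    Finset.sum_add_distrib]
  rw [Finset.sum_range_succ (fun k => (n.choose (k + 1) : ℝ) / 2 ^ (n + 1) * c (k + 1)),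
    Finset.sum_range_succ' (fun k => (n.choose k : ℝ) / 2 ^ n * c k)]
  simp only [Nat.choose_succ_self, Nat.cast_zero, zero_div, zero_mul, add_zero,
    Nat.choose_zero_right, Finset.sum_div]
  have : ∀ a b : ℝ, a / 2 ^ (n + 1) * b = a / 2 ^ n * b / 2 := fun a b => by
    rw [pow_succ]; field_simp
  simp only [this, add_div, Finset.sum_div]
  ring

variable {G : Type u} [Group G] [MeasurableSpace G]

/-- The lazy version of `μ`: stay put with probability one half. -/
noncomputable def lazy (μ : Measure G) : Measure G := (2⁻¹ : ℝ≥0∞) • (Measure.dirac 1 + μ)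

instance isProbabilityMeasure_lazy (μ : Measure G) [IsProbabilityMeasure μ] :
    IsProbabilityMeasure (lazy μ) := by
  constructor
  simp only [lazy, Measure.smul_apply, Measure.add_apply, measure_univ, smul_eq_mul]
  rw [one_add_one_eq_two, ENNReal.inv_mul_cancel (by norm_num) (by norm_num)]

variable [Countable G] [DiscreteMeasurableSpace G]

lemma integral_lazy (μ : Measure G) [IsProbabilityMeasure μ] {f : G → ℝ} {C : ℝ}
    (hC : ∀ x, |f x| ≤ C) : ∫ x, f x ∂(lazy μ) = (f 1 + ∫ x, f x ∂μ) / 2 := by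
  have hi : ∀ m : Measure G, IsFiniteMeasure m → Integrable f m := fun m _ =>
    integrable_of_abs_le m Measurable.of_discrete hC
  rw [lazy, integral_smul_measure, integral_add_measure (hi _ inferInstance) (hi _ inferInstance),
    integral_dirac]
  simp
  ring

lemma real_lazy (μ : Measure G) [IsProbabilityMeasure μ] (s : Set G) :
    (lazy μ).real s = ((Measure.dirac (1 : G)).real s + μ.real s) / 2 := by
  rw [lazy, measureReal_ennreal_smul_apply, measureReal_add_apply]
  simp
  ring

lemma integral_convPow_succ (μ : Measure G) [IsProbabilityMeasure μ] (n : ℕ) {f : G → ℝ} {C : ℝ}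
    (hC : ∀ x, |f x| ≤ C) :
    ∫ x, f x ∂(convPow μ (n + 1)) = ∫ x, ∫ g, f (x * g) ∂μ ∂(convPow μ n) := by
  rw [convPow, integral_mconv_of_bdd _ _ hC]

/-- Among `n` lazy steps the number of genuine `μ`-steps is binomial. -/
lemma integral_convPow_lazy (μ : Measure G) [IsProbabilityMeasure μ] (n : ℕ) {f : G → ℝ} {C : ℝ}
    (hC : ∀ x, |f x| ≤ C) :
    ∫ x, f x ∂(convPow (lazy μ) n) =
      ∑ k ∈ Finset.range (n + 1), (n.choose k : ℝ) / 2 ^ n * ∫ x, f x ∂(convPow μ k) := by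
  induction n generalizing f with
  | zero => simp [convPow]
  | succ n ih =>
    have hC' : ∀ x, |∫ g, f (x * g) ∂μ| ≤ C := fun x => abs_integral_le_of_abs_le μ fun g => hC _
    have hi : ∀ h : G → ℝ, (∀ x, |h x| ≤ C) → Integrable h (convPow (lazy μ) n) := fun h hh =>
      integrable_of_abs_le _ Measurable.of_discrete hh
    rw [integral_convPow_succ _ _ hC, sum_choose_succ_div_two_pow]
    simp only [integral_lazy μ (fun g => hC _), mul_one]
    rw [integral_div, integral_add (hi _ hC) (hi _ hC'), ih hC, ih hC']
    simp only [integral_convPow_succ μ _ hC]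

lemma abs_integral_convPow_lazy_succ_sub_le (μ : Measure G) [IsProbabilityMeasure μ] (n : ℕ)
    {f : G → ℝ} {C : ℝ} (hC : ∀ x, |f x| ≤ C) :
    |∫ x, f x ∂(convPow (lazy μ) (n + 1)) - ∫ x, f x ∂(convPow (lazy μ) n)| ≤
      C / √(n + 1 : ℝ) := by
  rw [integral_convPow_lazy μ _ hC, integral_convPow_lazy μ _ hC]
  exact abs_sum_choose_sub_le n _ fun k => abs_integral_le_of_abs_le _ hC

end Lazy

/-! ### Random subgroups and right cosets -/

section Cosets

variable {G : Type u} [Group G]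

lemma measurableSet_mem_subgroup (g : G) : MeasurableSet {K : Subgroup G | g ∈ K} := by
  refine ⟨{A : Set G | g ∈ A}, ?_, rfl⟩
  exact measurableSet_setOfPred.2 (measurable_set_mem g)

lemma measurable_subgroup_iff {α : Type*} [MeasurableSpace α] {f : α → Subgroup G}
    (hf : ∀ g, MeasurableSet {a | g ∈ f a}) : Measurable f := by
  refine measurable_comap_iff.2 ?_
  refine measurable_set_iff.2 fun g => ?_
  exact measurableSet_setOfPred.1 (hf g)

lemma mem_conj_smul (g w : G) (K : Subgroup G) : w ∈ MulAut.conj g • K ↔ g⁻¹ * w * g ∈ K := by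
  rw [Subgroup.mem_pointwise_smul_iff_inv_smul_mem, ← map_inv, MulAut.smul_def,
    MulAut.conj_apply, inv_inv]

lemma measurable_conj_smul (g : G) : Measurable (fun K : Subgroup G => MulAut.conj g • K) := by
  refine measurable_subgroup_iff fun w => ?_
  simp only [mem_conj_smul]
  exact measurableSet_mem_subgroup _

lemma lintegral_conj_smul {lam : Measure (Subgroup G)} (hlam : ConjInvariant lam) (g : G)
    {f : Subgroup G → ℝ≥0∞} (hf : Measurable f) :
    ∫⁻ K, f (MulAut.conj g • K) ∂lam = ∫⁻ K, f K ∂lam := by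
  conv_rhs => rw [← hlam g]
  rw [lintegral_map hf (measurable_conj_smul g)]

/-- The right coset `K z`. -/
def rightCoset (K : Subgroup G) (z : G) : Set G := {w | w * z⁻¹ ∈ K}

lemma rightCoset_eq {K : Subgroup G} {w z : G} (h : w * z⁻¹ ∈ K) :
    rightCoset K w = rightCoset K z := by
  ext y
  have : y * z⁻¹ = y * w⁻¹ * (w * z⁻¹) := by group
  simp only [rightCoset, Set.mem_ofPred_eq, this]
  exact (K.mul_mem_cancel_right h).symm

lemma mem_rightCoset_self (K : Subgroup G) (z : G) : z ∈ rightCoset K z := by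
  simp [rightCoset]

lemma mem_rightCoset_comm {K : Subgroup G} {w z : G} :
    w ∈ rightCoset K z ↔ z ∈ rightCoset K w := by
  simp only [rightCoset, Set.mem_ofPred_eq]
  rw [← K.inv_mem_iff]
  simp

variable [Countable G] [MeasurableSpace G] [DiscreteMeasurableSpace G]

lemma measurable_measure_rightCoset (ω : Measure G) [SFinite ω] :
    Measurable (fun p : Subgroup G × G => ω (rightCoset p.1 p.2)) := by
  refine measurable_from_prod_countable_left fun z => ?_
  have hs : MeasurableSet {p : Subgroup G × G | p.2 * z⁻¹ ∈ p.1} := by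
    have : {p : Subgroup G × G | p.2 * z⁻¹ ∈ p.1} =
        ⋃ w : G, {K : Subgroup G | w * z⁻¹ ∈ K} ×ˢ {w} := by
      ext ⟨K, w⟩
      simp
    rw [this]
    exact MeasurableSet.iUnion fun w =>
      (measurableSet_mem_subgroup _).prod (MeasurableSet.of_discrete)
  exact measurable_measure_prodMk_left hs

/-- If `ω' ≤ ω`, then `ω'` has density `ω' (K z) / ω (K z)` on the right cosets of `K`. -/
lemma lintegral_rightCoset_div_mul (ω ω' : Measure G) [IsFiniteMeasure ω] [IsFiniteMeasure ω']
    (hle : ω' ≤ ω) (K : Subgroup G) {b : G → ℝ≥0∞} (hb : ∀ w z, w * z⁻¹ ∈ K → b w = b z) :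
    ∫⁻ z, ω' (rightCoset K z) / ω (rightCoset K z) * b z ∂ω = ∫⁻ y, b y ∂ω' := by
  have h1 : ∀ z, ω' (rightCoset K z) / ω (rightCoset K z) * b z =
      ∫⁻ y, (rightCoset K y).indicator (fun _ => b y / ω (rightCoset K y)) z ∂ω' := by
    intro z
    have : ∀ y, (rightCoset K y).indicator (fun _ => b y / ω (rightCoset K y)) z =
        (rightCoset K z).indicator (fun _ => b z / ω (rightCoset K z)) y := by
      intro y
      by_cases h : z ∈ rightCoset K y
      · rw [Set.indicator_of_mem h, Set.indicator_of_mem (mem_rightCoset_comm.1 h), hb z y h,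
          rightCoset_eq h]
      · rw [Set.indicator_of_notMem h,
          Set.indicator_of_notMem (fun h' => h (mem_rightCoset_comm.1 h'))]
    simp only [this]
    rw [lintegral_indicator_const .of_discrete]
    simp only [div_eq_mul_inv]
    ring
  simp only [h1]
  -- Being in the same coset is symmetric, so after the swap the inner integral is the mass of one
  -- coset, which cancels the denominator.
  rw [lintegral_lintegral_swap (by exact (Measurable.of_discrete).aemeasurable)]
  refine lintegral_congr_ae ?_
  -- The quotient may be 0/0 on some cosets; only atoms of `ω'` matter here, and their cosets have
  -- positive `ω`-mass.
  rw [Filter.EventuallyEq, ae_iff_of_countable]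
  intro y hy
  rw [lintegral_indicator_const .of_discrete]
  refine ENNReal.div_mul_cancel ?_ (measure_ne_top _ _)
  intro h0
  refine hy (le_antisymm ?_ bot_le)
  calc ω' {y} ≤ ω {y} := hle _
    _ ≤ ω (rightCoset K y) := measure_mono (by simpa using mem_rightCoset_self K y)
    _ = 0 := h0

/-! ### Backward probabilities of the first increment -/

section Steps

variable (μ : Measure G)

/-- The law of the position at time `n + 1` on the event that the first increment is `g`. -/
noncomputable def firstStep (n : ℕ) (g : G) : Measure G :=
  μ {g} • (convPow μ n).map (fun y => g * y)

variable [IsProbabilityMeasure μ]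

instance isFiniteMeasure_firstStep (n : ℕ) (g : G) : IsFiniteMeasure (firstStep μ n g) := by
  constructor
  rw [firstStep, Measure.smul_apply, Measure.map_apply .of_discrete .univ]
  simp

lemma lintegral_firstStep (n : ℕ) (g : G) (f : G → ℝ≥0∞) :
    ∫⁻ z, f z ∂(firstStep μ n g) = μ {g} * ∫⁻ y, f (g * y) ∂(convPow μ n) := by
  rw [firstStep, lintegral_smul_measure, lintegral_map .of_discrete .of_discrete, smul_eq_mul]

lemma lintegral_convPow_succ' (n : ℕ) (f : G → ℝ≥0∞) :
    ∫⁻ z, f z ∂(convPow μ (n + 1)) = ∑' g, ∫⁻ z, f z ∂(firstStep μ n g) := by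
  rw [convPow_succ', Measure.lintegral_mconv .of_discrete, lintegral_countable']
  simp only [lintegral_firstStep]
  exact tsum_congr fun g => mul_comm _ _

lemma firstStep_le (n : ℕ) (g : G) : firstStep μ n g ≤ convPow μ (n + 1) := by
  refine Measure.le_iff.2 fun s hs => ?_
  rw [← lintegral_indicator_one hs, ← lintegral_indicator_one hs, lintegral_convPow_succ']
  exact ENNReal.le_tsum g

/-- The conditional probability that the first increment is `g`, given `K` and that the coset at
time `n + 1` is `K z`. -/
noncomputable def backProb (n : ℕ) (g : G) (K : Subgroup G) (z : G) : ℝ :=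
  (firstStep μ n g (rightCoset K z) / convPow μ (n + 1) (rightCoset K z)).toReal

lemma backProb_div_le_one (n : ℕ) (g : G) (K : Subgroup G) (z : G) :
    firstStep μ n g (rightCoset K z) / convPow μ (n + 1) (rightCoset K z) ≤ 1 :=
  ENNReal.div_le_of_le_mul (by rw [one_mul]; exact firstStep_le μ n g _)

lemma ofReal_backProb (n : ℕ) (g : G) (K : Subgroup G) (z : G) :
    ENNReal.ofReal (backProb μ n g K z) =
      firstStep μ n g (rightCoset K z) / convPow μ (n + 1) (rightCoset K z) :=
  ENNReal.ofReal_toReal ((backProb_div_le_one μ n g K z).trans_lt ENNReal.one_lt_top).ne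

lemma backProb_nonneg (n : ℕ) (g : G) (K : Subgroup G) (z : G) : 0 ≤ backProb μ n g K z :=
  ENNReal.toReal_nonneg

lemma backProb_le_one (n : ℕ) (g : G) (K : Subgroup G) (z : G) : backProb μ n g K z ≤ 1 :=
  ENNReal.toReal_le_of_le_ofReal zero_le_one (by simpa using backProb_div_le_one μ n g K z)

lemma backProb_congr (n : ℕ) (g : G) {K : Subgroup G} {w z : G} (h : w * z⁻¹ ∈ K) :
    backProb μ n g K w = backProb μ n g K z := by
  simp only [backProb, rightCoset_eq h]

lemma measurable_backProb (n : ℕ) (g : G) :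
    Measurable (fun p : Subgroup G × G => backProb μ n g p.1 p.2) :=
  ((measurable_measure_rightCoset _).div (measurable_measure_rightCoset _)).ennreal_toReal

/-- Bayes' formula, tested against functions of the coset. -/
lemma lintegral_backProb_mul (n : ℕ) (g : G) (K : Subgroup G) {b : G → ℝ≥0∞}
    (hb : ∀ w z, w * z⁻¹ ∈ K → b w = b z) :
    ∫⁻ z, ENNReal.ofReal (backProb μ n g K z) * b z ∂(convPow μ (n + 1)) =
      ∫⁻ z, b z ∂(firstStep μ n g) := by
  simp only [ofReal_backProb]
  exact lintegral_rightCoset_div_mul _ _ (firstStep_le μ n g) K hb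

lemma integral_backProb_mul (n : ℕ) (g : G) (K : Subgroup G) {b : G → ℝ}
    (hb : ∀ w z, w * z⁻¹ ∈ K → b w = b z) (hb0 : ∀ z, 0 ≤ b z) :
    ∫ z, backProb μ n g K z * b z ∂(convPow μ (n + 1)) =
      μ.real {g} * ∫ y, b (g * y) ∂(convPow μ n) := by
  rw [integral_eq_lintegral_of_nonneg_ae
      (ae_of_all _ fun z => mul_nonneg (backProb_nonneg μ n g K z) (hb0 z))
      (Measurable.of_discrete).aestronglyMeasurable,
    integral_eq_lintegral_of_nonneg_ae (ae_of_all _ fun z => hb0 _)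
      (Measurable.of_discrete).aestronglyMeasurable, Measure.real, ← ENNReal.toReal_mul]
  congr 1
  rw [← lintegral_firstStep μ n g (fun z => ENNReal.ofReal (b z)),
    ← lintegral_backProb_mul μ n g K (fun w z h => by rw [hb w z h])]
  exact lintegral_congr fun z => ENNReal.ofReal_mul (backProb_nonneg μ n g K z)

/-- The backward probability at time `n + 1`, integrated against a function of the coset at a later
time. -/
lemma integral_backProb_mul_integral (n m : ℕ) (g : G) (K : Subgroup G) {b : G → ℝ} {C : ℝ}
    (hb : ∀ w z, w * z⁻¹ ∈ K → b w = b z) (hb0 : ∀ z, 0 ≤ b z) (hC : ∀ z, |b z| ≤ C) :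
    ∫ z, backProb μ n g K z * ∫ y, b (z * y) ∂(convPow μ m) ∂(convPow μ (n + 1)) =
      μ.real {g} * ∫ y, b (g * y) ∂(convPow μ (n + m)) := by
  rw [integral_backProb_mul μ n g K (b := fun z => ∫ y, b (z * y) ∂(convPow μ m))]
  · congr 1
    have hadd : convPow μ (n + m) = Measure.mconv (convPow μ n) (convPow μ m) := by
      induction m with
      | zero => simp [convPow]
      | succ m ih => rw [← add_assoc, convPow, ih, convPow, Measure.mconv_assoc]
    rw [hadd, integral_mconv_of_bdd _ _ (fun z => hC (g * z))]
    simp only [mul_assoc]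
  · intro w z h
    refine integral_congr_ae (ae_of_all _ fun y => hb _ _ ?_)
    simpa [mul_assoc] using h
  · exact fun z => integral_nonneg fun y => hb0 _

end Steps

/-! ### The entropy chain rule on a coset space -/

section Entropy

lemma ofReal_negMulLog {x : ℝ} (h0 : 0 ≤ x) :
    ENNReal.ofReal (Real.negMulLog x) = ENNReal.ofReal x * ENNReal.ofReal (-Real.log x) := by
  rw [← ENNReal.ofReal_mul h0, Real.negMulLog]
  congr 1
  ring

lemma entropy_eq_lintegral {W : Type u} [Countable W] [MeasurableSpace W]
    [MeasurableSingletonClass W] (ω : Measure W) [IsFiniteMeasure ω] :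
    entropy ω = ∫⁻ w, ENNReal.ofReal (-Real.log (ω.real {w})) ∂ω := by
  rw [lintegral_countable', entropy]
  refine tsum_congr fun w => ?_
  rw [ofReal_negMulLog measureReal_nonneg, mul_comm, Measure.real,
    ENNReal.ofReal_toReal (measure_ne_top _ _)]

variable (μ : Measure G) [IsProbabilityMeasure μ]

instance discreteMeasurableSpace_cosetSpace (K : Subgroup G) :
    DiscreteMeasurableSpace (CosetSpace K) := by
  constructor
  intro s
  exact MeasurableSet.of_discrete (s := Quotient.mk (QuotientGroup.rightRel K) ⁻¹' s)

lemma entropy_cosetLaw (K : Subgroup G) (n : ℕ) :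
    entropy (cosetLaw μ K n) =
      ∫⁻ z, ENNReal.ofReal (-Real.log ((convPow μ n).real (rightCoset K z))) ∂(convPow μ n) := by
  have hm : Measurable (Quotient.mk (QuotientGroup.rightRel K)) := Measurable.of_discrete
  have : IsProbabilityMeasure (cosetLaw μ K n) :=
    Measure.isProbabilityMeasure_map hm.aemeasurable
  rw [entropy_eq_lintegral]
  conv_lhs => rw [cosetLaw]
  rw [lintegral_map .of_discrete hm]
  refine lintegral_congr fun z => ?_
  rw [measureReal_def, Measure.map_apply hm .of_discrete, measureReal_def]
  congr 4
  congr 1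
  ext w
  simp only [Set.mem_preimage, Set.mem_singleton_iff, rightCoset, Set.mem_ofPred_eq]
  rw [Quotient.eq, QuotientGroup.rightRel_apply, ← K.inv_mem_iff]
  simp

lemma measurable_entropy_cosetLaw (n : ℕ) :
    Measurable (fun K : Subgroup G => entropy (cosetLaw μ K n)) := by
  simp only [entropy_cosetLaw]
  refine Measurable.lintegral_prod_right' (f := fun p : Subgroup G × G =>
    ENNReal.ofReal (-Real.log ((convPow μ n).real (rightCoset p.1 p.2)))) ?_
  exact ((measurable_measure_rightCoset _).ennreal_toReal.log.neg).ennreal_ofReal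

lemma neg_log_nonneg {x : ℝ} (h0 : 0 ≤ x) (h1 : x ≤ 1) : 0 ≤ -Real.log x :=
  neg_nonneg.2 (Real.log_nonpos h0 h1)

/-- The chain rule for the first increment and the coset at time `n + 1`. -/
lemma entropy_chain_rule (K : Subgroup G) (n : ℕ) :
    entropy μ + ∑' g, μ {g} * entropy (cosetLaw μ (MulAut.conj g⁻¹ • K) n) =
      entropy (cosetLaw μ K (n + 1)) +
        ∑' g, ∫⁻ z, ENNReal.ofReal (Real.negMulLog (backProb μ n g K z)) ∂(convPow μ (n + 1)) := by
  have h1 : ∀ g, ∫⁻ z, ENNReal.ofReal (Real.negMulLog (backProb μ n g K z)) ∂(convPow μ (n + 1)) =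
      ∫⁻ z, ENNReal.ofReal (-Real.log (backProb μ n g K z)) ∂(firstStep μ n g) := by
    intro g
    rw [← lintegral_backProb_mul μ n g K (fun w z h => by rw [backProb_congr μ n g h])]
    exact lintegral_congr fun z => ofReal_negMulLog (backProb_nonneg μ n g K z)
  simp only [h1]
  rw [entropy_cosetLaw, lintegral_convPow_succ', entropy_eq_lintegral, lintegral_countable',
    ← ENNReal.tsum_add, ← ENNReal.tsum_add]
  refine tsum_congr fun g => ?_
  rw [← lintegral_add_left .of_discrete]
  -- The chain rule holds pointwise: both sides are minus the logarithm of the joint probability of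
  -- the first increment `g` and the coset `K g y`, factored in the two possible orders.
  have h2 : ∀ y : G, convPow μ n {y} ≠ 0 → μ {g} ≠ 0 →
      ENNReal.ofReal (-Real.log ((convPow μ (n + 1)).real (rightCoset K (g * y)))) +
        ENNReal.ofReal (-Real.log (backProb μ n g K (g * y))) =
      ENNReal.ofReal (-Real.log (μ.real {g})) + ENNReal.ofReal
        (-Real.log ((convPow μ n).real (rightCoset (MulAut.conj g⁻¹ • K) y))) := by
    intro y hy hg
    -- Undoing the first step turns K g y into (g⁻¹Kg) y; this is where the conjugated subgroup
    -- comes from.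
    have hset : (fun y' => g * y') ⁻¹' (rightCoset K (g * y)) =
        rightCoset (MulAut.conj g⁻¹ • K) y := by
      ext w
      simp only [Set.mem_preimage, rightCoset, Set.mem_ofPred_eq, mem_conj_smul]
      simp [mul_assoc]
    have hf : firstStep μ n g (rightCoset K (g * y)) =
        μ {g} * convPow μ n (rightCoset (MulAut.conj g⁻¹ • K) y) := by
      rw [firstStep, Measure.smul_apply, Measure.map_apply .of_discrete .of_discrete, hset,
        smul_eq_mul]
    have hq : 0 < convPow μ n (rightCoset (MulAut.conj g⁻¹ • K) y) :=
      (pos_iff_ne_zero.2 hy).trans_le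
        (measure_mono (by simpa using mem_rightCoset_self _ y))
    have hfpos : 0 < firstStep μ n g (rightCoset K (g * y)) := by
      rw [hf]
      exact ENNReal.mul_pos hg hq.ne'
    have hcpos : 0 < convPow μ (n + 1) (rightCoset K (g * y)) :=
      hfpos.trans_le (firstStep_le μ n g _)
    have hcr : 0 < (convPow μ (n + 1)).real (rightCoset K (g * y)) :=
      ENNReal.toReal_pos hcpos.ne' (measure_ne_top _ _)
    have hgr : 0 < μ.real {g} := ENNReal.toReal_pos hg (measure_ne_top _ _)
    have hqr : 0 < (convPow μ n).real (rightCoset (MulAut.conj g⁻¹ • K) y) :=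
      ENNReal.toReal_pos hq.ne' (measure_ne_top _ _)
    rw [← ENNReal.ofReal_add (neg_log_nonneg measureReal_nonneg measureReal_le_one)
        (neg_log_nonneg (backProb_nonneg μ n g K _) (backProb_le_one μ n g K _)),
      ← ENNReal.ofReal_add (neg_log_nonneg measureReal_nonneg measureReal_le_one)
        (neg_log_nonneg measureReal_nonneg measureReal_le_one)]
    congr 1
    have hb : backProb μ n g K (g * y) = μ.real {g} *
        (convPow μ n).real (rightCoset (MulAut.conj g⁻¹ • K) y) /
          (convPow μ (n + 1)).real (rightCoset K (g * y)) := by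
      rw [backProb, ENNReal.toReal_div, hf, ENNReal.toReal_mul]
      rfl
    rw [hb, Real.log_div (mul_pos hgr hqr).ne' hcr.ne', Real.log_mul hgr.ne' hqr.ne']
    ring
  rw [lintegral_firstStep, entropy_cosetLaw]
  by_cases hg : μ {g} = 0
  · simp [hg]
  have h3 : ∫⁻ y, (ENNReal.ofReal (-Real.log ((convPow μ (n + 1)).real (rightCoset K (g * y)))) +
        ENNReal.ofReal (-Real.log (backProb μ n g K (g * y)))) ∂(convPow μ n) =
      ∫⁻ y, (ENNReal.ofReal (-Real.log (μ.real {g})) + ENNReal.ofReal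
        (-Real.log ((convPow μ n).real (rightCoset (MulAut.conj g⁻¹ • K) y)))) ∂(convPow μ n) := by
    refine lintegral_congr_ae ?_
    rw [Filter.EventuallyEq, ae_iff_of_countable]
    exact fun y hy => h2 y hy hg
  rw [h3, lintegral_add_left measurable_const, lintegral_const, measure_univ, mul_one, mul_add]
  congr 1
  exact mul_comm _ _

/-- Dropping the nonnegative conditional entropy in the chain rule shows that each step adds at most
`entropy μ`. The induction must range over all `K`, since the subgroup gets conjugated. -/
lemma entropy_cosetLaw_le (K : Subgroup G) (n : ℕ) :
    entropy (cosetLaw μ K n) ≤ n * entropy μ := by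
  induction n generalizing K with
  | zero =>
    rw [entropy_cosetLaw, convPow, lintegral_dirac]
    simp [measureReal_def, Set.indicator_of_mem (mem_rightCoset_self K 1)]
  | succ n ih =>
    calc entropy (cosetLaw μ K (n + 1)) ≤ _ := le_self_add
      _ = entropy μ + ∑' g, μ {g} * entropy (cosetLaw μ (MulAut.conj g⁻¹ • K) n) :=
        (entropy_chain_rule μ K n).symm
      _ ≤ entropy μ + ∑' g, μ {g} * (n * entropy μ) := by
        gcongr with g
        exact ih _
      _ = (n + 1 : ℕ) * entropy μ := by
        have : ∑' g, μ {g} = 1 := by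
          have h := lintegral_countable' (μ := μ) (fun _ => 1)
          simp only [one_mul, lintegral_const, measure_univ, mul_one] at h
          exact h.symm
        rw [ENNReal.tsum_mul_right, this]
        push_cast
        ring

end Entropy

end Cosets

/-! ### Conditional Jensen and sequences with decreasing increments -/

section Jensen

lemma negMulLog_le_one {x : ℝ} (h0 : 0 ≤ x) : Real.negMulLog x ≤ 1 := by
  rcases h0.eq_or_lt with rfl | h
  · simp
  · have h1 := mul_le_mul_of_nonneg_left (Real.one_sub_inv_le_log_of_pos h) h0
    rw [mul_sub, mul_inv_cancel₀ h.ne'] at h1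
    rw [Real.negMulLog]
    linarith

lemma abs_negMulLog_le_one {x : ℝ} (h0 : 0 ≤ x) (h1 : x ≤ 1) : |Real.negMulLog x| ≤ 1 := by
  rw [abs_of_nonneg (Real.negMulLog_nonneg h0 h1)]
  exact negMulLog_le_one h0

/-- The hypothesis `h` says V = E[U | V], so this is conditional Jensen for the concave function -x
log x: conditioning on less raises entropy. It is applied with `V` a later backward probability, a
constant, and a boundary density. -/
lemma integral_negMulLog_le {α : Type*} [MeasurableSpace α] (P : Measure α) [IsProbabilityMeasure P]
    {U V : α → ℝ} (hU : Measurable U) (hV : Measurable V) (hU0 : ∀ x, 0 ≤ U x) (hU1 : ∀ x, U x ≤ 1)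
    (hV0 : ∀ᵐ x ∂P, 0 ≤ V x) (hV1 : ∀ᵐ x ∂P, V x ≤ 1)
    (h : ∀ C : Set ℝ, MeasurableSet C → ∫ x in V ⁻¹' C, U x ∂P = ∫ x in V ⁻¹' C, V x ∂P) :
    ∫ x, Real.negMulLog (U x) ∂P ≤ ∫ x, Real.negMulLog (V x) ∂P := by
  have hUi : Integrable U P := Integrable.of_bound hU.aestronglyMeasurable 1
    (ae_of_all _ fun x => by rw [Real.norm_eq_abs, abs_of_nonneg (hU0 x)]; exact hU1 x)
  have hVi : Integrable V P := Integrable.of_bound hV.aestronglyMeasurable 1 (by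
    filter_upwards [hV0, hV1] with x h0 h1
    rwa [Real.norm_eq_abs, abs_of_nonneg h0])
  have hUn : Integrable (Real.negMulLog ∘ U) P := Integrable.of_bound
    (Real.continuous_negMulLog.measurable.comp hU).aestronglyMeasurable 1
    (ae_of_all _ fun x => abs_negMulLog_le_one (hU0 x) (hU1 x))
  have hVn : Integrable (Real.negMulLog ∘ V) P := Integrable.of_bound
    (Real.continuous_negMulLog.measurable.comp hV).aestronglyMeasurable 1 (by
    filter_upwards [hV0, hV1] with x h0 h1
    exact abs_negMulLog_le_one h0 h1)
  have hm : MeasurableSpace.comap V inferInstance ≤ (inferInstance : MeasurableSpace α) :=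
    hV.comap_le
  have hc : V =ᵐ[P] P[U | MeasurableSpace.comap V inferInstance] := by
    refine ae_eq_condExp_of_forall_setIntegral_eq hm hUi (fun s _ _ => hVi.integrableOn) ?_
      (comap_measurable V).stronglyMeasurable.aestronglyMeasurable
    rintro _ ⟨C, hC, rfl⟩ -
    exact (h C hC).symm
  have hj := Real.concaveOn_negMulLog.condExp_map_le (μ := P) (f := U) hm
    (Real.continuous_negMulLog.upperSemicontinuous.upperSemicontinuousOn _)
    (ae_of_all _ fun x => hU0 x) isClosed_Ici hUi hUn
  change ∫ x, (Real.negMulLog ∘ U) x ∂P ≤ _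
  rw [← integral_condExp hm (f := Real.negMulLog ∘ U)]
  refine integral_mono_ae integrable_condExp hVn ?_
  filter_upwards [hj, hc] with x h1 h2
  simpa [h2] using h1

/-- Averages of a sequence with decreasing increments. -/
lemma exists_limit_of_antitone_increments (a : ℕ → ℝ) (h0 : a 0 = 0)
    (hd : Antitone fun n => a (n + 1) - a n) {c : ℝ} (hc : ∀ n, c ≤ a (n + 1) - a n) :
    ∃ L, c ≤ L ∧ Tendsto (fun n => a (n + 1) - a n) atTop (𝓝 L) ∧
      (∀ n, n * L ≤ a n) ∧ Tendsto (fun n : ℕ => (1 / (n : ℝ)) * a n) atTop (𝓝 L) ∧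
      IsGLB {x : ℝ | ∃ n : ℕ, 1 ≤ n ∧ x = (1 / (n : ℝ)) * a n} L ∧
      IsGLB {x : ℝ | ∃ n : ℕ, x = a (n + 1) - a n} L := by
  have hbdd : BddBelow (Set.range fun n => a (n + 1) - a n) := ⟨c, by rintro _ ⟨n, rfl⟩; exact hc n⟩
  obtain ⟨L, hL⟩ : ∃ L, Tendsto (fun n => a (n + 1) - a n) atTop (𝓝 L) :=
    ⟨_, tendsto_atTop_ciInf hd hbdd⟩
  have hle : ∀ n, L ≤ a (n + 1) - a n := fun n => hd.le_of_tendsto hL n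
  have hmul : ∀ n : ℕ, n * L ≤ a n := by
    intro n
    induction n with
    | zero => simp [h0]
    | succ n ih =>
      have := hle n
      push_cast
      linarith
  have hces : Tendsto (fun n : ℕ => (1 / (n : ℝ)) * a n) atTop (𝓝 L) := by
    refine hL.cesaro.congr fun n => ?_
    rw [Finset.sum_range_sub, h0, sub_zero, one_div]
  have hdiv : ∀ n : ℕ, 1 ≤ n → L ≤ (1 / (n : ℝ)) * a n := fun n hn => by
    have : (0 : ℝ) < n := by exact_mod_cast hn
    rw [one_div, ← div_eq_inv_mul, le_div_iff₀ this, mul_comm]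
    exact hmul n
  refine ⟨L, ge_of_tendsto' hL hc, hL, hmul, hces, ⟨?_, ?_⟩, ⟨?_, ?_⟩⟩
  · rintro _ ⟨n, hn, rfl⟩
    exact hdiv n hn
  · intro b hb
    refine ge_of_tendsto hces ?_
    filter_upwards [eventually_ge_atTop 1] with n hn
    exact hb ⟨n, hn, rfl⟩
  · rintro _ ⟨n, rfl⟩
    exact hle n
  · exact fun b hb => ge_of_tendsto' hL fun n => hb ⟨n, rfl⟩

end Jensen

/-! ### Backward martingale and monotonicity of the entropy increments -/

section Increments

variable {G : Type u} [Group G] [Countable G] [MeasurableSpace G] [DiscreteMeasurableSpace G]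
  (μ : Measure G) [IsProbabilityMeasure μ]

lemma integral_position_mul (j m : ℕ) {b c : G → ℝ} {B C : ℝ} (hB : ∀ z, |b z| ≤ B)
    (hC : ∀ z, |c z| ≤ C) :
    ∫ x, c (position x j) * b (position x (j + m)) ∂(Measure.infinitePi (fun _ : ℕ => μ)) =
      ∫ z, c z * ∫ y, b (z * y) ∂(convPow μ m) ∂(convPow μ j) := by
  have hbm : Measurable b := Measurable.of_discrete
  have hcm : Measurable c := Measurable.of_discrete
  have hm : Measurable (fun x : ℕ → G => c (position x j) * b (position x (j + m))) :=
    (hcm.comp (measurable_position j)).mul (hbm.comp (measurable_position _))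
  rw [integral_glue μ j (integrable_of_abs_le _ hm (C := C * B) fun x => by
    rw [abs_mul]
    exact mul_le_mul (hC _) (hB _) (abs_nonneg _) ((abs_nonneg _).trans (hC 1)))]
  have h0 : ∀ x y : ℕ → G, position (glue j x y) j = position x j := fun x y => by
    simpa [position] using position_glue j 0 x y
  simp only [position_glue, h0]
  conv_rhs => rw [← map_position μ j, ← map_position μ m]
  rw [integral_map (measurable_position j).aemeasurable (Measurable.of_discrete).aestronglyMeasurable]
  refine integral_congr_ae (ae_of_all _ fun x => ?_)
  simp only
  rw [integral_const_mul, integral_map (measurable_position m).aemeasurable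
    (Measurable.of_discrete).aestronglyMeasurable]

variable (lam : Measure (Subgroup G)) [IsProbabilityMeasure lam]

/-- The law of the pair of a random subgroup and the sequence of increments. -/
noncomputable abbrev walkLaw : Measure (Subgroup G × (ℕ → G)) :=
  lam.prod (Measure.infinitePi (fun _ : ℕ => μ))

lemma measurable_walk (n : ℕ) :
    Measurable (fun ω : Subgroup G × (ℕ → G) => (ω.1, position ω.2 n)) :=
  measurable_fst.prodMk ((measurable_position n).comp measurable_snd)

lemma map_walk (n : ℕ) :
    (walkLaw μ lam).map (fun ω => (ω.1, position ω.2 n)) = lam.prod (convPow μ n) := by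
  have h := Measure.map_prod_map lam (Measure.infinitePi (fun _ : ℕ => μ)) measurable_id
    (measurable_position (G := G) n)
  rw [map_position, Measure.map_id] at h
  exact h.symm

lemma integral_walk (n : ℕ) {f : Subgroup G × G → ℝ} (hf : Measurable f) {C : ℝ}
    (hC : ∀ p, |f p| ≤ C) :
    ∫ ω, f (ω.1, position ω.2 n) ∂(walkLaw μ lam) =
      ∫ K, ∫ z, f (K, z) ∂(convPow μ n) ∂lam := by
  rw [← integral_prod _ (integrable_of_abs_le _ hf hC), ← map_walk,
    integral_map (measurable_walk n).aemeasurable hf.aestronglyMeasurable]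

lemma lintegral_walk (n : ℕ) {f : Subgroup G × G → ℝ≥0∞} (hf : Measurable f) :
    ∫⁻ ω, f (ω.1, position ω.2 n) ∂(walkLaw μ lam) =
      ∫⁻ K, ∫⁻ z, f (K, z) ∂(convPow μ n) ∂lam := by
  rw [← lintegral_prod _ hf.aemeasurable, ← map_walk, lintegral_map hf (measurable_walk n)]

/-- The conditional probability that the first increment is `g`, given `K` and the coset of the
position at time `n + 1`. -/
noncomputable def backMartingale (n : ℕ) (g : G) (ω : Subgroup G × (ℕ → G)) : ℝ :=
  backProb μ n g ω.1 (position ω.2 (n + 1))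

lemma measurable_backMartingale (n : ℕ) (g : G) : Measurable (backMartingale μ n g) := by
  have h := (measurable_backProb μ n g).comp (measurable_walk (G := G) (n + 1))
  exact h

lemma backMartingale_nonneg (n : ℕ) (g : G) (ω : Subgroup G × (ℕ → G)) : 0 ≤ backMartingale μ n g ω :=
  backProb_nonneg μ n g _ _

lemma backMartingale_le_one (n : ℕ) (g : G) (ω : Subgroup G × (ℕ → G)) : backMartingale μ n g ω ≤ 1 :=
  backProb_le_one μ n g _ _

/-- The backward process, integrated against a function of the coset at a later time. -/
lemma integral_backMartingale_mul (n m : ℕ) (g : G) {b : Subgroup G × G → ℝ} (hbm : Measurable b)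
    {C : ℝ} (hb : ∀ K w z, w * z⁻¹ ∈ K → b (K, w) = b (K, z)) (hb0 : ∀ p, 0 ≤ b p)
    (hC : ∀ p, b p ≤ C) :
    ∫ ω, backMartingale μ n g ω * b (ω.1, position ω.2 (n + m + 1)) ∂(walkLaw μ lam) =
      μ.real {g} * ∫ K, ∫ y, b (K, g * y) ∂(convPow μ (n + m)) ∂lam := by
  have hC' : ∀ p, |b p| ≤ C := fun p => by rw [abs_of_nonneg (hb0 p)]; exact hC p
  have hu : ∀ K z, |backProb μ n g K z| ≤ 1 := fun K z => by
    rw [abs_of_nonneg (backProb_nonneg μ n g K z)]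
    exact backProb_le_one μ n g K z
  have hm : Measurable fun ω : Subgroup G × (ℕ → G) =>
      backMartingale μ n g ω * b (ω.1, position ω.2 (n + m + 1)) :=
    (measurable_backMartingale μ n g).mul (hbm.comp (measurable_walk _))
  rw [integral_prod _ (integrable_of_abs_le _ hm (C := 1 * C) fun ω => by
      rw [abs_mul]
      exact mul_le_mul (hu _ _) (hC' _) (abs_nonneg _) zero_le_one), ← integral_const_mul]
  refine integral_congr_ae (ae_of_all _ fun K => ?_)
  simp only [backMartingale]
  rw [show n + m + 1 = n + 1 + m by ring]
  have := integral_position_mul μ (n + 1) m (b := fun z => b (K, z)) (c := backProb μ n g K)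
    (fun z => hC' _) (hu K)
  rw [this]
  exact integral_backProb_mul_integral μ n m g K (b := fun z => b (K, z)) (hb K) (fun z => hb0 _)
    (fun z => hC' _)

/-- The expected entropy contribution of the first increment being `g`, given the coset at time
`n + 1`. -/
noncomputable def backEntropy (n : ℕ) (g : G) : ℝ :=
  ∫ ω, Real.negMulLog (backMartingale μ n g ω) ∂(walkLaw μ lam)

/-- The backward probability at one time is the conditional expectation of the preceding one:
against an indicator depending on the later coset, `integral_backMartingale_mul` with delays 1 and 0
gives the same value. -/
lemma monotone_backEntropy (g : G) : Monotone fun n => backEntropy μ lam n g := by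
  refine monotone_nat_of_le_succ fun n => ?_
  refine integral_negMulLog_le _ (measurable_backMartingale μ n g) (measurable_backMartingale μ (n + 1) g)
    (backMartingale_nonneg μ n g) (backMartingale_le_one μ n g)
    (ae_of_all _ (backMartingale_nonneg μ (n + 1) g)) (ae_of_all _ (backMartingale_le_one μ (n + 1) g))
    fun C hC => ?_
  have hs : MeasurableSet (backMartingale μ (n + 1) g ⁻¹' C) := measurable_backMartingale μ (n + 1) g hC
  rw [← integral_indicator hs, ← integral_indicator hs]
  set b : Subgroup G × G → ℝ := fun p => Set.indicator C (fun _ => 1) (backProb μ (n + 1) g p.1 p.2)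
    with hbdef
  have hbm : Measurable b :=
    (measurable_const.indicator hC).comp (measurable_backProb μ (n + 1) g)
  have hb : ∀ K w z, w * z⁻¹ ∈ K → b (K, w) = b (K, z) := fun K w z h => by
    simp only [hbdef, backProb_congr μ (n + 1) g h]
  have hb0 : ∀ p, 0 ≤ b p := fun p => Set.indicator_nonneg (fun _ _ => zero_le_one) _
  have hb1 : ∀ p, b p ≤ 1 := fun p => Set.indicator_le' (fun _ _ => le_rfl)
    (fun _ _ => zero_le_one) _
  have h1 := integral_backMartingale_mul μ lam n 1 g hbm hb hb0 hb1
  have h2 := integral_backMartingale_mul μ lam (n + 1) 0 g hbm hb hb0 hb1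
  rw [add_zero] at h2
  rw [← h2] at h1
  have key : ∀ f : Subgroup G × (ℕ → G) → ℝ, ∀ ω,
      (backMartingale μ (n + 1) g ⁻¹' C).indicator f ω =
        f ω * b (ω.1, position ω.2 (n + 1 + 1)) := by
    intro f ω
    by_cases h : backMartingale μ (n + 1) g ω ∈ C
    · rw [Set.indicator_of_mem (show ω ∈ backMartingale μ (n + 1) g ⁻¹' C from h)]
      change f ω = f ω * C.indicator (fun _ => (1 : ℝ)) (backMartingale μ (n + 1) g ω)
      rw [Set.indicator_of_mem h, mul_one]
    · rw [Set.indicator_of_notMem (show ω ∉ backMartingale μ (n + 1) g ⁻¹' C from h)]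
      change 0 = f ω * C.indicator (fun _ => (1 : ℝ)) (backMartingale μ (n + 1) g ω)
      rw [Set.indicator_of_notMem h, mul_zero]
  simp only [key]
  exact h1

variable {μ lam}

lemma cosetEntropy_le (hH : entropy μ < ∞) (n : ℕ) (K : Subgroup G) :
    cosetEntropy μ n K ≤ n * (entropy μ).toReal := by
  rw [cosetEntropy]
  have := ENNReal.toReal_mono (ENNReal.mul_ne_top (ENNReal.natCast_ne_top n) hH.ne)
    (entropy_cosetLaw_le μ K n)
  simpa using this

lemma measurable_cosetEntropy (n : ℕ) : Measurable (cosetEntropy μ n) :=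
  (measurable_entropy_cosetLaw μ n).ennreal_toReal

lemma integrable_cosetEntropy (hH : entropy μ < ∞) (n : ℕ) : Integrable (cosetEntropy μ n) lam :=
  integrable_of_abs_le _ (measurable_cosetEntropy n) fun K => by
    rw [abs_of_nonneg (show 0 ≤ cosetEntropy μ n K from ENNReal.toReal_nonneg)]
    exact cosetEntropy_le hH n K

lemma entropy_cosetLaw_lt_top (hH : entropy μ < ∞) (n : ℕ) (K : Subgroup G) :
    entropy (cosetLaw μ K n) < ∞ :=
  (entropy_cosetLaw_le μ K n).trans_lt (ENNReal.mul_lt_top (ENNReal.natCast_lt_top n) hH)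

lemma lintegral_entropy_cosetLaw (hH : entropy μ < ∞) (n : ℕ) :
    ∫⁻ K, entropy (cosetLaw μ K n) ∂lam = ENNReal.ofReal (∫ K, cosetEntropy μ n K ∂lam) := by
  rw [ofReal_integral_eq_lintegral_ofReal (integrable_cosetEntropy hH n)
    (ae_of_all _ fun K => ENNReal.toReal_nonneg)]
  exact lintegral_congr fun K => (ENNReal.ofReal_toReal (entropy_cosetLaw_lt_top hH n K).ne).symm

lemma integral_cosetEntropy_zero : ∫ K, cosetEntropy μ 0 K ∂lam = 0 := by
  have : ∀ K : Subgroup G, cosetEntropy μ 0 K = 0 := fun K => by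
    have := entropy_cosetLaw_le μ K 0
    simp only [Nat.cast_zero, zero_mul, nonpos_iff_eq_zero] at this
    simp [cosetEntropy, this]
  simp [this]

/-- This is the chain rule integrated over `lam`. Conjugation invariance removes the conjugation by
the first increment, and finite entropy allows the passage from extended to real subtraction. -/
lemma hasSum_backEntropy (hH : entropy μ < ∞) (hlam : ConjInvariant lam) (n : ℕ) :
    HasSum (backEntropy μ lam n) ((entropy μ).toReal -
      (∫ K, cosetEntropy μ (n + 1) K ∂lam - ∫ K, cosetEntropy μ n K ∂lam)) := by
  have hJ : ∀ g, ∫⁻ K, ∫⁻ z, ENNReal.ofReal (Real.negMulLog (backProb μ n g K z))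
      ∂(convPow μ (n + 1)) ∂lam = ENNReal.ofReal (backEntropy μ lam n g) := by
    intro g
    have hm : Measurable (fun p : Subgroup G × G => Real.negMulLog (backProb μ n g p.1 p.2)) :=
      Real.continuous_negMulLog.measurable.comp (measurable_backProb μ n g)
    have hm' : Measurable fun ω => Real.negMulLog (backMartingale μ n g ω) :=
      Real.continuous_negMulLog.measurable.comp (measurable_backMartingale μ n g)
    rw [backEntropy, ofReal_integral_eq_lintegral_ofReal (integrable_of_abs_le _ hm' (C := 1) fun ω =>
        abs_negMulLog_le_one (backMartingale_nonneg μ n g ω) (backMartingale_le_one μ n g ω))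
      (ae_of_all _ fun ω => Real.negMulLog_nonneg (backMartingale_nonneg μ n g ω)
        (backMartingale_le_one μ n g ω)),
      ← lintegral_walk μ lam (n + 1) hm.ennreal_ofReal]
    rfl
  have hJ0 : ∀ g, 0 ≤ backEntropy μ lam n g := fun g => integral_nonneg fun ω =>
    Real.negMulLog_nonneg (backMartingale_nonneg μ n g ω) (backMartingale_le_one μ n g ω)
  have hchain : entropy μ + ∫⁻ K, entropy (cosetLaw μ K n) ∂lam =
      ∫⁻ K, entropy (cosetLaw μ K (n + 1)) ∂lam +
        ∑' g, ENNReal.ofReal (backEntropy μ lam n g) := by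
    have h := lintegral_congr (μ := lam) fun K => entropy_chain_rule μ K n
    have hmg : ∀ g : G, Measurable fun K : Subgroup G =>
        μ {g} * entropy (cosetLaw μ (MulAut.conj g⁻¹ • K) n) := fun g =>
      ((measurable_entropy_cosetLaw μ n).comp (measurable_conj_smul g⁻¹)).const_mul _
    have hmz : ∀ g : G, Measurable fun K : Subgroup G =>
        ∫⁻ z, ENNReal.ofReal (Real.negMulLog (backProb μ n g K z)) ∂(convPow μ (n + 1)) := fun g =>
      Measurable.lintegral_prod_right' (f := fun p : Subgroup G × G =>
        ENNReal.ofReal (Real.negMulLog (backProb μ n g p.1 p.2)))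
        (Real.continuous_negMulLog.measurable.comp (measurable_backProb μ n g)).ennreal_ofReal
    rw [lintegral_add_left measurable_const, lintegral_const, measure_univ, mul_one,
      lintegral_tsum (fun g => (hmg g).aemeasurable),
      lintegral_add_left (measurable_entropy_cosetLaw μ (n + 1)),
      lintegral_tsum (fun g => (hmz g).aemeasurable)] at h
    simp only [hJ] at h
    rw [← h]
    congr 1
    have hg : ∀ g : G, ∫⁻ K, μ {g} * entropy (cosetLaw μ (MulAut.conj g⁻¹ • K) n) ∂lam =
        μ {g} * ∫⁻ K, entropy (cosetLaw μ K n) ∂lam := fun g => by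
      have hm : Measurable fun K : Subgroup G => entropy (cosetLaw μ (MulAut.conj g⁻¹ • K) n) :=
        (measurable_entropy_cosetLaw μ n).comp (measurable_conj_smul g⁻¹)
      rw [lintegral_const_mul _ hm,
        lintegral_conj_smul hlam g⁻¹ (measurable_entropy_cosetLaw μ n)]
    simp only [hg]
    have h1 := lintegral_countable' (μ := μ) (fun _ => ∫⁻ K, entropy (cosetLaw μ K n) ∂lam)
    simp only [lintegral_const, measure_univ, mul_one] at h1
    conv_lhs => rw [h1]
    exact tsum_congr fun g => mul_comm _ _
  rw [lintegral_entropy_cosetLaw hH, lintegral_entropy_cosetLaw hH] at hchain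
  have hfin : ∑' g, ENNReal.ofReal (backEntropy μ lam n g) ≠ ∞ := by
    intro htop
    rw [htop, add_top] at hchain
    exact (ENNReal.add_lt_top.2 ⟨hH, ENNReal.ofReal_lt_top⟩).ne hchain
  have hnn : ∀ k, 0 ≤ ∫ K, cosetEntropy μ k K ∂lam := fun k =>
    integral_nonneg fun K => ENNReal.toReal_nonneg
  have hs : Summable (backEntropy μ lam n) := by
    have := ENNReal.summable_toReal hfin
    simpa only [ENNReal.toReal_ofReal (hJ0 _)] using this
  have ht := congrArg ENNReal.toReal hchain
  rw [ENNReal.toReal_add hH.ne ENNReal.ofReal_ne_top, ENNReal.toReal_add ENNReal.ofReal_ne_top hfin,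
    ENNReal.toReal_ofReal (hnn _), ENNReal.toReal_ofReal (hnn _),
    ← ENNReal.ofReal_tsum_of_nonneg hJ0 hs, ENNReal.toReal_ofReal (tsum_nonneg hJ0)] at ht
  have := hs.hasSum
  rwa [show ∑' g, backEntropy μ lam n g = (entropy μ).toReal -
      (∫ K, cosetEntropy μ (n + 1) K ∂lam - ∫ K, cosetEntropy μ n K ∂lam) by linarith] at this

lemma antitone_integral_cosetEntropy_sub (hH : entropy μ < ∞) (hlam : ConjInvariant lam) :
    Antitone fun n : ℕ => ∫ K, cosetEntropy μ (n + 1) K ∂lam - ∫ K, cosetEntropy μ n K ∂lam := by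
  refine antitone_nat_of_succ_le fun n => ?_
  have := hasSum_le (fun g => monotone_backEntropy μ lam g n.le_succ)
    (hasSum_backEntropy hH hlam n) (hasSum_backEntropy hH hlam (n + 1))
  linarith

end Increments

/-! ### The space of coset paths -/

section Paths

variable {G : Type u} [Group G]

lemma op_smul_eq_rightCoset (K : Subgroup G) (z : G) :
    MulOpposite.op z • (K : Set G) = rightCoset K z := by
  ext w
  rw [Set.mem_smul_set_iff_inv_smul_mem, ← MulOpposite.op_inv, op_smul_eq_mul]
  rfl

/-- The path of cosets `(K; K z₀, K z₁, …)`. -/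
def cosetPath (K : Subgroup G) (z : ℕ → G) : CosetPath G :=
  ⟨(K, fun n => MulOpposite.op (z n) • (K : Set G)), fun n => ⟨z n, rfl⟩⟩

lemma toCosetPath_eq (ω : Subgroup G × (ℕ → G)) :
    toCosetPath ω = cosetPath ω.1 (position ω.2) := rfl

lemma cosetPath_congr {K : Subgroup G} {w z : ℕ → G} (h : ∀ n, w n * (z n)⁻¹ ∈ K) :
    cosetPath K w = cosetPath K z := by
  refine Subtype.ext (Prod.ext rfl (funext fun n => ?_))
  simp only [cosetPath, op_smul_eq_rightCoset]
  exact rightCoset_eq (h n)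

lemma smul_cosetPath (g : G) (K : Subgroup G) (z : ℕ → G) :
    g • cosetPath K z = cosetPath (MulAut.conj g • K) (fun n => g * z n) := by
  refine Subtype.ext (Prod.ext rfl (funext fun n => ?_))
  change g • (MulOpposite.op (z n) • (K : Set G)) =
    MulOpposite.op (g * z n) • ((MulAut.conj g • K : Subgroup G) : Set G)
  rw [op_smul_eq_rightCoset, op_smul_eq_rightCoset]
  ext w
  rw [Set.mem_smul_set_iff_inv_smul_mem]
  simp only [rightCoset, Set.mem_ofPred_eq, mem_conj_smul, smul_eq_mul]
  simp [mul_assoc]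

lemma shift_cosetPath (K : Subgroup G) (z : ℕ → G) :
    shift (cosetPath K z) = cosetPath K (fun n => z (n + 1)) := rfl

lemma measurable_cosetPath_iff {α : Type*} [MeasurableSpace α] {f : α → CosetPath G}
    (h1 : Measurable fun a => (f a).1.1)
    (h2 : ∀ n g, MeasurableSet {a | g ∈ (f a).1.2 n}) : Measurable f := by
  refine Measurable.subtype_mk (h1.prodMk (measurable_pi_lambda _ fun n => ?_))
  exact measurable_set_iff.2 fun g => measurableSet_setOfPred.1 (h2 n g)

lemma measurable_fst_cosetPath : Measurable fun p : CosetPath G => p.1.1 :=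
  measurable_fst.comp measurable_subtype_coe

lemma measurableSet_mem_cosetPath (n : ℕ) (g : G) :
    MeasurableSet {p : CosetPath G | g ∈ p.1.2 n} := by
  have : Measurable fun p : CosetPath G => p.1.2 n :=
    (measurable_pi_apply n).comp (measurable_snd.comp measurable_subtype_coe)
  exact this (measurableSet_setOfPred.2 (measurable_set_mem g))

lemma measurable_smul_cosetPath (g : G) : Measurable (fun p : CosetPath G => g • p) := by
  refine measurable_cosetPath_iff ((measurable_conj_smul g).comp measurable_fst_cosetPath)
    fun n w => ?_
  have : {p : CosetPath G | w ∈ (g • p).1.2 n} = {p : CosetPath G | g⁻¹ * w ∈ p.1.2 n} := by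
    ext p
    change w ∈ g • p.1.2 n ↔ _
    rw [Set.mem_smul_set_iff_inv_smul_mem]
    rfl
  rw [this]
  exact measurableSet_mem_cosetPath n _

variable [Countable G] [MeasurableSpace G] [DiscreteMeasurableSpace G]

lemma measurable_cosetPath :
    Measurable (fun p : Subgroup G × (ℕ → G) => cosetPath p.1 p.2) := by
  refine measurable_cosetPath_iff measurable_fst fun n w => ?_
  have : {p : Subgroup G × (ℕ → G) | w ∈ (cosetPath p.1 p.2).1.2 n} =
      ⋃ z : G, {K : Subgroup G | w * z⁻¹ ∈ K} ×ˢ {x : ℕ → G | x n = z} := by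
    ext ⟨K, x⟩
    simp only [cosetPath, op_smul_eq_rightCoset]
    simp [rightCoset]
  rw [this]
  refine MeasurableSet.iUnion fun z => (measurableSet_mem_subgroup _).prod ?_
  have hz : Measurable fun x : ℕ → G => x n := measurable_pi_apply n
  exact hz (MeasurableSet.of_discrete (s := {z}))

lemma measurable_toCosetPath : Measurable (toCosetPath : Subgroup G × (ℕ → G) → CosetPath G) := by
  have h : Measurable fun ω : Subgroup G × (ℕ → G) => (ω.1, position ω.2) :=
    measurable_fst.prodMk (measurable_position'.comp measurable_snd)
  exact measurable_cosetPath.comp h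

/-! ### Expectations of path functionals from a given starting point -/

section StartExp

variable (μ : Measure G) [IsProbabilityMeasure μ]

/-- The expectation of a functional of the random walk started at `z`. -/
noncomputable def startExp (ψ : (ℕ → G) → ℝ) (z : G) : ℝ :=
  ∫ y, ψ (fun i => z * position y i) ∂(Measure.infinitePi (fun _ : ℕ => μ))

lemma measurable_mul_position (z : G) :
    Measurable (fun y : ℕ → G => fun i => z * position y i) :=
  measurable_pi_lambda _ fun i => (measurable_position i).const_mul z

lemma abs_startExp_le {ψ : (ℕ → G) → ℝ} {C : ℝ} (hC : ∀ z, |ψ z| ≤ C) (z : G) :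
    |startExp μ ψ z| ≤ C :=
  abs_integral_le_of_abs_le _ fun _ => hC _

lemma startExp_nonneg {ψ : (ℕ → G) → ℝ} (hC : ∀ z, 0 ≤ ψ z) (z : G) : 0 ≤ startExp μ ψ z :=
  integral_nonneg fun _ => hC _

/-- The Markov property. -/
lemma startExp_drop {ψ : (ℕ → G) → ℝ} (hψ : Measurable ψ) {C : ℝ} (hC : ∀ z, |ψ z| ≤ C) (j : ℕ)
    (z : G) :
    startExp μ (fun w => ψ (fun i => w (j + i))) z =
      ∫ x, startExp μ ψ (z * x) ∂(convPow μ j) := by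
  have hd : Measurable (fun w : ℕ → G => fun i => w (j + i)) :=
    measurable_pi_lambda _ fun i => measurable_pi_apply _
  have hm : Measurable fun y : ℕ → G => ψ (fun i => z * position y (j + i)) :=
    hψ.comp (hd.comp (measurable_mul_position z))
  rw [startExp, integral_glue μ j (integrable_of_abs_le _ hm fun _ => hC _), ← map_position μ j,
    integral_map (measurable_position j).aemeasurable (Measurable.of_discrete).aestronglyMeasurable]
  simp only [position_glue, startExp, mul_assoc]

lemma convPow_one : convPow μ 1 = μ := by
  simp [convPow]

lemma measurable_startExp {ψ : Subgroup G → (ℕ → G) → ℝ}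
    (hψ : Measurable fun p : Subgroup G × (ℕ → G) => ψ p.1 p.2) :
    Measurable fun p : Subgroup G × G => startExp μ (ψ p.1) p.2 := by
  refine measurable_from_prod_countable_left fun z => ?_
  have hm : Measurable fun p : Subgroup G × (ℕ → G) => ψ p.1 (fun i => z * position p.2 i) :=
    hψ.comp (measurable_fst.prodMk ((measurable_mul_position z).comp measurable_snd))
  exact hm.stronglyMeasurable.integral_prod_right.measurable

end StartExp

/-! ### Invariant events and their harmonic functions -/

section HitProb

variable (μ : Measure G) [IsProbabilityMeasure μ]

/-- The probability that the walk on `K \ G` started at `K z` follows a path in `A`. -/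
noncomputable def hitProb (A : Set (CosetPath G)) (p : Subgroup G × G) : ℝ :=
  startExp μ (fun w => A.indicator (fun _ => (1 : ℝ)) (cosetPath p.1 w)) p.2

variable {A : Set (CosetPath G)}

lemma indicator_one_nonneg {α : Type*} (A : Set α) (x : α) :
    0 ≤ A.indicator (fun _ => (1 : ℝ)) x := Set.indicator_nonneg (fun _ _ => zero_le_one) x

lemma indicator_one_le_one {α : Type*} (A : Set α) (x : α) :
    A.indicator (fun _ => (1 : ℝ)) x ≤ 1 :=
  Set.indicator_le' (fun _ _ => le_rfl) (fun _ _ => zero_le_one) x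

lemma abs_indicator_one_le {α : Type*} (A : Set α) (x : α) :
    |A.indicator (fun _ => (1 : ℝ)) x| ≤ 1 := by
  rw [abs_of_nonneg (indicator_one_nonneg A x)]
  exact indicator_one_le_one A x

lemma abs_hitProb_le (p : Subgroup G × G) : |hitProb μ A p| ≤ 1 :=
  abs_startExp_le μ (fun _ => abs_indicator_one_le A _) p.2

lemma hitProb_nonneg (p : Subgroup G × G) : 0 ≤ hitProb μ A p :=
  startExp_nonneg μ (fun _ => indicator_one_nonneg A _) p.2

lemma hitProb_le_one (p : Subgroup G × G) : hitProb μ A p ≤ 1 :=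
  (le_abs_self _).trans (abs_hitProb_le μ p)

lemma measurable_indicator_cosetPath (hA : MeasurableSet A) :
    Measurable fun p : Subgroup G × (ℕ → G) =>
      A.indicator (fun _ => (1 : ℝ)) (cosetPath p.1 p.2) :=
  (measurable_const.indicator hA).comp measurable_cosetPath

lemma measurable_indicator_cosetPath_right (hA : MeasurableSet A) (K : Subgroup G) :
    Measurable fun w : ℕ → G => A.indicator (fun _ => (1 : ℝ)) (cosetPath K w) :=
  (measurable_indicator_cosetPath hA).comp measurable_prodMk_left

lemma measurable_hitProb (hA : MeasurableSet A) : Measurable (hitProb μ A) :=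
  measurable_startExp μ (ψ := fun K w => A.indicator (fun _ => (1 : ℝ)) (cosetPath K w))
    (measurable_indicator_cosetPath hA)

lemma hitProb_congr (K : Subgroup G) (w z : G) (h : w * z⁻¹ ∈ K) :
    hitProb μ A (K, w) = hitProb μ A (K, z) := by
  refine integral_congr_ae (ae_of_all _ fun y => ?_)
  change A.indicator (fun _ => (1 : ℝ)) (cosetPath K _) =
    A.indicator (fun _ => (1 : ℝ)) (cosetPath K _)
  rw [cosetPath_congr fun n => ?_]
  simpa [mul_assoc] using h

lemma shift_iterate_cosetPath (K : Subgroup G) (j : ℕ) (w : ℕ → G) :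
    shift^[j] (cosetPath K w) = cosetPath K (fun i => w (j + i)) := by
  induction j generalizing w with
  | zero => simp
  | succ j ih =>
    rw [Function.iterate_succ_apply, shift_cosetPath, ih]
    congr 1
    funext i
    congr 1
    ring

lemma mem_shift_iterate_iff (hA : MeasurableSet[MeasurableSpace.invariants shift] A)
    (K : Subgroup G) (j : ℕ) (w : ℕ → G) :
    cosetPath K w ∈ A ↔ cosetPath K (fun i => w (j + i)) ∈ A := by
  have := (MeasurableSpace.le_invariants_iterate shift j A hA).2
  rw [← shift_iterate_cosetPath]
  conv_lhs => rw [← this]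
  rfl

lemma indicator_drop (hA : MeasurableSet[MeasurableSpace.invariants shift] A)
    (K : Subgroup G) (j : ℕ) (w : ℕ → G) :
    A.indicator (fun _ => (1 : ℝ)) (cosetPath K w) =
      A.indicator (fun _ => (1 : ℝ)) (cosetPath K (fun i => w (j + i))) := by
  by_cases h : cosetPath K w ∈ A
  · rw [Set.indicator_of_mem h, Set.indicator_of_mem ((mem_shift_iterate_iff hA K j w).1 h)]
  · rw [Set.indicator_of_notMem h,
      Set.indicator_of_notMem (fun h' => h ((mem_shift_iterate_iff hA K j w).2 h'))]

/-- Dropping the first `j` positions does not affect membership in an invariant event, so the Markov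
property makes the hitting probability harmonic. -/
lemma integral_hitProb_convPow (hA : MeasurableSet[MeasurableSpace.invariants shift] A) (j : ℕ)
    (K : Subgroup G) (z : G) :
    ∫ x, hitProb μ A (K, z * x) ∂(convPow μ j) = hitProb μ A (K, z) := by
  rw [hitProb]
  simp only [hitProb]
  rw [← startExp_drop μ (measurable_indicator_cosetPath_right hA.1 K)
    (fun _ => abs_indicator_one_le A _) j z]
  exact integral_congr_ae (ae_of_all _ fun y =>
    (indicator_drop hA K j (fun i => z * position y i)).symm)

lemma integral_hitProb (hA : MeasurableSet[MeasurableSpace.invariants shift] A)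
    (K : Subgroup G) (z : G) :
    ∫ x, hitProb μ A (K, z * x) ∂μ = hitProb μ A (K, z) := by
  have := integral_hitProb_convPow μ hA 1 K z
  rwa [convPow_one] at this

variable (lam : Measure (Subgroup G)) [IsProbabilityMeasure lam]

lemma ae_walkLaw_of_forall {p : Subgroup G × (ℕ → G) → Prop}
    (hp : MeasurableSet {ω | p ω})
    (h : ∀ K, ∀ᵐ x ∂(Measure.infinitePi (fun _ : ℕ => μ)), p (K, x)) :
    ∀ᵐ ω ∂(walkLaw μ lam), p ω :=
  (Measure.ae_prod_iff_ae_ae hp).2 (ae_of_all _ h)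

lemma ae_tendsto_hitProb (hA : MeasurableSet[MeasurableSpace.invariants shift] A) :
    ∀ᵐ ω ∂(walkLaw μ lam), Tendsto (fun j => hitProb μ A (ω.1, position ω.2 j)) atTop
      (𝓝 (A.indicator (fun _ => (1 : ℝ)) (toCosetPath ω))) := by
  refine ae_walkLaw_of_forall μ lam (measurableSet_tendsto_fun (fun j =>
      (measurable_hitProb μ hA.1).comp (measurable_walk j))
    ((measurable_const.indicator hA.1).comp measurable_toCosetPath)) fun K => ?_
  exact tendsto_tail μ (fun _ w => A.indicator (fun _ => (1 : ℝ)) (cosetPath K w))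
    (fun _ => measurable_indicator_cosetPath_right hA.1 K) (fun _ _ => abs_indicator_one_le A _)
    (fun j w => indicator_drop hA K j w)

variable {lam}

/-- The translate by `g` of the walk on K\G from K is the walk on the cosets of gKg⁻¹ from (gKg⁻¹)g;
conjugation invariance renames gKg⁻¹ as K. -/
lemma real_map_smul_pathLaw (hlam : ConjInvariant lam) (hA : MeasurableSet A) (g : G) :
    ((pathLaw μ lam).map (fun p => g • p)).real A = ∫ K, hitProb μ A (K, g) ∂lam := by
  have hms := measurable_smul_cosetPath (G := G) g
  have hmA : MeasurableSet ((fun p : CosetPath G => g • p) ⁻¹' A) := hms hA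
  have hf : Measurable fun K : Subgroup G => hitProb μ A (K, g) :=
    (measurable_hitProb μ hA).comp measurable_prodMk_right
  have h1 : ∫ K, hitProb μ A (K, g) ∂lam = ∫ K, hitProb μ A (MulAut.conj g • K, g) ∂lam := by
    conv_lhs => rw [← hlam g]
    rw [integral_map (measurable_conj_smul g).aemeasurable hf.aestronglyMeasurable]
  have hind : Measurable fun ω : Subgroup G × (ℕ → G) =>
      A.indicator (fun _ => (1 : ℝ)) (g • toCosetPath ω) :=
    (measurable_const.indicator hA).comp (hms.comp measurable_toCosetPath)
  rw [h1, measureReal_def, Measure.map_apply hms hA, pathLaw,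
    Measure.map_apply measurable_toCosetPath hmA, ← measureReal_def,
    ← integral_indicator_one (measurable_toCosetPath hmA)]
  change ∫ ω, A.indicator (fun _ => (1 : ℝ)) (g • toCosetPath ω) ∂(walkLaw μ lam) = _
  rw [integral_prod _ (integrable_of_abs_le _ hind fun ω => abs_indicator_one_le A _)]
  refine integral_congr_ae (ae_of_all _ fun K => ?_)
  simp only [toCosetPath_eq, smul_cosetPath, hitProb, startExp]

end HitProb

/-! ### Upper limits of coset functions as invariant path functions -/

section Lift

/-- The value on a right coset of a function that is constant on right cosets. -/
noncomputable def cosetValue (v : Subgroup G × G → ℝ) (K : Subgroup G) (S : Set G) : ℝ :=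
  ⨆ g : G, S.indicator (fun g => v (K, g)) g

/-- Nonnegativity is essential: outside the coset the indicator contributes 0 to the supremum, which
must not exceed the value on the coset. -/
lemma cosetValue_rightCoset {v : Subgroup G × G → ℝ} (hv0 : ∀ p, 0 ≤ v p)
    (hv : ∀ K w z, w * z⁻¹ ∈ K → v (K, w) = v (K, z)) (K : Subgroup G) (z : G) :
    cosetValue v K (rightCoset K z) = v (K, z) := by
  have hle : ∀ g, (rightCoset K z).indicator (fun g => v (K, g)) g ≤ v (K, z) := by
    intro g
    by_cases h : g ∈ rightCoset K z
    · rw [Set.indicator_of_mem h, hv K g z h]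
    · rw [Set.indicator_of_notMem h]
      exact hv0 _
  refine le_antisymm (ciSup_le hle) ?_
  refine le_trans (le_of_eq ?_) (le_ciSup ⟨_, by rintro _ ⟨g, rfl⟩; exact hle g⟩ z)
  rw [Set.indicator_of_mem (mem_rightCoset_self K z)]

/-- The upper limit along a path of cosets of a function that is constant on right cosets. -/
noncomputable def pathLimsup (v : Subgroup G × G → ℝ) (p : CosetPath G) : ℝ :=
  limsup (fun n => cosetValue v p.1.1 (p.1.2 n)) atTop

lemma pathLimsup_shift (v : Subgroup G × G → ℝ) (p : CosetPath G) :
    pathLimsup v (shift p) = pathLimsup v p :=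
  limsup_nat_add (fun n => cosetValue v p.1.1 (p.1.2 n)) 1

lemma measurable_pathLimsup {v : Subgroup G × G → ℝ} (hv : Measurable v) :
    Measurable (pathLimsup v) := by
  refine Measurable.limsup fun n => Measurable.iSup fun g => ?_
  have h : Measurable fun p : CosetPath G => v (p.1.1, g) :=
    hv.comp (measurable_fst_cosetPath.prodMk measurable_const)
  exact h.indicator (measurableSet_mem_cosetPath n g)

lemma measurable_invariants_pathLimsup {v : Subgroup G × G → ℝ} (hv : Measurable v) :
    Measurable[MeasurableSpace.invariants shift] (pathLimsup v) :=
  MeasurableSpace.measurable_invariants_dom.2 ⟨measurable_pathLimsup hv, fun s _ => by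
    rw [show pathLimsup v ∘ shift = pathLimsup v from funext (pathLimsup_shift v)]⟩

lemma pathLimsup_cosetPath {v : Subgroup G × G → ℝ} (hv0 : ∀ p, 0 ≤ v p)
    (hv : ∀ K w z, w * z⁻¹ ∈ K → v (K, w) = v (K, z)) (K : Subgroup G) (w : ℕ → G) :
    pathLimsup v (cosetPath K w) = limsup (fun n => v (K, w n)) atTop := by
  simp only [pathLimsup, cosetPath, op_smul_eq_rightCoset, cosetValue_rightCoset hv0 hv]

end Lift

end Paths

/-! ### Almost everywhere convergence of backward processes -/

lemma limsup_mem_Icc {a : ℕ → ℝ} {c d : ℝ} (hc : ∀ n, c ≤ a n) (hd : ∀ n, a n ≤ d) :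
    limsup a atTop ∈ Set.Icc c d := by
  have h1 : IsBoundedUnder (· ≤ ·) atTop a := isBoundedUnder_of ⟨d, hd⟩
  have h2 : IsBoundedUnder (· ≥ ·) atTop a := isBoundedUnder_of ⟨c, hc⟩
  exact ⟨le_limsup_of_frequently_le (Frequently.of_forall hc) h1,
    limsup_le_of_le h2.isCoboundedUnder_le (Eventually.of_forall hd)⟩

/-- A bounded sequence of functions whose pairwise inner products are those of a reversed martingale
has an almost everywhere convergent subsequence. -/
lemma exists_subseq_ae_tendsto {α : Type*} [MeasurableSpace α] (P : Measure α)
    [IsProbabilityMeasure P] (U : ℕ → α → ℝ) (hU : ∀ n, Measurable (U n)) {C : ℝ}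
    (hC : ∀ n x, |U n x| ≤ C)
    (h : ∀ n m, n ≤ m → ∫ x, U n x * U m x ∂P = ∫ x, U m x * U m x ∂P) :
    ∃ φ : ℕ → ℕ, StrictMono φ ∧ ∀ᵐ x ∂P, ∃ l, Tendsto (fun i => U (φ i) x) atTop (𝓝 l) := by
  set c : ℕ → ℝ := fun n => ∫ x, U n x * U n x ∂P with hc
  have hi : ∀ n m, Integrable (fun x => U n x * U m x) P := fun n m =>
    integrable_of_abs_le P ((hU n).mul (hU m)) (C := C * C) fun x => by
      rw [abs_mul]
      exact mul_le_mul (hC n x) (hC m x) (abs_nonneg _) ((abs_nonneg _).trans (hC n x))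
  -- Orthogonality of increments; as the second moments decrease and are bounded below, the sequence
  -- is Cauchy in L².
  have hdist : ∀ n m, n ≤ m → ∫ x, (U n x - U m x) ^ 2 ∂P = c n - c m := by
    intro n m hnm
    have h1 : ∀ x, (U n x - U m x) ^ 2 = U n x * U n x - 2 * (U n x * U m x) + U m x * U m x :=
      fun x => by ring
    simp only [h1]
    have hs : Integrable (fun x => U n x * U n x - 2 * (U n x * U m x)) P :=
      (hi n n).sub ((hi n m).const_mul 2)
    rw [integral_add hs (hi m m), integral_sub (hi n n) ((hi n m).const_mul 2), integral_const_mul, h n m hnm]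
    simp only [hc]
    ring
  have hanti : Antitone c := antitone_nat_of_succ_le fun n => by
    have : 0 ≤ ∫ x, (U n x - U (n + 1) x) ^ 2 ∂P := integral_nonneg fun x => sq_nonneg _
    rw [hdist n _ n.le_succ] at this
    linarith
  have hlim := tendsto_atTop_ciInf hanti
    ⟨0, by rintro _ ⟨n, rfl⟩; exact integral_nonneg fun x => mul_self_nonneg _⟩
  -- Squared L² distances below 4^(-i) become distances below 2^(-i), which are summable.
  obtain ⟨φ, hφ, hφc⟩ := extraction_forall_of_eventually (P := fun i k => c k - ⨅ n, c n < (1 / 4) ^ i)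
    fun i => by
      have := (hlim.sub_const (⨅ n, c n))
      rw [sub_self] at this
      exact this.eventually_lt_const (by positivity)
  refine ⟨φ, hφ, ?_⟩
  have hle : ∀ n, ⨅ n, c n ≤ c n := fun n => hanti.le_of_tendsto hlim n
  have hMem : ∀ n, MemLp (U (φ n)) 2 P := fun n =>
    MemLp.of_bound (hU _).aestronglyMeasurable C (ae_of_all _ (hC _))
  have key : ∀ N n m, N ≤ n → n ≤ m → eLpNorm (U (φ n) - U (φ m)) 2 P < ENNReal.ofReal ((1 / 2) ^ N) := by
    intro N n m hn hm
    rw [((hMem n).sub (hMem m)).eLpNorm_eq_integral_rpow_norm two_ne_zero ENNReal.ofNat_ne_top]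
    have h2 : ∫ a, ‖(U (φ n) - U (φ m)) a‖ ^ (2 : ℝ≥0∞).toReal ∂P = c (φ n) - c (φ m) := by
      rw [← hdist _ _ (hφ.monotone hm)]
      refine integral_congr_ae (ae_of_all _ fun x => ?_)
      simp
    rw [h2]
    refine (ENNReal.ofReal_lt_ofReal_iff (by positivity)).2 ?_
    have h3 : c (φ n) - c (φ m) < (1 / 4) ^ N := by
      have h4 := hφc N
      have h5 := hle (φ m)
      have h6 := hanti (hφ.monotone hn)
      linarith
    have h0 : 0 ≤ c (φ n) - c (φ m) := sub_nonneg.2 (hanti (hφ.monotone hm))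
    rw [ENNReal.toReal_ofNat, ← one_div, ← Real.sqrt_eq_rpow, Real.sqrt_lt' (by positivity)]
    calc _ < _ := h3
      _ = _ := by rw [← pow_mul, mul_comm N 2, pow_mul]; norm_num
  refine Lp.ae_tendsto_of_cauchy_eLpNorm (μ := P) (p := 2) (f := fun n => U (φ n)) (E := ℝ)
    (B := fun N => ENNReal.ofReal ((1 / 2) ^ N)) (fun n => (hU _).aestronglyMeasurable)
    (by norm_num) ?_ ?_
  · rw [← ENNReal.ofReal_tsum_of_nonneg (fun n => by positivity)
      (summable_geometric_of_lt_one (by norm_num) (by norm_num))]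
    exact ENNReal.ofReal_ne_top
  · intro N n m hn hm
    rcases le_total n m with h' | h'
    · exact key N n m hn h'
    · rw [eLpNorm_sub_comm]
      exact key N m n hm h'

/-! ### Tail functionals of the lazy walk and harmonic functions -/

section LazyTail

variable {G : Type u} [Group G] [Countable G] [MeasurableSpace G] [DiscreteMeasurableSpace G]
  (μ : Measure G) [IsProbabilityMeasure μ]

/-- For a lazy walk the expectation of a tail functional does not depend on the time. -/
lemma startExp_lazy_tail {ψ : ℕ → (ℕ → G) → ℝ} (hψm : ∀ j, Measurable (ψ j)) {C : ℝ}
    (hC : ∀ j z, |ψ j z| ≤ C) (hψ : ∀ i j z, ψ i z = ψ (i + j) (fun k => z (j + k))) (j : ℕ) (z : G) :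
    startExp (lazy μ) (ψ j) z = startExp (lazy μ) (ψ 0) z := by
  have hT : ∀ i k, startExp (lazy μ) (ψ i) z =
      ∫ x, startExp (lazy μ) (ψ (i + k)) (z * x) ∂(convPow (lazy μ) k) := by
    intro i k
    rw [← startExp_drop (lazy μ) (hψm _) (hC _)]
    congr 1
    funext w
    exact hψ i k w
  induction j with
  | zero => rfl
  | succ j ih =>
    rw [← ih]
    have hb : ∀ k : ℕ, |startExp (lazy μ) (ψ j) z - startExp (lazy μ) (ψ (j + 1)) z| ≤
        C / √(k + 1 : ℝ) := by
      intro k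
      -- Both expectations now integrate the same function, belonging to the index j + k + 1, once
      -- after k + 1 lazy steps and once after k; only the binomial laws differ.
      rw [hT j (k + 1), hT (j + 1) k, show j + 1 + k = j + (k + 1) by ring]
      exact abs_integral_convPow_lazy_succ_sub_le μ k
        (f := fun x => startExp (lazy μ) (ψ (j + (k + 1))) (z * x))
        fun x => abs_startExp_le (lazy μ) (hC _) _
    have hlim : Tendsto (fun k : ℕ => C / √(k + 1 : ℝ)) atTop (𝓝 0) := by
      refine Tendsto.div_atTop tendsto_const_nhds (Real.tendsto_sqrt_atTop.comp ?_)
      exact tendsto_atTop_add_const_right _ _ tendsto_natCast_atTop_atTop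
    have h0 := ge_of_tendsto' hlim hb
    have := abs_nonpos_iff.1 h0
    linarith

/-- Time independence makes the expectation harmonic for the lazy measure. A function equal to the
average of itself and its `μ`-mean equals its `μ`-mean. -/
lemma integral_startExp_lazy_tail {ψ : ℕ → (ℕ → G) → ℝ} (hψm : ∀ j, Measurable (ψ j)) {C : ℝ}
    (hC : ∀ j z, |ψ j z| ≤ C) (hψ : ∀ i j z, ψ i z = ψ (i + j) (fun k => z (j + k))) (z : G) :
    ∫ x, startExp (lazy μ) (ψ 0) (z * x) ∂μ = startExp (lazy μ) (ψ 0) z := by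
  have h1 : startExp (lazy μ) (ψ 0) z = ∫ x, startExp (lazy μ) (ψ 1) (z * x) ∂(lazy μ) := by
    have h := startExp_drop (lazy μ) (hψm 1) (hC 1) 1 z
    rw [convPow_one] at h
    rw [← h]
    congr 1
    funext w
    simpa using hψ 0 1 w
  simp only [startExp_lazy_tail μ hψm hC hψ 1] at h1
  rw [integral_lazy μ (fun x => abs_startExp_le (lazy μ) (hC 0) _), mul_one] at h1
  linarith

variable (lam : Measure (Subgroup G)) [IsProbabilityMeasure lam]

lemma integral_walk_lazy (n : ℕ) {b : Subgroup G × G → ℝ} (hb : Measurable b) {C : ℝ}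
    (hC : ∀ p, |b p| ≤ C) :
    ∫ ω, b (ω.1, position ω.2 n) ∂(walkLaw (lazy μ) lam) =
      ∑ k ∈ Finset.range (n + 1), (n.choose k : ℝ) / 2 ^ n *
        ∫ ω, b (ω.1, position ω.2 k) ∂(walkLaw μ lam) := by
  rw [integral_walk _ _ n hb hC]
  simp only [integral_walk μ lam _ hb hC, integral_convPow_lazy μ n (fun z => hC (_, z))]
  have hi : ∀ k, Integrable (fun K => ∫ z, b (K, z) ∂(convPow μ k)) lam := fun k =>
    (integrable_of_abs_le (lam.prod (convPow μ k)) hb hC).integral_prod_left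
  rw [integral_finsetSum _ fun k _ => (hi k).const_mul _]
  simp only [integral_const_mul]

/-- The lazy walk is the original one run with a binomial clock. This transfers limits of
expectations between the walks without comparing their path spaces. -/
lemma tendsto_integral_walk_lazy {b : Subgroup G × G → ℝ} (hb : Measurable b) {C : ℝ}
    (hC : ∀ p, |b p| ≤ C) {l : ℝ}
    (h : Tendsto (fun k => ∫ ω, b (ω.1, position ω.2 k) ∂(walkLaw μ lam)) atTop (𝓝 l)) :
    Tendsto (fun n => ∫ ω, b (ω.1, position ω.2 n) ∂(walkLaw (lazy μ) lam)) atTop (𝓝 l) := by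
  simp only [integral_walk_lazy μ lam _ hb hC]
  exact tendsto_sum_choose_mul _ h

lemma tendsto_integral_of_abs_le {α : Type*} [MeasurableSpace α] (P : Measure α)
    [IsProbabilityMeasure P] {f : ℕ → α → ℝ} {F : α → ℝ} (hf : ∀ n, Measurable (f n)) {C : ℝ}
    (hC : ∀ n x, |f n x| ≤ C) (h : ∀ᵐ x ∂P, Tendsto (fun n => f n x) atTop (𝓝 (F x))) :
    Tendsto (fun n => ∫ x, f n x ∂P) atTop (𝓝 (∫ x, F x ∂P)) :=
  tendsto_integral_of_dominated_convergence (fun _ => C) (fun n => (hf n).aestronglyMeasurable)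
    (integrable_const C) (fun n => ae_of_all _ (hC n)) h

/-- Along a subsequence the backward process converges to a tail functional of the walk. -/
lemma exists_tail_limit_backMartingale (g : G) :
    ∃ (φ : ℕ → ℕ) (ψ : Subgroup G → ℕ → (ℕ → G) → ℝ), StrictMono φ ∧
      (∀ j, Measurable fun p : Subgroup G × (ℕ → G) => ψ p.1 j p.2) ∧
      (∀ K j z, ψ K j z ∈ Set.Icc (0 : ℝ) 1) ∧
      (∀ K i j z, ψ K i z = ψ K (i + j) (fun k => z (j + k))) ∧
      (∀ K j w z, (∀ n, w n * (z n)⁻¹ ∈ K) → ψ K j w = ψ K j z) ∧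
      ∀ᵐ ω ∂(walkLaw μ lam), Tendsto (fun i => backMartingale μ (φ i) g ω) atTop
        (𝓝 (ψ ω.1 0 (position ω.2))) := by
  have hU01 : ∀ n ω, |backMartingale μ n g ω| ≤ 1 := fun n ω => by
    rw [abs_of_nonneg (backMartingale_nonneg _ n g ω)]
    exact backMartingale_le_one _ n g ω
  obtain ⟨φ, hφ, hφl⟩ := exists_subseq_ae_tendsto (walkLaw μ lam)
    (fun n => backMartingale μ n g) (fun n => measurable_backMartingale _ n g) hU01 (by
      intro n m hnm
      obtain ⟨k, rfl⟩ := Nat.exists_eq_add_of_le hnm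
      have hbm := measurable_backProb μ (n + k) g
      have h1 := integral_backMartingale_mul μ lam n k g hbm
        (fun K w z h => backProb_congr _ _ g h) (fun p => backProb_nonneg _ _ g _ _)
        (fun p => backProb_le_one _ _ g _ _)
      have h2 := integral_backMartingale_mul μ lam (n + k) 0 g hbm
        (fun K w z h => backProb_congr _ _ g h) (fun p => backProb_nonneg _ _ g _ _)
        (fun p => backProb_le_one _ _ g _ _)
      exact h1.trans h2.symm)
  -- The index `j` counts the positions already dropped from `z`, so the entry read is still the one
  -- of original time φ i + 1. Truncated subtraction affects only finitely many i, hence not the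
  -- upper limit.
  refine ⟨φ, fun K j z => limsup (fun i => backProb μ (φ i) g K (z (φ i + 1 - j))) atTop, hφ,
    fun j => ?_, fun K j z => ?_, fun K i j z => ?_, fun K j w z h => ?_, ?_⟩
  · refine Measurable.limsup fun i => ?_
    have h : Measurable fun p : Subgroup G × (ℕ → G) => (p.1, p.2 (φ i + 1 - j)) :=
      measurable_fst.prodMk ((measurable_pi_apply _).comp measurable_snd)
    have h' := (measurable_backProb μ (φ i) g).comp h
    exact h'
  · exact limsup_mem_Icc (fun i => backProb_nonneg _ _ g _ _) (fun i => backProb_le_one _ _ g _ _)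
  · refine limsup_congr ?_
    filter_upwards [eventually_ge_atTop (i + j)] with k hk
    have := hφ.le_apply (x := k)
    rw [show j + (φ k + 1 - (i + j)) = φ k + 1 - i by omega]
  · exact limsup_congr (Eventually.of_forall fun i => backProb_congr _ _ g (h _))
  · filter_upwards [hφl] with ω ⟨l, hl⟩
    have h := hl.limsup_eq
    simp only [Nat.sub_zero]
    rw [show limsup (fun i => backProb μ (φ i) g ω.1 (position ω.2 (φ i + 1))) atTop = l from h]
    exact hl

/-- A bounded tail functional of the lazy walk is the boundary value of a function that is harmonic
for the original walk. -/
lemma exists_harmonic_of_tail {ψ : Subgroup G → ℕ → (ℕ → G) → ℝ}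
    (hψm : ∀ j, Measurable fun p : Subgroup G × (ℕ → G) => ψ p.1 j p.2)
    (hψ01 : ∀ K j z, ψ K j z ∈ Set.Icc (0 : ℝ) 1)
    (hψtail : ∀ K i j z, ψ K i z = ψ K (i + j) (fun k => z (j + k)))
    (hψK : ∀ K j w z, (∀ n, w n * (z n)⁻¹ ∈ K) → ψ K j w = ψ K j z) :
    ∃ v : Subgroup G × G → ℝ, Measurable v ∧ (∀ p, 0 ≤ v p) ∧ (∀ p, v p ≤ 1) ∧
      (∀ K w z, w * z⁻¹ ∈ K → v (K, w) = v (K, z)) ∧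
      (∀ K z, ∫ x, v (K, z * x) ∂μ = v (K, z)) ∧
      ∀ᵐ ω ∂(walkLaw (lazy μ) lam), Tendsto (fun n => v (ω.1, position ω.2 n)) atTop
        (𝓝 (ψ ω.1 0 (position ω.2))) := by
  have hψabs : ∀ K j z, |ψ K j z| ≤ 1 := fun K j z => by
    rw [abs_of_nonneg (hψ01 K j z).1]
    exact (hψ01 K j z).2
  have hψmK : ∀ K j, Measurable (ψ K j) := fun K j => (hψm j).comp measurable_prodMk_left
  have hvm : Measurable fun p : Subgroup G × G => startExp (lazy μ) (ψ p.1 0) p.2 :=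
    measurable_startExp (lazy μ) (ψ := fun K => ψ K 0) (hψm 0)
  refine ⟨fun p => startExp (lazy μ) (ψ p.1 0) p.2, hvm,
    fun p => startExp_nonneg _ (fun z => (hψ01 _ _ z).1) _,
    fun p => (le_abs_self _).trans (abs_startExp_le _ (fun z => hψabs _ _ z) _), ?_, ?_, ?_⟩
  · intro K w z h
    refine integral_congr_ae (ae_of_all _ fun y => hψK K 0 _ _ fun n => ?_)
    simpa [mul_assoc] using h
  · exact fun K z => integral_startExp_lazy_tail μ (hψmK K) (hψabs K) (hψtail K) z
  · have hfm : Measurable fun ω : Subgroup G × (ℕ → G) => ψ ω.1 0 (position ω.2) := by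
      have h : Measurable fun ω : Subgroup G × (ℕ → G) => (ω.1, position ω.2) :=
        measurable_fst.prodMk (measurable_position'.comp measurable_snd)
      exact (hψm 0).comp h
    refine ae_walkLaw_of_forall _ _ (measurableSet_tendsto_fun
      (fun n => hvm.comp (measurable_walk n)) hfm) fun K => ?_
    have h := tendsto_tail (lazy μ) (ψ K) (hψmK K) (hψabs K) (fun j z => by
      simpa using hψtail K 0 j z)
    filter_upwards [h] with x hx
    refine hx.congr fun j => ?_
    -- The zero-one law yields the expectation of the functional with index `j` from the current
    -- position; time independence replaces that index by 0.
    exact startExp_lazy_tail μ (hψmK K) (hψabs K) (hψtail K) j _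

/-- The backward probabilities of the lazy walk converge to the boundary values of a bounded
harmonic function. -/
lemma exists_harmonic_of_lazy (g : G) :
    ∃ v : Subgroup G × G → ℝ, Measurable v ∧ (∀ p, 0 ≤ v p) ∧ (∀ p, v p ≤ 1) ∧
      (∀ A : Set (CosetPath G), MeasurableSet[MeasurableSpace.invariants shift] A →
        ∫ ω, A.indicator (fun _ => (1 : ℝ)) (toCosetPath ω) * pathLimsup v (toCosetPath ω)
          ∂(walkLaw μ lam) = (lazy μ).real {g} * ∫ K, hitProb μ A (K, g) ∂lam) ∧
      Tendsto (fun n => backEntropy (lazy μ) lam n g) atTop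
        (𝓝 (∫ ω, Real.negMulLog (pathLimsup v (toCosetPath ω)) ∂(walkLaw μ lam))) := by
  have hU01 : ∀ n ω, |backMartingale (lazy μ) n g ω| ≤ 1 := fun n ω => by
    rw [abs_of_nonneg (backMartingale_nonneg _ n g ω)]
    exact backMartingale_le_one _ n g ω
  obtain ⟨φ, ψ, hφ, hψm, hψ01, hψtail, hψK, hψU⟩ :=
    exists_tail_limit_backMartingale (lazy μ) lam g
  obtain ⟨v, hvm, hv0, hv1, hvK, hvharm, hvψ⟩ :=
    exists_harmonic_of_tail μ lam hψm hψ01 hψtail hψK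
  obtain ⟨f, hUf, hvf⟩ : ∃ f : Subgroup G × (ℕ → G) → ℝ,
      (∀ᵐ ω ∂(walkLaw (lazy μ) lam),
        Tendsto (fun i => backMartingale (lazy μ) (φ i) g ω) atTop (𝓝 (f ω))) ∧
      ∀ᵐ ω ∂(walkLaw (lazy μ) lam),
        Tendsto (fun n => v (ω.1, position ω.2 n)) atTop (𝓝 (f ω)) := ⟨_, hψU, hvψ⟩
  have hvabs : ∀ p, |v p| ≤ 1 := fun p => by
    rw [abs_of_nonneg (hv0 p)]
    exact hv1 p
  have hvm' : ∀ n, Measurable fun ω : Subgroup G × (ℕ → G) => v (ω.1, position ω.2 n) := fun n =>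
    hvm.comp (measurable_walk n)
  have hFlim : ∀ ω, pathLimsup v (toCosetPath ω) = limsup (fun n => v (ω.1, position ω.2 n)) atTop :=
    fun ω => pathLimsup_cosetPath hv0 hvK ω.1 (position ω.2)
  have hFm : Measurable fun ω : Subgroup G × (ℕ → G) => pathLimsup v (toCosetPath ω) :=
    (measurable_pathLimsup hvm).comp measurable_toCosetPath
  have hvF : ∀ᵐ ω ∂(walkLaw μ lam),
      Tendsto (fun n => v (ω.1, position ω.2 n)) atTop (𝓝 (pathLimsup v (toCosetPath ω))) := by
    refine ae_walkLaw_of_forall _ _ (measurableSet_tendsto_fun hvm' hFm) fun K => ?_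
    -- The function was built from the lazy walk, but harmonicity for `μ` makes it converge along
    -- the original paths too.
    filter_upwards [exists_tendsto_harmonic μ (fun z => v (K, z)) (fun z => hvabs _) (hvharm K)]
      with x ⟨l, hl⟩
    have := hFlim (K, x)
    rw [this, hl.limsup_eq]
    exact hl
  have hφ1 : Tendsto (fun i => φ i + 1) atTop atTop :=
    (tendsto_add_atTop_nat 1).comp hφ.tendsto_atTop
  refine ⟨v, hvm, hv0, hv1, ?_, ?_⟩
  · intro A hA
    have ham := measurable_hitProb μ hA.1
    have hab : ∀ p, |hitProb μ A p * v p| ≤ 1 := fun p => by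
      rw [abs_mul]
      exact mul_le_one₀ (abs_hitProb_le μ p) (abs_nonneg _) (hvabs p)
    have hm' : ∀ n, Measurable fun ω : Subgroup G × (ℕ → G) => hitProb μ A (ω.1, position ω.2 n) :=
      fun n => ham.comp (measurable_walk n)
    have h1 : Tendsto (fun k => ∫ ω, hitProb μ A (ω.1, position ω.2 k) * v (ω.1, position ω.2 k)
        ∂(walkLaw μ lam)) atTop (𝓝 (∫ ω, A.indicator (fun _ => (1 : ℝ)) (toCosetPath ω) *
          pathLimsup v (toCosetPath ω) ∂(walkLaw μ lam))) := by
      refine tendsto_integral_of_abs_le _ (fun n => (hm' n).mul (hvm' n)) (C := 1)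
        (fun n ω => hab _) ?_
      filter_upwards [hvF, ae_tendsto_hitProb μ lam hA] with ω h1 h2
      exact h2.mul h1
    have h2 := (tendsto_integral_walk_lazy μ lam (b := fun p => hitProb μ A p * v p)
      (ham.mul hvm) hab h1).comp hφ1
    have h3 : ∀ i, ∫ ω, backMartingale (lazy μ) (φ i) g ω * hitProb μ A (ω.1, position ω.2 (φ i + 1))
        ∂(walkLaw (lazy μ) lam) = (lazy μ).real {g} * ∫ K, hitProb μ A (K, g) ∂lam := by
      intro i
      have h := integral_backMartingale_mul (lazy μ) lam (φ i) 0 g ham (hitProb_congr μ)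
        (hitProb_nonneg μ) (hitProb_le_one μ)
      rw [add_zero] at h
      rw [h]
      congr 1
      refine integral_congr_ae (ae_of_all _ fun K => ?_)
      simp only
      rw [integral_convPow_lazy μ _ (f := fun y => hitProb μ A (K, g * y))
        (fun y => abs_hitProb_le μ _)]
      simp only [integral_hitProb_convPow μ hA]
      rw [← Finset.sum_mul, sum_choose_div_two_pow, one_mul]
    have hUm : ∀ i, Measurable (backMartingale (lazy μ) (φ i) g) := fun i =>
      measurable_backMartingale _ _ g
    -- For the lazy walk, `v` and the backward probability have the same limit. So in the integrals
    -- against the hitting probability one may replace the other, and Bayes' formula (`h3`) computes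
    -- the latter for every i.
    have h4 : Tendsto (fun i => ∫ ω, (hitProb μ A (ω.1, position ω.2 (φ i + 1)) *
        v (ω.1, position ω.2 (φ i + 1)) - backMartingale (lazy μ) (φ i) g ω *
          hitProb μ A (ω.1, position ω.2 (φ i + 1))) ∂(walkLaw (lazy μ) lam)) atTop
        (𝓝 (∫ _, (0 : ℝ) ∂(walkLaw (lazy μ) lam))) := by
      refine tendsto_integral_of_abs_le _ (fun i => ((hm' _).mul (hvm' _)).sub
        ((hUm i).mul (hm' _))) (C := 2) (fun i ω => ?_) ?_
      · refine (abs_sub _ _).trans ?_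
        have e1 := hab (ω.1, position ω.2 (φ i + 1))
        have e2 : |backMartingale (lazy μ) (φ i) g ω * hitProb μ A (ω.1, position ω.2 (φ i + 1))| ≤ 1 := by
          rw [abs_mul]
          exact mul_le_one₀ (hU01 _ _) (abs_nonneg _) (abs_hitProb_le μ _)
        linarith
      · filter_upwards [hvf, hUf] with ω e1 e2
        have e3 : Tendsto (fun i => v (ω.1, position ω.2 (φ i + 1)) -
            backMartingale (lazy μ) (φ i) g ω) atTop (𝓝 0) := by
          have := (e1.comp hφ1).sub e2
          rwa [sub_self] at this
        refine squeeze_zero_norm (fun i => ?_) (tendsto_zero_iff_norm_tendsto_zero.1 e3)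
        rw [mul_comm (backMartingale _ _ _ _), ← mul_sub, norm_mul]
        exact mul_le_of_le_one_left (norm_nonneg _) (abs_hitProb_le μ _)
    have h5 : ∀ i, ∫ ω, (hitProb μ A (ω.1, position ω.2 (φ i + 1)) *
        v (ω.1, position ω.2 (φ i + 1)) - backMartingale (lazy μ) (φ i) g ω *
          hitProb μ A (ω.1, position ω.2 (φ i + 1))) ∂(walkLaw (lazy μ) lam) =
        ∫ ω, hitProb μ A (ω.1, position ω.2 (φ i + 1)) * v (ω.1, position ω.2 (φ i + 1))
          ∂(walkLaw (lazy μ) lam) - (lazy μ).real {g} * ∫ K, hitProb μ A (K, g) ∂lam := by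
      intro i
      have hm1 : Measurable fun ω : Subgroup G × (ℕ → G) =>
          hitProb μ A (ω.1, position ω.2 (φ i + 1)) * v (ω.1, position ω.2 (φ i + 1)) :=
        (hm' _).mul (hvm' _)
      have hm2 : Measurable fun ω : Subgroup G × (ℕ → G) =>
          backMartingale (lazy μ) (φ i) g ω * hitProb μ A (ω.1, position ω.2 (φ i + 1)) :=
        (hUm i).mul (hm' _)
      rw [integral_sub (integrable_of_abs_le _ hm1 fun ω => hab _)
        (integrable_of_abs_le _ hm2 (C := 1) fun ω => ?_), h3]
      rw [abs_mul]
      exact mul_le_one₀ (hU01 _ _) (abs_nonneg _) (abs_hitProb_le μ _)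
    simp only [h5, integral_zero] at h4
    exact tendsto_nhds_unique h2 (tendsto_sub_nhds_zero_iff.1 h4)
  · have hnm := Real.continuous_negMulLog.measurable
    have h1 : Tendsto (fun k => ∫ ω, Real.negMulLog (v (ω.1, position ω.2 k)) ∂(walkLaw μ lam))
        atTop (𝓝 (∫ ω, Real.negMulLog (pathLimsup v (toCosetPath ω)) ∂(walkLaw μ lam))) := by
      refine tendsto_integral_of_abs_le _ (fun n => hnm.comp (hvm' n)) (C := 1)
        (fun n ω => abs_negMulLog_le_one (hv0 _) (hv1 _)) ?_
      filter_upwards [hvF] with ω h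
      exact (Real.continuous_negMulLog.tendsto _).comp h
    have h2 := tendsto_integral_walk_lazy μ lam (b := fun p => Real.negMulLog (v p))
      (hnm.comp hvm) (C := 1) (fun p => abs_negMulLog_le_one (hv0 _) (hv1 _)) h1
    have h3 : Tendsto (fun k => ∫ ω, Real.negMulLog (v (ω.1, position ω.2 k))
        ∂(walkLaw (lazy μ) lam)) atTop (𝓝 (∫ ω, Real.negMulLog (f ω) ∂(walkLaw (lazy μ) lam))) := by
      refine tendsto_integral_of_abs_le _ (fun n => hnm.comp (hvm' n)) (C := 1)
        (fun n ω => abs_negMulLog_le_one (hv0 _) (hv1 _)) ?_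
      filter_upwards [hvf] with ω h
      exact (Real.continuous_negMulLog.tendsto _).comp h
    have h4 : Tendsto (fun i => backEntropy (lazy μ) lam (φ i) g) atTop
        (𝓝 (∫ ω, Real.negMulLog (f ω) ∂(walkLaw (lazy μ) lam))) := by
      refine tendsto_integral_of_abs_le _ (fun i => hnm.comp (measurable_backMartingale _ _ g)) (C := 1)
        (fun i ω => abs_negMulLog_le_one (backMartingale_nonneg _ _ g ω) (backMartingale_le_one _ _ g ω)) ?_
      filter_upwards [hUf] with ω h
      exact (Real.continuous_negMulLog.tendsto _).comp h
    rw [tendsto_nhds_unique h2 h3]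
    -- Convergence was obtained only along φ; monotonicity extends it to the full sequence.
    exact (tendsto_iff_tendsto_subseq_of_monotone (monotone_backEntropy (lazy μ) lam g)
      hφ.tendsto_atTop).2 h4

end LazyTail

/-! ### Entropy of the lazy walk -/

section LazyEntropy

variable {G : Type u} [Group G] [Countable G] [MeasurableSpace G] [DiscreteMeasurableSpace G]
  {μ : Measure G} [IsProbabilityMeasure μ] {lam : Measure (Subgroup G)} [IsProbabilityMeasure lam]

lemma hasSum_entropy (hH : entropy μ < ∞) :
    HasSum (fun g => Real.negMulLog (μ.real {g})) (entropy μ).toReal := by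
  have h0 : ∀ g : G, 0 ≤ Real.negMulLog (μ.real {g}) := fun g =>
    Real.negMulLog_nonneg measureReal_nonneg measureReal_le_one
  have hs := ENNReal.summable_toReal hH.ne
  simp only [ENNReal.toReal_ofReal (h0 _)] at hs
  have h1 : entropy μ = ENNReal.ofReal (∑' g, Real.negMulLog (μ.real {g})) :=
    (ENNReal.ofReal_tsum_of_nonneg h0 hs).symm
  rw [h1, ENNReal.toReal_ofReal (tsum_nonneg h0)]
  exact hs.hasSum

lemma hasSum_real_singleton (μ : Measure G) [IsProbabilityMeasure μ] :
    HasSum (fun g => μ.real {g}) 1 := by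
  have h := lintegral_countable' (μ := μ) (fun _ => 1)
  simp only [one_mul, lintegral_const, measure_univ, mul_one] at h
  have h1 := (ENNReal.hasSum_toReal (h ▸ ENNReal.one_ne_top : ∑' g, μ {g} ≠ ∞))
  rwa [← ENNReal.tsum_toReal_eq fun g => measure_ne_top _ _, ← h, ENNReal.toReal_one] at h1

lemma backEntropy_nonneg (n : ℕ) (g : G) : 0 ≤ backEntropy μ lam n g :=
  integral_nonneg fun ω =>
    Real.negMulLog_nonneg (backMartingale_nonneg μ n g ω) (backMartingale_le_one μ n g ω)

/-- Conditioning lowers entropy: the backward probability has mean `μ.real {g}`, so Jensen applies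
with a constant `V`. -/
lemma backEntropy_le (n : ℕ) (g : G) : backEntropy μ lam n g ≤ Real.negMulLog (μ.real {g}) := by
  have h := integral_negMulLog_le (walkLaw μ lam) (V := fun _ => μ.real {g})
    (measurable_backMartingale μ n g) measurable_const (backMartingale_nonneg μ n g)
    (backMartingale_le_one μ n g) (ae_of_all _ fun _ => measureReal_nonneg)
    (ae_of_all _ fun _ => measureReal_le_one) fun C _ => by
      by_cases hC : μ.real {g} ∈ C
      · rw [Set.preimage_const_of_mem hC, Measure.restrict_univ]
        have h := integral_backMartingale_mul μ lam n 0 g (b := fun _ => 1) measurable_const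
          (fun _ _ _ _ => rfl) (fun _ => zero_le_one) (fun _ => le_rfl)
        simpa using h
      · rw [Set.preimage_const_of_notMem hC]
        simp
  refine h.trans ?_
  simp

lemma integral_cosetEntropy_sub_nonneg (hH : entropy μ < ∞) (hlam : ConjInvariant lam) (n : ℕ) :
    0 ≤ ∫ K, cosetEntropy μ (n + 1) K ∂lam - ∫ K, cosetEntropy μ n K ∂lam := by
  have := hasSum_le (fun g => backEntropy_le n g) (hasSum_backEntropy hH hlam n) (hasSum_entropy hH)
  linarith

lemma entropy_lazy_lt_top (hH : entropy μ < ∞) : entropy (lazy μ) < ∞ := by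
  -- The atom at 1 costs at most 1. Elsewhere the mass is halved, and the product rule for -x log x
  -- bounds the cost by the old term plus the old mass.
  have hle : ∀ g : G, ENNReal.ofReal (Real.negMulLog ((lazy μ).real {g})) ≤
      ({1} : Set G).indicator (fun _ => 1) g +
        (ENNReal.ofReal (Real.negMulLog (μ.real {g})) + μ {g}) := by
    intro g
    by_cases hg : g = 1
    · refine le_trans ?_ le_self_add
      rw [hg, Set.indicator_of_mem (Set.mem_singleton _)]
      exact ENNReal.ofReal_le_one.2 (negMulLog_le_one measureReal_nonneg)
    · refine le_trans ?_ le_add_self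
      have h1 : (lazy μ).real {g} = μ.real {g} * (1 / 2) := by
        rw [real_lazy, measureReal_def, Measure.dirac_apply,
          Set.indicator_of_notMem (by simpa using Ne.symm hg)]
        simp
        ring
      have h2 : (0 : ℝ) ≤ Real.negMulLog (μ.real {g}) :=
        Real.negMulLog_nonneg measureReal_nonneg measureReal_le_one
      have h3 : Real.negMulLog (1 / 2 : ℝ) ≤ 1 := negMulLog_le_one (by norm_num)
      have h4 : (0 : ℝ) ≤ μ.real {g} := measureReal_nonneg
      rw [h1, Real.negMulLog_mul]
      refine (ENNReal.ofReal_le_ofReal (q := Real.negMulLog (μ.real {g}) + μ.real {g}) ?_).trans ?_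
      · nlinarith
      · rw [ENNReal.ofReal_add h2 h4, Measure.real, ENNReal.ofReal_toReal (measure_ne_top _ _)]
  have h1 := lintegral_countable' (μ := μ) (fun _ => 1)
  simp only [one_mul, lintegral_const, measure_univ, mul_one] at h1
  have h2 : ∑' g : G, ({1} : Set G).indicator (fun _ => (1 : ℝ≥0∞)) g = 1 := by
    rw [tsum_eq_single 1]
    · simp
    · intro g hg
      exact Set.indicator_of_notMem (by simpa using hg) _
  refine (ENNReal.tsum_le_tsum hle).trans_lt ?_
  rw [ENNReal.tsum_add, ENNReal.tsum_add, ← h1, h2]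
  exact ENNReal.add_lt_top.2 ⟨ENNReal.one_lt_top, ENNReal.add_lt_top.2 ⟨hH, ENNReal.one_lt_top⟩⟩

lemma real_convPow_lazy (n : ℕ) (s : Set G) :
    (convPow (lazy μ) n).real s =
      ∑ k ∈ Finset.range (n + 1), (n.choose k : ℝ) / 2 ^ n * (convPow μ k).real s := by
  have h := integral_convPow_lazy μ n (f := s.indicator fun _ => 1) (abs_indicator_one_le s)
  have h1 : ∀ m : Measure G, ∫ x, s.indicator (fun _ => (1 : ℝ)) x ∂m = m.real s := fun m =>
    integral_indicator_one .of_discrete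
  simpa only [h1] using h

/-- Concavity of entropy for the binomial mixture. -/
lemma sum_entropy_cosetLaw_le (K : Subgroup G) (n : ℕ) :
    ∑ k ∈ Finset.range (n + 1), ENNReal.ofReal ((n.choose k : ℝ) / 2 ^ n) *
      entropy (cosetLaw μ K k) ≤ entropy (cosetLaw (lazy μ) K n) := by
  have hm : Measurable (Quotient.mk (QuotientGroup.rightRel K)) := Measurable.of_discrete
  simp only [entropy, ← ENNReal.tsum_mul_left]
  rw [← Summable.tsum_finsetSum fun _ _ => ENNReal.summable]
  refine ENNReal.tsum_le_tsum fun w => ?_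
  have hreal : (cosetLaw (lazy μ) K n).real {w} =
      ∑ k ∈ Finset.range (n + 1), (n.choose k : ℝ) / 2 ^ n * (cosetLaw μ K k).real {w} := by
    simp only [cosetLaw, map_measureReal_apply hm (MeasurableSet.of_discrete (s := {w})),
      real_convPow_lazy]
  have h01 : ∀ k, (cosetLaw μ K k).real {w} ≤ 1 := fun k => by
    rw [cosetLaw, map_measureReal_apply hm .of_discrete]
    exact measureReal_le_one
  have hn : ∀ k, 0 ≤ (n.choose k : ℝ) / 2 ^ n * Real.negMulLog ((cosetLaw μ K k).real {w}) :=
    fun k => mul_nonneg (by positivity) (Real.negMulLog_nonneg measureReal_nonneg (h01 k))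
  have hb : ∀ k, 0 ≤ (n.choose k : ℝ) / 2 ^ n := fun k => by positivity
  simp only [← ENNReal.ofReal_mul (hb _)]
  rw [← ENNReal.ofReal_sum_of_nonneg fun k _ => hn k]
  refine ENNReal.ofReal_le_ofReal ?_
  rw [hreal]
  have := Real.concaveOn_negMulLog.le_map_sum (t := Finset.range (n + 1))
    (w := fun k => (n.choose k : ℝ) / 2 ^ n) (p := fun k => (cosetLaw μ K k).real {w})
    (fun k _ => hb k) (sum_choose_div_two_pow n) (fun k _ => measureReal_nonneg)
  simpa only [smul_eq_mul] using this

lemma sum_integral_cosetEntropy_le (hH : entropy μ < ∞) (n : ℕ) :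
    ∑ k ∈ Finset.range (n + 1), (n.choose k : ℝ) / 2 ^ n * ∫ K, cosetEntropy μ k K ∂lam ≤
      ∫ K, cosetEntropy (lazy μ) n K ∂lam := by
  have hi : ∀ k, Integrable (fun K => (n.choose k : ℝ) / 2 ^ n * cosetEntropy μ k K) lam := fun k =>
    (integrable_cosetEntropy hH k).const_mul _
  simp only [← integral_const_mul]
  rw [← integral_finsetSum _ fun k _ => hi k]
  refine integral_mono (integrable_finsetSum _ fun k _ => hi k)
    (integrable_cosetEntropy (entropy_lazy_lt_top hH) n) fun K => ?_
  have h := ENNReal.toReal_mono (entropy_cosetLaw_lt_top (entropy_lazy_lt_top hH) n K).ne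
    (sum_entropy_cosetLaw_le (μ := μ) K n)
  rw [ENNReal.toReal_sum fun k _ =>
    ENNReal.mul_ne_top ENNReal.ofReal_ne_top (entropy_cosetLaw_lt_top hH k K).ne] at h
  have hb : ∀ k, 0 ≤ (n.choose k : ℝ) / 2 ^ n := fun k => by positivity
  simp only [ENNReal.toReal_mul, ENNReal.toReal_ofReal (hb _)] at h
  exact h

lemma sum_choose_div_two_pow_mul_id (n : ℕ) :
    ∑ k ∈ Finset.range (n + 1), (n.choose k : ℝ) / 2 ^ n * k = n / 2 := by
  induction n with
  | zero => simp
  | succ n ih =>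
    rw [sum_choose_succ_div_two_pow n (fun k => (k : ℝ)), ih]
    push_cast
    simp only [mul_add, Finset.sum_add_distrib, mul_one]
    rw [ih, sum_choose_div_two_pow]
    ring

end LazyEntropy

/-! ### Densities and Furstenberg entropy of a stationary action -/

section StationaryAction

variable {G : Type u} [Group G] [Countable G] [MeasurableSpace G] [DiscreteMeasurableSpace G]
  {μ : Measure G} [IsProbabilityMeasure μ]
  {B : Type v} [MeasurableSpace B] [MulAction G B] [MeasurableConstSMul G B]
  {ν : Measure B} [IsProbabilityMeasure ν]

instance isProbabilityMeasure_map_smul (g : G) : IsProbabilityMeasure (ν.map (fun b => g • b)) :=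
  Measure.isProbabilityMeasure_map (measurable_const_smul g).aemeasurable

lemma smul_map_smul_le (hst : Stationary μ ν) (g : G) : μ {g} • ν.map (fun b => g • b) ≤ ν := by
  refine Measure.le_iff.2 fun s hs => ?_
  rw [hst s hs, lintegral_countable', Measure.smul_apply, smul_eq_mul, mul_comm]
  exact ENNReal.le_tsum g

/-- Stationarity gives domination for atoms of `μ`. The property is stable under products, and by
admissibility the atoms generate `G` as a semigroup, so inverses are covered as well. -/
lemma map_smul_absolutelyContinuous (hμ : Admissible μ) (hst : Stationary μ ν) (g : G) :
    ν.map (fun b => g • b) ≪ ν := by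
  have hg : g ∈ Subsemigroup.closure {g : G | μ {g} ≠ 0} := by
    rw [hμ]
    trivial
  induction hg using Subsemigroup.closure_induction with
  | mem g hg =>
    intro s hs
    have h := smul_map_smul_le hst g s
    rw [hs, nonpos_iff_eq_zero, Measure.smul_apply, smul_eq_mul] at h
    exact (mul_eq_zero.1 h).resolve_left hg
  | mul g h _ _ hg hh =>
    have : ν.map (fun b => (g * h) • b) = (ν.map (fun b => h • b)).map (fun b => g • b) := by
      rw [Measure.map_map (measurable_const_smul g) (measurable_const_smul h)]
      congr 1
      funext b
      exact mul_smul g h b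
    rw [this]
    exact (hh.map (measurable_const_smul g)).trans hg

lemma nonsingular_of_stationary (hμ : Admissible μ) (hst : Stationary μ ν) : Nonsingular G ν :=
  fun g => map_smul_absolutelyContinuous hμ hst g⁻¹

/-- The Radon–Nikodym derivative of `g_* ν` with respect to `ν`. -/
noncomputable def density (ν : Measure B) (g : G) (b : B) : ℝ :=
  ((ν.map (fun b => g • b)).rnDeriv ν b).toReal

lemma measurable_density (g : G) : Measurable (density ν g) :=
  (Measure.measurable_rnDeriv _ _).ennreal_toReal

lemma density_nonneg (g : G) (b : B) : 0 ≤ density ν g b := ENNReal.toReal_nonneg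

lemma integrable_density (g : G) : Integrable (density ν g) ν :=
  Measure.integrable_toReal_rnDeriv

lemma setIntegral_density (hμ : Admissible μ) (hst : Stationary μ ν) (g : G) (s : Set B) :
    ∫ b in s, density ν g b ∂ν = (ν.map (fun b => g • b)).real s :=
  Measure.setIntegral_toReal_rnDeriv (map_smul_absolutelyContinuous hμ hst g) s

lemma integral_density (hμ : Admissible μ) (hst : Stationary μ ν) (g : G) :
    ∫ b, density ν g b ∂ν = 1 := by
  rw [← setIntegral_univ, setIntegral_density hμ hst, probReal_univ]

lemma density_one : density ν (1 : G) =ᵐ[ν] fun _ => 1 := by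
  filter_upwards [Measure.rnDeriv_self ν] with b hb
  simp [density, hb]

lemma mul_density_le_one (hst : Stationary μ ν) (g : G) :
    ∀ᵐ b ∂ν, μ.real {g} * density ν g b ≤ 1 := by
  have h : (fun b => μ {g} * (ν.map (fun b => g • b)).rnDeriv ν b) ≤ᵐ[ν] fun _ => 1 := by
    refine ae_le_of_forall_setLIntegral_le_of_sigmaFinite
      ((Measure.measurable_rnDeriv _ _).const_mul _) fun s hs _ => ?_
    rw [lintegral_const_mul _ (Measure.measurable_rnDeriv _ _), setLIntegral_one]
    calc μ {g} * ∫⁻ b in s, (ν.map (fun b => g • b)).rnDeriv ν b ∂ν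
        ≤ μ {g} * ν.map (fun b => g • b) s := by
          gcongr
          exact Measure.setLIntegral_rnDeriv_le s
      _ ≤ ν s := smul_map_smul_le hst g s
  filter_upwards [h] with b hb
  rw [measureReal_def, density, ← ENNReal.toReal_mul]
  exact ENNReal.toReal_le_of_le_ofReal zero_le_one (by simpa using hb)

/-- Stationarity bounds the density by 1/μ(g), and -x log x is bounded on compact intervals. -/
lemma integrable_negMulLog_density (hst : Stationary μ ν) {g : G} (hg : μ.real {g} ≠ 0) :
    Integrable (fun b => Real.negMulLog (density ν g b)) ν := by
  have hpos : 0 < μ.real {g} := lt_of_le_of_ne measureReal_nonneg (Ne.symm hg)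
  obtain ⟨C, hC⟩ := (isCompact_Icc (a := (0 : ℝ)) (b := (μ.real {g})⁻¹)).exists_bound_of_continuousOn
    Real.continuous_negMulLog.continuousOn
  refine Integrable.of_bound
    (Real.continuous_negMulLog.measurable.comp (measurable_density g)).aestronglyMeasurable C ?_
  filter_upwards [mul_density_le_one hst g] with b hb
  refine hC _ ⟨density_nonneg g b, ?_⟩
  rw [← one_div, le_div_iff₀ hpos, mul_comm]
  exact hb

/-- The relative entropy of `g_* ν` with respect to `ν`. -/
noncomputable def relEntropy (ν : Measure B) (g : G) : ℝ :=
  -∫ b, Real.negMulLog (density ν g b) ∂ν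

lemma relEntropy_one : relEntropy ν (1 : G) = 0 := by
  rw [relEntropy, neg_eq_zero]
  have : (fun b => Real.negMulLog (density ν (1 : G) b)) =ᵐ[ν] fun _ => (0 : ℝ) := by
    filter_upwards [density_one (ν := ν) (G := G)] with b hb
    simp [hb]
  rw [integral_congr_ae this]
  simp

/-- Product rule for -x log x and total mass one of the density. Condition `hc` is shaped for the
lazy weights: the identity may carry weight without being an atom of `μ`, but there the density is
1. -/
lemma integral_negMulLog_mul_density (hμ : Admissible μ) (hst : Stationary μ ν) (g : G) (c : ℝ)
    (hc : c ≠ 0 → μ.real {g} = 0 → g = 1) :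
    ∫ b, Real.negMulLog (c * density ν g b) ∂ν = Real.negMulLog c - c * relEntropy ν g := by
  by_cases hc0 : c = 0
  · simp [hc0]
  have hi : Integrable (fun b => Real.negMulLog (density ν g b)) ν := by
    by_cases hg : μ.real {g} = 0
    · have h1 := hc hc0 hg
      subst h1
      refine (integrable_zero B ℝ ν).congr ?_
      filter_upwards [density_one (ν := ν) (G := G)] with b hb
      simp [hb]
    · exact integrable_negMulLog_density hst hg
  simp only [Real.negMulLog_mul]
  rw [integral_add ((integrable_density g).mul_const _) (hi.const_mul _), integral_mul_const,
    integral_const_mul, integral_density hμ hst, relEntropy]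
  ring

lemma mul_relEntropy_le (hμ : Admissible μ) (hst : Stationary μ ν) (g : G) :
    μ.real {g} * relEntropy ν g ≤ Real.negMulLog (μ.real {g}) := by
  have h := integral_negMulLog_mul_density hμ hst g (μ.real {g}) (fun h h' => absurd h' h)
  have h0 : 0 ≤ ∫ b, Real.negMulLog (μ.real {g} * density ν g b) ∂ν := by
    refine integral_nonneg_of_ae ?_
    filter_upwards [mul_density_le_one hst g] with b hb
    exact Real.negMulLog_nonneg (mul_nonneg measureReal_nonneg (density_nonneg g b)) hb
  linarith

/-- Transporting by `g` turns the pair (ν, ν∘g) into (g_*ν, ν), so the derivative of g_*ν at g b is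
the reciprocal of the derivative of ν∘g at b. -/
lemma logDensity_ae_eq (hμ : Admissible μ) (hst : Stationary μ ν) (g : G) :
    (fun b => logDensity ν (g, b)) =ᵐ[ν] fun b => Real.log (density ν g (g • b)) := by
  have hac := map_smul_absolutelyContinuous hμ hst
  have hme : MeasurableEmbedding (fun b : B => g • b) := measurableEmbedding_const_smul g
  have hmm : (translate ν g).map (fun b => g • b) = ν := by
    rw [translate, Measure.map_map (measurable_const_smul g) (measurable_const_smul g⁻¹)]
    convert Measure.map_id (μ := ν) using 2
    funext b
    simp
  have hprob : IsProbabilityMeasure (translate ν g) :=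
    isProbabilityMeasure_map_smul (ν := ν) g⁻¹
  have hνt : ν ≪ translate ν g := by
    have h := (hac g).map (measurable_const_smul g⁻¹)
    rw [Measure.map_map (measurable_const_smul g⁻¹) (measurable_const_smul g)] at h
    have h2 : ν.map ((fun b => g⁻¹ • b) ∘ fun b => g • b) = ν := by
      convert Measure.map_id (μ := ν) using 2
      funext b
      simp
    rw [h2] at h
    exact h
  have h1 := hνt.ae_le (hme.rnDeriv_map ν (translate ν g))
  rw [hmm] at h1
  filter_upwards [h1, Measure.inv_rnDeriv hνt] with b hb1 hb2
  rw [logDensity, density, hb1, ← hb2, Pi.inv_apply, ENNReal.toReal_inv, Real.log_inv, neg_neg]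

lemma integral_comp_smul_eq (hμ : Admissible μ) (hst : Stationary μ ν) (g : G) {f : B → ℝ}
    (hf : Measurable f) : ∫ b, f (g • b) ∂ν = ∫ b, density ν g b * f b ∂ν := by
  rw [← integral_map (measurable_const_smul g).aemeasurable hf.aestronglyMeasurable]
  exact (integral_rnDeriv_smul (map_smul_absolutelyContinuous hμ hst g)).symm

lemma measurable_log_density (g : G) : Measurable fun b => Real.log (density ν g b) :=
  (measurable_density g).log

lemma integral_logDensity (hμ : Admissible μ) (hst : Stationary μ ν) (g : G) :
    ∫ b, logDensity ν (g, b) ∂ν = relEntropy ν g := by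
  rw [integral_congr_ae (logDensity_ae_eq hμ hst g),
    integral_comp_smul_eq hμ hst g (measurable_log_density g), relEntropy, ← integral_neg]
  refine integral_congr_ae (ae_of_all _ fun b => ?_)
  simp [Real.negMulLog]

lemma measurable_logDensity : Measurable (logDensity (G := G) ν) := by
  refine measurable_from_prod_countable_right fun g => ?_
  have h : Measurable fun b => -Real.log (((translate ν g).rnDeriv ν b).toReal) :=
    ((Measure.measurable_rnDeriv _ _).ennreal_toReal.log).neg
  exact h

lemma integrable_logDensity_right (hμ : Admissible μ) (hst : Stationary μ ν) {g : G}
    (hg : μ.real {g} ≠ 0) : Integrable (fun b => logDensity ν (g, b)) ν := by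
  refine Integrable.congr ?_ (logDensity_ae_eq hμ hst g).symm
  have hm := measurable_log_density (ν := ν) g
  have h1 : Integrable (fun b => Real.log (density ν g b)) (ν.map (fun b => g • b)) := by
    refine (integrable_rnDeriv_smul_iff (map_smul_absolutelyContinuous hμ hst g)).1 ?_
    refine (integrable_negMulLog_density hst hg).neg.congr (ae_of_all _ fun b => ?_)
    simp [Real.negMulLog, density]
  exact (integrable_map_measure hm.aestronglyMeasurable
    (measurable_const_smul g).aemeasurable).1 h1

lemma integral_abs_logDensity_le (hμ : Admissible μ) (hst : Stationary μ ν) {g : G}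
    (hg : μ.real {g} ≠ 0) : ∫ b, ‖logDensity ν (g, b)‖ ∂ν ≤ relEntropy ν g + 2 := by
  have hm := measurable_log_density (ν := ν) g
  have h1 : ∫ b, ‖logDensity ν (g, b)‖ ∂ν = ∫ b, |Real.negMulLog (density ν g b)| ∂ν := by
    have h2 : (fun b => ‖logDensity ν (g, b)‖) =ᵐ[ν] fun b => |Real.log (density ν g (g • b))| := by
      filter_upwards [logDensity_ae_eq hμ hst g] with b hb
      rw [hb, Real.norm_eq_abs]
    rw [integral_congr_ae h2, integral_comp_smul_eq hμ hst g
      (f := fun b => |Real.log (density ν g b)|) (measurable_abs.comp hm)]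
    refine integral_congr_ae (ae_of_all _ fun b => ?_)
    simp only
    rw [Real.negMulLog, abs_mul, abs_neg, abs_of_nonneg (density_nonneg g b)]
  have hi := integrable_negMulLog_density hst hg
  rw [h1]
  -- As -x log x ≤ 1, its absolute value is at most its negative plus 2; so relative entropy
  -- controls the L¹ norm.
  have h3 : ∫ b, |Real.negMulLog (density ν g b)| ∂ν ≤
      ∫ b, (-Real.negMulLog (density ν g b) + 2) ∂ν := by
    refine integral_mono hi.abs (hi.neg.add (integrable_const 2)) fun b => ?_
    have := negMulLog_le_one (density_nonneg (ν := ν) g b)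
    refine abs_le.2 ⟨?_, ?_⟩ <;> linarith
  refine h3.trans (le_of_eq ?_)
  have hn : Integrable (fun b => -Real.negMulLog (density ν g b)) ν := hi.neg
  rw [integral_add hn (integrable_const 2), integral_neg, relEntropy]
  simp

lemma integrable_logDensity (hμ : Admissible μ) (hst : Stationary μ ν) (hH : entropy μ < ∞) :
    Integrable (logDensity (G := G) ν) (μ.prod ν) := by
  refine (integrable_prod_iff measurable_logDensity.aestronglyMeasurable).2 ⟨?_, ?_⟩
  · rw [ae_iff_of_countable]
    intro g hg
    exact integrable_logDensity_right hμ hst (ENNReal.toReal_ne_zero.2 ⟨hg, measure_ne_top _ _⟩)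
  · refine ⟨(Measurable.of_discrete).aestronglyMeasurable, ?_⟩
    rw [HasFiniteIntegral, lintegral_countable']
    have hle : ∀ g : G, ‖∫ b, ‖logDensity ν (g, b)‖ ∂ν‖ₑ * μ {g} ≤
        ENNReal.ofReal (Real.negMulLog (μ.real {g}) + 2 * μ.real {g}) := by
      intro g
      by_cases hg : μ {g} = 0
      · simp [hg]
      have hgr : μ.real {g} ≠ 0 := ENNReal.toReal_ne_zero.2 ⟨hg, measure_ne_top _ _⟩
      have h0 : 0 ≤ ∫ b, ‖logDensity ν (g, b)‖ ∂ν := integral_nonneg fun b => norm_nonneg _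
      rw [Real.enorm_eq_ofReal h0, ← ENNReal.ofReal_toReal (measure_ne_top μ {g}),
        ← ENNReal.ofReal_mul h0]
      refine ENNReal.ofReal_le_ofReal ?_
      have h1 := integral_abs_logDensity_le hμ hst hgr
      have h2 := mul_relEntropy_le hμ hst g
      have h3 : 0 ≤ μ.real {g} := measureReal_nonneg
      have h4 := mul_le_mul_of_nonneg_right h1 h3
      rw [← measureReal_def]
      linarith
    have hs : Summable fun g : G => Real.negMulLog (μ.real {g}) + 2 * μ.real {g} :=
      (hasSum_entropy hH).summable.add ((hasSum_real_singleton μ).summable.mul_left 2)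
    refine (ENNReal.tsum_le_tsum hle).trans_lt ?_
    exact lt_top_iff_ne_top.2 hs.tsum_ofReal_ne_top

lemma neg_le_mul_relEntropy (hst : Stationary μ ν) (g : G) :
    -μ.real {g} ≤ μ.real {g} * relEntropy ν g := by
  by_cases hg : μ.real {g} = 0
  · simp [hg]
  have h : ∫ b, Real.negMulLog (density ν g b) ∂ν ≤ ∫ _, (1 : ℝ) ∂ν :=
    integral_mono (integrable_negMulLog_density hst hg) (integrable_const 1) fun b =>
      negMulLog_le_one (density_nonneg g b)
  have h1 : -1 ≤ relEntropy ν g := by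
    rw [relEntropy]
    simp at h
    linarith
  have h2 := mul_le_mul_of_nonneg_left h1 (measureReal_nonneg (μ := μ) (s := {g}))
  linarith

lemma hasSum_furstenbergEntropy (hμ : Admissible μ) (hst : Stationary μ ν) (hH : entropy μ < ∞) :
    HasSum (fun g => μ.real {g} * relEntropy ν g) (furstenbergEntropy μ ν) := by
  have hi := (integrable_logDensity hμ hst hH).integral_prod_left
  simp only [integral_logDensity hμ hst] at hi
  rw [furstenbergEntropy]
  simp only [integral_logDensity hμ hst]
  rw [integral_countable hi]
  have hs : Summable fun g => μ.real {g} * relEntropy ν g := by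
    refine Summable.of_norm_bounded
      ((hasSum_entropy hH).summable.add (hasSum_real_singleton μ).summable) fun g => ?_
    have h1 := neg_le_mul_relEntropy hst g
    have h2 := mul_relEntropy_le hμ hst g
    have h3 : 0 ≤ Real.negMulLog (μ.real {g}) :=
      Real.negMulLog_nonneg measureReal_nonneg measureReal_le_one
    have h4 : 0 ≤ μ.real {g} := measureReal_nonneg
    exact abs_le.2 ⟨by linarith, by linarith⟩
  exact hs.hasSum

end StationaryAction

/-! ### The Poisson boundary: stationarity and the upper bound for its entropy -/

section Boundary

variable {G : Type u} [Group G] [Countable G] [MeasurableSpace G] [DiscreteMeasurableSpace G]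
  {μ : Measure G} [IsProbabilityMeasure μ] {lam : Measure (Subgroup G)} [IsProbabilityMeasure lam]

instance isProbabilityMeasure_pathLaw : IsProbabilityMeasure (pathLaw μ lam) :=
  Measure.isProbabilityMeasure_map measurable_toCosetPath.aemeasurable

lemma ae_map_smul_pathLaw {P : CosetPath G → Prop} (h : ∀ᵐ p ∂(pathClass μ lam), P p) (g : G) :
    ∀ᵐ p ∂((pathLaw μ lam).map (fun p => g • p)), P p :=
  (Measure.ae_sum_iff.1 h) g

lemma ae_pathLaw {P : CosetPath G → Prop} (h : ∀ᵐ p ∂(pathClass μ lam), P p) :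
    ∀ᵐ p ∂(pathLaw μ lam), P p := by
  have := ae_map_smul_pathLaw h 1
  simpa using this

lemma ae_walkLaw {P : CosetPath G → Prop} (h : ∀ᵐ p ∂(pathClass μ lam), P p) :
    ∀ᵐ ω ∂(walkLaw μ lam), P (toCosetPath ω) :=
  ae_of_ae_map measurable_toCosetPath.aemeasurable (ae_pathLaw h)

/-- The backward process, integrated over an invariant event. -/
lemma integral_backMartingale_mul_indicator (n : ℕ) (g : G) {A : Set (CosetPath G)}
    (hA : MeasurableSet[MeasurableSpace.invariants shift] A) :
    ∫ ω, backMartingale μ n g ω * A.indicator (fun _ => (1 : ℝ)) (toCosetPath ω) ∂(walkLaw μ lam) =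
      μ.real {g} * ∫ K, hitProb μ A (K, g) ∂lam := by
  have hlim : Tendsto (fun m => ∫ ω, backMartingale μ n g ω *
      hitProb μ A (ω.1, position ω.2 (n + m + 1)) ∂(walkLaw μ lam)) atTop
      (𝓝 (∫ ω, backMartingale μ n g ω * A.indicator (fun _ => (1 : ℝ)) (toCosetPath ω)
        ∂(walkLaw μ lam))) := by
    refine tendsto_integral_of_abs_le _ (C := 1) (fun m => ?_) (fun m ω => ?_) ?_
    · have h := (measurable_hitProb μ hA.1).comp (measurable_walk (n + m + 1))
      exact (measurable_backMartingale μ n g).mul h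
    · rw [abs_mul, abs_of_nonneg (backMartingale_nonneg μ n g ω)]
      exact mul_le_one₀ (backMartingale_le_one μ n g ω) (abs_nonneg _) (abs_hitProb_le μ _)
    · filter_upwards [ae_tendsto_hitProb μ lam hA] with ω hω
      have hs : Tendsto (fun m => n + m + 1) atTop atTop :=
        tendsto_atTop_mono (fun m => by simp only [id]; omega) tendsto_id
      exact (hω.comp hs).const_mul _
  refine tendsto_nhds_unique hlim ((tendsto_const_nhds (x := _)).congr fun m => ?_)
  rw [integral_backMartingale_mul μ lam n m g (measurable_hitProb μ hA.1) (hitProb_congr μ)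
    (hitProb_nonneg μ) (hitProb_le_one μ)]
  simp only [integral_hitProb_convPow μ hA]

variable {B : Type v} [MeasurableSpace B] [MulAction G B] [MeasurableConstSMul G B]
  {ν : Measure B} {bnd : CosetPath G → B}

namespace IsPoissonBoundary

lemma isProbabilityMeasure (hB : IsPoissonBoundary μ lam ν bnd) : IsProbabilityMeasure ν := by
  rw [← hB.map_eq]
  exact Measure.isProbabilityMeasure_map hB.measurable.aemeasurable

lemma measurable_bnd_toCosetPath (hB : IsPoissonBoundary μ lam ν bnd) :
    Measurable fun ω : Subgroup G × (ℕ → G) => bnd (toCosetPath ω) :=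
  hB.measurable.comp measurable_toCosetPath

lemma map_walkLaw (hB : IsPoissonBoundary μ lam ν bnd) :
    (walkLaw μ lam).map (fun ω => bnd (toCosetPath ω)) = ν := by
  rw [← hB.map_eq, pathLaw, Measure.map_map hB.measurable measurable_toCosetPath]
  rfl

lemma ae_bnd (hB : IsPoissonBoundary μ lam ν bnd) {P : B → Prop} (h : ∀ᵐ b ∂ν, P b) :
    ∀ᵐ ω ∂(walkLaw μ lam), P (bnd (toCosetPath ω)) := by
  rw [← hB.map_walkLaw] at h
  exact ae_of_ae_map hB.measurable_bnd_toCosetPath.aemeasurable h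

/-- The event is evaluated under a translated path law, so the comparison of `E` with `A` must hold
modulo null sets of `pathClass`, not merely of `pathLaw`. -/
lemma map_smul_apply (hB : IsPoissonBoundary μ lam ν bnd) (g : G) {E : Set B}
    (hE : MeasurableSet E) {A : Set (CosetPath G)} (hEA : bnd ⁻¹' E =ᵐ[pathClass μ lam] A) :
    ν.map (fun b => g • b) E = (pathLaw μ lam).map (fun p => g • p) A := by
  have h1 : ν.map (fun b => g • b) = ((pathLaw μ lam).map (fun p => g • p)).map bnd := by
    rw [← hB.map_eq, Measure.map_map (measurable_const_smul g) hB.measurable,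
      Measure.map_map hB.measurable (measurable_smul_cosetPath g)]
    refine Measure.map_congr ?_
    filter_upwards [ae_pathLaw (hB.equivariant g)] with p hp
    exact hp.symm
  rw [h1, Measure.map_apply hB.measurable hE]
  exact measure_congr (ae_map_smul_pathLaw hEA g)

lemma real_map_smul (hB : IsPoissonBoundary μ lam ν bnd) (hlam : ConjInvariant lam) (g : G)
    {E : Set B} (hE : MeasurableSet E) {A : Set (CosetPath G)} (hA : MeasurableSet A)
    (hEA : bnd ⁻¹' E =ᵐ[pathClass μ lam] A) :
    (ν.map (fun b => g • b)).real E = ∫ K, hitProb μ A (K, g) ∂lam := by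
  rw [measureReal_def, hB.map_smul_apply g hE hEA, ← measureReal_def,
    real_map_smul_pathLaw μ hlam hA]

/-- The mass that g_*ν gives to a set is the averaged hitting probability from Kg of an invariant
event; harmonicity at the identity is stationarity. -/
lemma stationary (hB : IsPoissonBoundary μ lam ν bnd) (hlam : ConjInvariant lam) :
    Stationary μ ν := by
  have := hB.isProbabilityMeasure
  intro E hE
  obtain ⟨A, hA, hEA⟩ := hB.preimage_invariant E hE
  have hreal := fun g => hB.real_map_smul hlam g hE hA.1 hEA
  have h1 : ν.real E = ∫ K, hitProb μ A (K, 1) ∂lam := by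
    have := hreal 1
    simpa using this
  have hm : Measurable fun p : Subgroup G × G => hitProb μ A (p.1, p.2) := measurable_hitProb μ hA.1
  have h2 : ∫ K, hitProb μ A (K, 1) ∂lam = ∫ g, ∫ K, hitProb μ A (K, g) ∂lam ∂μ := by
    rw [← integral_integral_swap (f := fun K g => hitProb μ A (K, g))
      (integrable_of_abs_le _ hm fun p => abs_hitProb_le μ _)]
    refine integral_congr_ae (ae_of_all _ fun K => ?_)
    have := integral_hitProb μ hA K 1
    simpa only [one_mul] using this.symm
  have h3 : ∫⁻ g, ν.map (fun b => g • b) E ∂μ =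
      ENNReal.ofReal (∫ g, ∫ K, hitProb μ A (K, g) ∂lam ∂μ) := by
    rw [ofReal_integral_eq_lintegral_ofReal]
    · refine lintegral_congr fun g => ?_
      rw [← hreal g, ofReal_measureReal]
    · exact integrable_of_abs_le _ Measurable.of_discrete (C := 1) fun g =>
        abs_integral_le_of_abs_le _ fun K => abs_hitProb_le μ _
    · exact ae_of_all _ fun g => integral_nonneg fun K => hitProb_nonneg μ _
  rw [h3, ← h2, ← h1, ofReal_measureReal]

/-- The density of the harmonic measure, integrated over an invariant event. -/
lemma setIntegral_density_bnd (hB : IsPoissonBoundary μ lam ν bnd) (hμ : Admissible μ)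
    (hlam : ConjInvariant lam) (g : G) {E : Set B} (hE : MeasurableSet E) {A : Set (CosetPath G)}
    (hA : MeasurableSet A) (hEA : bnd ⁻¹' E =ᵐ[pathClass μ lam] A) :
    ∫ ω in (fun ω => bnd (toCosetPath ω)) ⁻¹' E, density ν g (bnd (toCosetPath ω))
      ∂(walkLaw μ lam) = ∫ K, hitProb μ A (K, g) ∂lam := by
  have := hB.isProbabilityMeasure
  have hst := hB.stationary hlam
  rw [← hB.real_map_smul hlam g hE hA hEA, ← setIntegral_density hμ hst g E]
  conv_rhs => rw [← hB.map_walkLaw]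
  rw [setIntegral_map hE _ hB.measurable_bnd_toCosetPath.aemeasurable, hB.map_walkLaw]
  rw [hB.map_walkLaw]
  exact (measurable_density g).aestronglyMeasurable

lemma setIntegral_eq_integral_mul_indicator (f : Subgroup G × (ℕ → G) → ℝ)
    (hB : IsPoissonBoundary μ lam ν bnd) {E : Set B} (hE : MeasurableSet E)
    {A : Set (CosetPath G)} (hEA : bnd ⁻¹' E =ᵐ[pathClass μ lam] A) :
    ∫ ω in (fun ω => bnd (toCosetPath ω)) ⁻¹' E, f ω ∂(walkLaw μ lam) =
      ∫ ω, f ω * A.indicator (fun _ => (1 : ℝ)) (toCosetPath ω) ∂(walkLaw μ lam) := by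
  rw [← integral_indicator (hB.measurable_bnd_toCosetPath hE)]
  refine integral_congr_ae ?_
  filter_upwards [ae_walkLaw hEA] with ω hω
  have hω' : toCosetPath ω ∈ bnd ⁻¹' E ↔ toCosetPath ω ∈ A := iff_of_eq hω
  by_cases h : toCosetPath ω ∈ A
  · rw [Set.indicator_of_mem h, Set.indicator_of_mem (show ω ∈ _ ⁻¹' E from hω'.2 h), mul_one]
  · rw [Set.indicator_of_notMem h,
      Set.indicator_of_notMem (show ω ∉ _ ⁻¹' E from fun h' => h (hω'.1 h')), mul_zero]

/-- Over an invariant event, the backward probability and μ(g) times the boundary density have the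
same integral. Hence the latter is the projection of the former, and Jensen applies. -/
lemma backEntropy_le_integral (hB : IsPoissonBoundary μ lam ν bnd) (hμ : Admissible μ)
    (hlam : ConjInvariant lam) (n : ℕ) (g : G) :
    backEntropy μ lam n g ≤ ∫ b, Real.negMulLog (μ.real {g} * density ν g b) ∂ν := by
  have := hB.isProbabilityMeasure
  have hst := hB.stationary hlam
  have hd : Measurable fun b => μ.real {g} * density ν g b := (measurable_density g).const_mul _
  have hV : Measurable fun ω => μ.real {g} * density ν g (bnd (toCosetPath ω)) :=
    hd.comp hB.measurable_bnd_toCosetPath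
  have hV1 : ∀ᵐ ω ∂(walkLaw μ lam), μ.real {g} * density ν g (bnd (toCosetPath ω)) ≤ 1 :=
    hB.ae_bnd (mul_density_le_one hst g)
  have h := integral_negMulLog_le (walkLaw μ lam) (measurable_backMartingale μ n g) hV
    (backMartingale_nonneg μ n g) (backMartingale_le_one μ n g)
    (ae_of_all _ fun ω => mul_nonneg measureReal_nonneg (density_nonneg _ _)) hV1 fun C hC => by
      have hpre : (fun ω => μ.real {g} * density ν g (bnd (toCosetPath ω))) ⁻¹' C =
        (fun ω => bnd (toCosetPath ω)) ⁻¹' ((fun b => μ.real {g} * density ν g b) ⁻¹' C) := rfl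
      have hE : MeasurableSet ((fun b => μ.real {g} * density ν g b) ⁻¹' C) := hd hC
      obtain ⟨A, hA, hEA⟩ := hB.preimage_invariant _ hE
      have h1 := hB.setIntegral_density_bnd hμ hlam g hE hA.1 hEA
      have h2 := setIntegral_eq_integral_mul_indicator (backMartingale μ n g) hB hE hEA
      rw [integral_backMartingale_mul_indicator n g hA] at h2
      rw [integral_const_mul, hpre, h1, h2]
  refine h.trans (le_of_eq ?_)
  rw [← hB.map_walkLaw, integral_map hB.measurable_bnd_toCosetPath.aemeasurable, hB.map_walkLaw]
  rw [hB.map_walkLaw]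
  exact (Real.continuous_negMulLog.measurable.comp hd).aestronglyMeasurable

/-- The Furstenberg entropy is at most each of the increments of the entropy of the walk. -/
lemma furstenbergEntropy_le (hB : IsPoissonBoundary μ lam ν bnd) (hμ : Admissible μ)
    (hH : entropy μ < ∞) (hlam : ConjInvariant lam) (n : ℕ) :
    furstenbergEntropy μ ν ≤
      ∫ K, cosetEntropy μ (n + 1) K ∂lam - ∫ K, cosetEntropy μ n K ∂lam := by
  have := hB.isProbabilityMeasure
  have hst := hB.stationary hlam
  have h := hasSum_le (fun g => ?_) (hasSum_backEntropy hH hlam n)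
    ((hasSum_entropy hH).sub (hasSum_furstenbergEntropy (ν := ν) hμ hst hH))
  · linarith
  rw [← integral_negMulLog_mul_density hμ hst g (μ.real {g}) fun h h' => absurd h' h]
  exact hB.backEntropy_le_integral hμ hlam n g

end IsPoissonBoundary

end Boundary

/-- If X < Y on a set of positive measure, some rational lies strictly between them on a set of
positive measure, and there the integrals differ. -/
lemma ae_le_of_setIntegral_eq {α : Type*} [MeasurableSpace α] {P : Measure α} {X Y : α → ℝ}
    (hX : Measurable X) (hY : Measurable Y) (hXi : Integrable X P) (hYi : Integrable Y P)
    (h : ∀ q : ℚ, ∫ x in {x | X x < q ∧ q < Y x}, X x ∂P = ∫ x in {x | X x < q ∧ q < Y x}, Y x ∂P) :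
    ∀ᵐ x ∂P, Y x ≤ X x := by
  have hq : ∀ q : ℚ, ∀ᵐ x ∂P, ¬ (X x < q ∧ q < Y x) := by
    intro q
    have hS : MeasurableSet {x | X x < q ∧ q < Y x} :=
      (measurableSet_lt hX measurable_const).inter (measurableSet_lt measurable_const hY)
    have h0 : ∫ x in {x | X x < q ∧ q < Y x}, (Y x - X x) ∂P = 0 := by
      rw [integral_sub hYi.restrict hXi.restrict, h q, sub_self]
    have hpos : ∀ᵐ x ∂(P.restrict {x | X x < q ∧ q < Y x}), 0 < Y x - X x := by
      filter_upwards [ae_restrict_mem hS] with x hx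
      have hx' : X x < q ∧ q < Y x := hx
      linarith [hx'.1, hx'.2]
    rw [integral_eq_zero_iff_of_nonneg_ae (hpos.mono fun x hx => hx.le)
      (hYi.restrict.sub hXi.restrict)] at h0
    have h1 : ∀ᵐ x ∂(P.restrict {x | X x < q ∧ q < Y x}), False := by
      filter_upwards [h0, hpos] with x hx1 hx2
      exact hx2.ne' hx1
    have h2 := (ae_restrict_iff' hS).1 h1
    exact h2.mono fun x hx => hx
  filter_upwards [ae_all_iff.2 hq] with x hx
  by_contra hlt
  obtain ⟨q, hq1, hq2⟩ := exists_rat_btwn (not_le.1 hlt)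
  exact hx q ⟨hq1, hq2⟩

/-! ### Identification of the limit with the Furstenberg entropy -/

section Boundary

variable {G : Type u} [Group G] [Countable G] [MeasurableSpace G] [DiscreteMeasurableSpace G]
  {μ : Measure G} [IsProbabilityMeasure μ] {lam : Measure (Subgroup G)} [IsProbabilityMeasure lam]
  {B : Type v} [MeasurableSpace B] [MulAction G B] [MeasurableConstSMul G B]
  {ν : Measure B} {bnd : CosetPath G → B}

namespace IsPoissonBoundary

lemma setIntegral_density_invariant (hB : IsPoissonBoundary μ lam ν bnd) (hμ : Admissible μ)
    (hlam : ConjInvariant lam) (g : G) (c : ℝ) {A : Set (CosetPath G)}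
    (hA : MeasurableSet[MeasurableSpace.invariants shift] A) :
    ∫ ω in toCosetPath ⁻¹' A, c * density ν g (bnd (toCosetPath ω)) ∂(walkLaw μ lam) =
      c * ∫ K, hitProb μ A (K, g) ∂lam := by
  obtain ⟨E, hE, hEA⟩ := hB.invariant_preimage A hA
  rw [integral_const_mul, ← hB.setIntegral_density_bnd hμ hlam g hE hA.1 hEA]
  congr 1
  exact setIntegral_congr_set (ae_walkLaw (P := fun p => (p ∈ A) = (p ∈ bnd ⁻¹' E))
    (hEA.mono fun p hp => hp.symm))

/-- A tail functional is determined by its integrals over invariant events. -/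
lemma pathLimsup_ae_eq (hB : IsPoissonBoundary μ lam ν bnd) (hμ : Admissible μ)
    (hlam : ConjInvariant lam) (g : G) (c : ℝ) {v : Subgroup G × G → ℝ} (hv : Measurable v)
    (hi : Integrable (fun ω => pathLimsup v (toCosetPath ω)) (walkLaw μ lam))
    (h : ∀ A : Set (CosetPath G), MeasurableSet[MeasurableSpace.invariants shift] A →
        ∫ ω, A.indicator (fun _ => (1 : ℝ)) (toCosetPath ω) * pathLimsup v (toCosetPath ω)
          ∂(walkLaw μ lam) = c * ∫ K, hitProb μ A (K, g) ∂lam) :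
    ∀ᵐ ω ∂(walkLaw μ lam),
      pathLimsup v (toCosetPath ω) = c * density ν g (bnd (toCosetPath ω)) := by
  have := hB.isProbabilityMeasure
  have hd : Measurable fun b => c * density ν g b := (measurable_density g).const_mul _
  have hY : Measurable fun ω => c * density ν g (bnd (toCosetPath ω)) :=
    hd.comp hB.measurable_bnd_toCosetPath
  have hX : Measurable fun ω => pathLimsup v (toCosetPath ω) :=
    (measurable_pathLimsup hv).comp measurable_toCosetPath
  have hYi : Integrable (fun ω => c * density ν g (bnd (toCosetPath ω))) (walkLaw μ lam) := by
    have h1 : Integrable (fun b => c * density ν g b)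
        ((walkLaw μ lam).map fun ω => bnd (toCosetPath ω)) := by
      rw [hB.map_walkLaw]
      exact (integrable_density g).const_mul c
    exact (integrable_map_measure hd.aestronglyMeasurable
      hB.measurable_bnd_toCosetPath.aemeasurable).1 h1
  have key : ∀ A : Set (CosetPath G), MeasurableSet[MeasurableSpace.invariants shift] A →
      ∫ ω in toCosetPath ⁻¹' A, pathLimsup v (toCosetPath ω) ∂(walkLaw μ lam) =
        ∫ ω in toCosetPath ⁻¹' A, c * density ν g (bnd (toCosetPath ω)) ∂(walkLaw μ lam) := by
    intro A hA
    rw [hB.setIntegral_density_invariant hμ hlam g c hA, ← h A hA,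
      ← integral_indicator (measurable_toCosetPath hA.1)]
    refine integral_congr_ae (ae_of_all _ fun ω => ?_)
    by_cases hω : toCosetPath ω ∈ A
    · simp [Set.indicator, hω]
    · simp [Set.indicator, hω]
  have key2 : ∀ (s t : Set ℝ), MeasurableSet s → MeasurableSet t →
      ∫ ω in {ω | pathLimsup v (toCosetPath ω) ∈ s ∧
          c * density ν g (bnd (toCosetPath ω)) ∈ t}, pathLimsup v (toCosetPath ω) ∂(walkLaw μ lam) =
        ∫ ω in {ω | pathLimsup v (toCosetPath ω) ∈ s ∧ c * density ν g (bnd (toCosetPath ω)) ∈ t},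
          c * density ν g (bnd (toCosetPath ω)) ∂(walkLaw μ lam) := by
    intro s t hs ht
    -- The upper limit is exactly shift-invariant, whereas the boundary density is so only modulo
    -- null sets; its level set is replaced by an invariant one.
    obtain ⟨A, hA, hEA⟩ := hB.preimage_invariant _ (hd ht)
    have hA' : MeasurableSet[MeasurableSpace.invariants shift] (pathLimsup v ⁻¹' s ∩ A) :=
      (measurable_invariants_pathLimsup hv hs).inter hA
    have hae : {ω | pathLimsup v (toCosetPath ω) ∈ s ∧ c * density ν g (bnd (toCosetPath ω)) ∈ t}
        =ᵐ[walkLaw μ lam] toCosetPath ⁻¹' (pathLimsup v ⁻¹' s ∩ A) := by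
      filter_upwards [ae_walkLaw hEA] with ω hω
      have hω' : c * density ν g (bnd (toCosetPath ω)) ∈ t ↔ toCosetPath ω ∈ A := iff_of_eq hω
      exact propext (and_congr_right fun _ => hω')
    rw [setIntegral_congr_set hae, setIntegral_congr_set hae, key _ hA']
  have h1 := ae_le_of_setIntegral_eq hX hY hi hYi fun q =>
    key2 (Set.Iio q) (Set.Ioi q) measurableSet_Iio measurableSet_Ioi
  have h2 := ae_le_of_setIntegral_eq hY hX hYi hi fun q => by
    have := key2 (Set.Ioi q) (Set.Iio q) measurableSet_Ioi measurableSet_Iio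
    simp only [and_comm (a := _ ∈ Set.Ioi _)] at this
    exact this.symm
  filter_upwards [h1, h2] with ω h1 h2
  exact le_antisymm h2 h1

/-- The limiting backward law of the lazy walk is expressed through densities on the boundary of the
original walk, via the common harmonic function. -/
lemma tendsto_backEntropy_lazy (hB : IsPoissonBoundary μ lam ν bnd) (hμ : Admissible μ)
    (hlam : ConjInvariant lam) (g : G) :
    Tendsto (fun n => backEntropy (lazy μ) lam n g) atTop
      (𝓝 (Real.negMulLog ((lazy μ).real {g}) - (lazy μ).real {g} * relEntropy ν g)) := by
  have := hB.isProbabilityMeasure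
  obtain ⟨v, hvm, hv0, hv1, hvA, hlim⟩ := exists_harmonic_of_lazy μ lam g
  have hmem : ∀ p, pathLimsup v p ∈ Set.Icc 0 1 := fun p => by
    refine limsup_mem_Icc (fun n => Real.iSup_nonneg fun g => ?_) fun n => ?_
    · exact Set.indicator_nonneg (fun _ _ => hv0 _) _
    · exact ciSup_le fun g => Set.indicator_le' (fun _ _ => hv1 _) (fun _ _ => zero_le_one) g
  have hi : Integrable (fun ω => pathLimsup v (toCosetPath ω)) (walkLaw μ lam) := by
    have hm : Measurable fun ω : Subgroup G × (ℕ → G) => pathLimsup v (toCosetPath ω) :=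
      (measurable_pathLimsup hvm).comp measurable_toCosetPath
    refine integrable_of_abs_le _ hm (C := 1) fun ω => ?_
    rw [abs_of_nonneg (hmem _).1]
    exact (hmem _).2
  have hae := hB.pathLimsup_ae_eq hμ hlam g _ hvm hi hvA
  have hint : ∫ ω, Real.negMulLog (pathLimsup v (toCosetPath ω)) ∂(walkLaw μ lam) =
      ∫ b, Real.negMulLog ((lazy μ).real {g} * density ν g b) ∂ν := by
    have hd : Measurable fun b => Real.negMulLog ((lazy μ).real {g} * density ν g b) :=
      Real.continuous_negMulLog.measurable.comp ((measurable_density g).const_mul _)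
    conv_rhs => rw [← hB.map_walkLaw]
    rw [integral_map hB.measurable_bnd_toCosetPath.aemeasurable, hB.map_walkLaw]
    · refine integral_congr_ae ?_
      filter_upwards [hae] with ω hω
      rw [hω]
    · rw [hB.map_walkLaw]
      exact hd.aestronglyMeasurable
  rwa [hint, integral_negMulLog_mul_density hμ (hB.stationary hlam) g _ fun h1 h2 => ?_] at hlim
  by_contra hg
  refine h1 ?_
  rw [real_lazy, h2]
  simp [measureReal_def, Ne.symm hg]

/-- Only a Fatou-type inequality is needed: finite partial sums of conditional entropies pass to the
limit and stay below the limit of the total. -/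
lemma limit_lazy_le (hB : IsPoissonBoundary μ lam ν bnd) (hμ : Admissible μ)
    (hH : entropy μ < ∞) (hlam : ConjInvariant lam) {l : ℝ}
    (hl : Tendsto (fun n => ∫ K, cosetEntropy (lazy μ) (n + 1) K ∂lam -
      ∫ K, cosetEntropy (lazy μ) n K ∂lam) atTop (𝓝 l)) :
    l ≤ furstenbergEntropy μ ν / 2 := by
  have := hB.isProbabilityMeasure
  have hst := hB.stationary hlam
  have hH' := entropy_lazy_lt_top hH
  -- Laziness halves the weights off the identity, and the identity has relative entropy zero.
  have hs : HasSum (fun g => (lazy μ).real {g} * relEntropy ν g) (furstenbergEntropy μ ν / 2) := by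
    refine ((hasSum_furstenbergEntropy (ν := ν) hμ hst hH).div_const 2).congr_fun fun g => ?_
    by_cases hg : g = 1
    · subst hg
      simp [relEntropy_one]
    · rw [real_lazy]
      simp [measureReal_def, Ne.symm hg]
      ring
  have h := hasSum_le_of_sum_le ((hasSum_entropy hH').sub hs)
    (c := (entropy (lazy μ)).toReal - l) fun s => ?_
  · linarith
  refine le_of_tendsto_of_tendsto
    (tendsto_finsetSum s fun g _ => hB.tendsto_backEntropy_lazy hμ hlam g)
    (tendsto_const_nhds.sub hl) (Eventually.of_forall fun n => ?_)
  exact sum_le_hasSum s (fun g _ => backEntropy_nonneg n g) (hasSum_backEntropy hH' hlam n)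

/-- The asymptotic description of the Furstenberg entropy of a Poisson boundary. -/
lemma entropy_formula (hB : IsPoissonBoundary μ lam ν bnd) (hμ : Admissible μ)
    (hH : entropy μ < ∞) (hlam : ConjInvariant lam) :
    Tendsto (fun n : ℕ => (1 / (n : ℝ)) * ∫ K, cosetEntropy μ n K ∂lam) atTop
        (𝓝 (furstenbergEntropy μ ν)) ∧
      IsGLB {a : ℝ | ∃ n : ℕ, 1 ≤ n ∧ a = (1 / (n : ℝ)) * ∫ K, cosetEntropy μ n K ∂lam}
        (furstenbergEntropy μ ν) ∧
      Tendsto (fun n : ℕ => ∫ K, cosetEntropy μ (n + 1) K ∂lam - ∫ K, cosetEntropy μ n K ∂lam) atTop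
        (𝓝 (furstenbergEntropy μ ν)) ∧
      IsGLB {a : ℝ | ∃ n : ℕ, a = ∫ K, cosetEntropy μ (n + 1) K ∂lam - ∫ K, cosetEntropy μ n K ∂lam}
        (furstenbergEntropy μ ν) := by
  have hH' := entropy_lazy_lt_top hH
  obtain ⟨l, hl, hincr, hle, hlim, hglb, hglb'⟩ :=
    exists_limit_of_antitone_increments (fun n => ∫ K, cosetEntropy μ n K ∂lam)
      (integral_cosetEntropy_zero) (antitone_integral_cosetEntropy_sub hH hlam)
      (hB.furstenbergEntropy_le hμ hH hlam)
  obtain ⟨l', -, hincr', -, hlim', -, -⟩ :=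
    exists_limit_of_antitone_increments (fun n => ∫ K, cosetEntropy (lazy μ) n K ∂lam)
      (integral_cosetEntropy_zero) (antitone_integral_cosetEntropy_sub hH' hlam)
      (integral_cosetEntropy_sub_nonneg hH' hlam)
  have h1 := hB.limit_lazy_le hμ hH hlam hincr'
  -- The lazy entropy at time n dominates the binomial average of a_k ≥ k l, whose mean index is
  -- n/2; divide by n.
  have h2 : l / 2 ≤ l' := by
    refine ge_of_tendsto hlim' ((eventually_ge_atTop 1).mono fun n hn => ?_)
    have h3 := sum_integral_cosetEntropy_le (lam := lam) hH n
    have hn' : (0 : ℝ) < n := by exact_mod_cast hn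
    have h4 : (n : ℝ) / 2 * l ≤ ∫ K, cosetEntropy (lazy μ) n K ∂lam := by
      refine le_trans ?_ h3
      rw [← sum_choose_div_two_pow_mul_id, Finset.sum_mul]
      refine Finset.sum_le_sum fun k _ => ?_
      rw [mul_assoc]
      exact mul_le_mul_of_nonneg_left (hle k) (by positivity)
    rw [one_div, ← div_eq_inv_mul, le_div_iff₀ hn']
    linarith
  -- The chain h ≤ l, l/2 ≤ l', l' ≤ h/2 closes up.
  have h5 : l = furstenbergEntropy μ ν := by linarith
  subst h5
  exact ⟨hlim, hglb, hincr, hglb'⟩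

end IsPoissonBoundary

end Boundary

/-- A sub-σ-algebra of a countably generated σ-algebra is generated, modulo null sets, by a
sequence of sets; moreover each of its sets is a lower limit of sets of the sequence. -/
lemma exists_seq_liminf_ae_eq {α : Type*} {m₀ : MeasurableSpace α}
    [MeasurableSpace.CountablyGenerated α] (P : Measure α) [SFinite P] {m : MeasurableSpace α}
    (hm : m ≤ m₀) :
    ∃ A : ℕ → Set α, (∀ i, MeasurableSet[m] (A i)) ∧ ∀ D, MeasurableSet[m] D →
      ∃ φ : ℕ → ℕ, {x | ∀ᶠ k in atTop, x ∈ A (φ k)} =ᵐ[P] D := by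
  -- An equivalent finite measure has the same null sets and puts all indicators in L¹, whose
  -- separability supplies the sequence.
  let Q := P.toFinite
  let f : {D : Set α // MeasurableSet[m] D} → Lp ℝ 1 Q := fun D =>
    indicatorConstLp 1 (hm _ D.2) (measure_ne_top Q _) 1
  have : Fact ((1 : ℝ≥0∞) ≠ ∞) := ⟨ENNReal.one_ne_top⟩
  have hne : Nonempty (Set.range f) := ⟨⟨_, ⟨∅, MeasurableSet.empty⟩, rfl⟩⟩
  obtain ⟨u, hu⟩ := TopologicalSpace.exists_dense_seq (Set.range f)
  choose A hA using fun i => (u i).2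
  refine ⟨fun i => (A i).1, fun i => (A i).2, fun D hD => ?_⟩
  have hcl : (⟨f ⟨D, hD⟩, Set.mem_range_self _⟩ : Set.range f) ∈ closure (Set.range u) := hu _
  obtain ⟨w, hw, hwlim⟩ := mem_closure_iff_seq_limit.1 hcl
  choose j hj using hw
  have hlim : Tendsto (fun k => f (A (j k))) atTop (𝓝 (f ⟨D, hD⟩)) := by
    have h := (continuous_subtype_val.tendsto _).comp hwlim
    refine h.congr fun k => ?_
    rw [hA, hj]
    rfl
  -- Along an almost everywhere convergent subsequence, 0-1 valued functions with a 0-1 valued limit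
  -- are eventually constant, so the lower limit of the sets is the target set.
  obtain ⟨ns, -, hns⟩ := (tendstoInMeasure_of_tendsto_Lp hlim).exists_seq_tendsto_ae
  refine ⟨fun k => j (ns k), ?_⟩
  rw [← ae_toFinite (μ := P)]
  have hA' : ∀ᵐ x ∂Q, ∀ k, f (A (j (ns k))) x = (A (j (ns k))).1.indicator (fun _ => (1 : ℝ)) x :=
    ae_all_iff.2 fun k => indicatorConstLp_coeFn
  filter_upwards [hns, hA', (indicatorConstLp_coeFn : f ⟨D, hD⟩ =ᵐ[Q] D.indicator fun _ => (1 : ℝ))]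
    with x h1 h2 h3
  have h3' : f ⟨D, hD⟩ x = D.indicator (fun _ => (1 : ℝ)) x := h3
  simp only [h2, h3'] at h1
  refine propext (Iff.trans ?_ (show D.indicator (fun _ => (1 : ℝ)) x = 1 ↔ x ∈ D from by
    simp))
  constructor
  · intro h
    refine tendsto_nhds_unique h1 ((tendsto_const_nhds (x := (1 : ℝ))).congr' ?_)
    filter_upwards [h] with k hk
    exact (Set.indicator_of_mem (f := fun _ => (1 : ℝ)) hk).symm
  · intro h
    rw [h] at h1
    filter_upwards [h1.eventually_const_lt (u := (0 : ℝ)) zero_lt_one] with k hk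
    by_contra hx
    have hx' : x ∉ (A (j (ns k))).1 := hx
    rw [Set.indicator_of_notMem hx'] at hk
    exact lt_irrefl _ hk

/-- The space of functions from `G` to `2^ℕ`, on which `G` acts by left translation. -/
def TranslationSpace (G : Type u) : Type u := G → ℕ → Prop

namespace TranslationSpace

instance (G : Type u) : MeasurableSpace (TranslationSpace G) :=
  inferInstanceAs (MeasurableSpace (G → ℕ → Prop))

instance (G : Type u) [Countable G] : StandardBorelSpace (TranslationSpace G) :=
  inferInstanceAs (StandardBorelSpace (G → ℕ → Prop))

variable {G : Type u} [Group G]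

instance : MulAction G (TranslationSpace G) where
  smul h f := fun g => f (h⁻¹ * g)
  one_smul f := funext fun g => congrArg f (by simp)
  mul_smul a b f := funext fun g => congrArg f (by simp [mul_assoc])

lemma smul_apply (h : G) (f : TranslationSpace G) (g : G) : (h • f) g = f (h⁻¹ * g) := rfl

lemma measurable_apply (g : G) (i : ℕ) : Measurable fun f : TranslationSpace G => f g i :=
  (measurable_pi_apply i).comp (measurable_pi_apply (X := fun _ : G => ℕ → Prop) g)

lemma measurable_iff {α : Type*} [MeasurableSpace α] {F : α → TranslationSpace G}
    (h : ∀ g i, MeasurableSet {a | F a g i}) : Measurable F :=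
  measurable_pi_lambda _ fun g => measurable_pi_lambda _ fun i => measurableSet_setOfPred.1 (h g i)

instance : MeasurableConstSMul G (TranslationSpace G) where
  measurable_const_smul h := measurable_iff fun g i =>
    measurableSet_setOfPred.2 (measurable_apply (h⁻¹ * g) i)

end TranslationSpace

/-! ### Existence of the Poisson boundary -/

section Existence

variable {G : Type u} [Group G]

instance countablyGenerated_cosetPath [Countable G] :
    MeasurableSpace.CountablyGenerated (CosetPath G) := by
  have h1 : MeasurableSpace.CountablyGenerated (Set G) :=
    inferInstanceAs (MeasurableSpace.CountablyGenerated (G → Prop))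
  have h2 : MeasurableSpace.CountablyGenerated (Subgroup G) :=
    MeasurableSpace.CountablyGenerated.comap _
  have h3 : MeasurableSpace.CountablyGenerated (ℕ → Set G) :=
    inferInstanceAs (MeasurableSpace.CountablyGenerated (ℕ → G → Prop))
  infer_instance

variable [Countable G] [MeasurableSpace G] [DiscreteMeasurableSpace G]
  (μ : Measure G) [IsProbabilityMeasure μ] (lam : Measure (Subgroup G)) [IsProbabilityMeasure lam]

/-- The map to the translation space that records which translates of a path lie in which sets of a
sequence. -/
def itinerary (A : ℕ → Set (CosetPath G)) (p : CosetPath G) : TranslationSpace G :=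
  fun g i => g⁻¹ • p ∈ A i

lemma smul_itinerary (A : ℕ → Set (CosetPath G)) (h : G) (p : CosetPath G) :
    itinerary A (h • p) = h • itinerary A p := by
  funext g i
  rw [TranslationSpace.smul_apply, itinerary, itinerary, smul_smul, mul_inv_rev, inv_inv]

lemma measurable_invariants_itinerary {A : ℕ → Set (CosetPath G)}
    (hA : ∀ i, MeasurableSet[MeasurableSpace.invariants shift] (A i)) :
    Measurable[MeasurableSpace.invariants shift] (itinerary A) := by
  refine @TranslationSpace.measurable_iff G _ _ (MeasurableSpace.invariants shift) _ fun g i => ?_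
  refine ⟨measurable_smul_cosetPath g⁻¹ (hA i).1, ?_⟩
  ext p
  have h := Set.ext_iff.1 (hA i).2 (g⁻¹ • p)
  exact h

/-- Recording all translates makes the itinerary equivariant everywhere. Translation commutes with
the shift, so it is also invariant-measurable; the generating sequence shows that it misses no
invariant set modulo null sets. -/
theorem exists_isPoissonBoundary :
    ∃ (B : Type u) (_ : MeasurableSpace B) (_ : StandardBorelSpace B) (_ : MulAction G B)
      (_ : MeasurableConstSMul G B) (ν : Measure B) (bnd : CosetPath G → B),
      IsPoissonBoundary μ lam ν bnd := by
  have hsf : SFinite (pathClass μ lam) := by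
    rw [pathClass]
    infer_instance
  have hle := MeasurableSpace.invariants_le (shift (G := G))
  obtain ⟨A, hA, hD⟩ := exists_seq_liminf_ae_eq (pathClass μ lam) hle
  have hm := measurable_invariants_itinerary hA
  refine ⟨TranslationSpace G, inferInstance, inferInstance, inferInstance, inferInstance,
    (pathLaw μ lam).map (itinerary A), itinerary A, ?_⟩
  refine ⟨hm.mono hle le_rfl, fun g => ae_of_all _ (smul_itinerary A g), rfl,
    fun E hE => ⟨_, hm hE, ae_eq_refl _⟩, fun D hDm => ?_⟩
  obtain ⟨φ, hφ⟩ := hD D hDm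
  -- The coordinate at the identity records the path itself, so this set pulls back to the lower
  -- limit approximating `D`.
  refine ⟨{f | ∀ᶠ k in atTop, f 1 (φ k)}, ?_, ?_⟩
  · have h : {f : TranslationSpace G | ∀ᶠ k in atTop, f 1 (φ k)} =
        ⋃ n, ⋂ k, ⋂ (_ : n ≤ k), {f | f 1 (φ k)} := by
      ext f
      simp
    rw [h]
    refine MeasurableSet.iUnion fun n => MeasurableSet.iInter fun k => MeasurableSet.iInter fun _ => ?_
    exact measurableSet_setOfPred.2 (TranslationSpace.measurable_apply 1 (φ k))
  · refine EventuallyEq.trans (EventuallyEq.of_eq ?_) hφ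
    ext p
    change (∀ᶠ k in atTop, (1 : G)⁻¹ • p ∈ A (φ k)) ↔ _
    simp only [inv_one, one_smul]
    rfl

end Existence

end CosetWalk

theorem theorem3p1 {G : Type u} [Group G] [Countable G] [MeasurableSpace G]
    [DiscreteMeasurableSpace G]
    (μ : Measure G) [IsProbabilityMeasure μ] (hμ : Admissible μ) (hH : entropy μ < ∞)
    (lam : Measure (Subgroup G)) [IsProbabilityMeasure lam] (hlam : ConjInvariant lam) :
    -- the Poisson boundary of the walk on the random coset space exists
    (∃ (B : Type u) (_ : MeasurableSpace B) (_ : StandardBorelSpace B) (_ : MulAction G B)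
      (_ : MeasurableConstSMul G B) (ν : Measure B) (bnd : CosetPath G → B),
      IsPoissonBoundary μ lam ν bnd) ∧
    -- all entropies of the walk are finite and integrable
    (∀ (n : ℕ) (K : Subgroup G), entropy (cosetLaw μ K n) < ∞) ∧
    (∀ n : ℕ, Integrable (cosetEntropy μ n) lam) ∧
    -- the entropy of every realization of the Poisson boundary is well defined, and
    -- equals the two limits and the two infima
    ∀ (B : Type v) [MeasurableSpace B] [StandardBorelSpace B] [MulAction G B]
      [MeasurableConstSMul G B] (ν : Measure B) (bnd : CosetPath G → B),
      IsPoissonBoundary μ lam ν bnd →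
      Nonsingular G ν ∧ Stationary μ ν ∧ Integrable (logDensity (G := G) ν) (μ.prod ν) ∧
      Tendsto (fun n : ℕ => (1 / (n : ℝ)) * ∫ K, cosetEntropy μ n K ∂lam) atTop
        (𝓝 (furstenbergEntropy μ ν)) ∧
      IsGLB {a : ℝ | ∃ n : ℕ, 1 ≤ n ∧ a = (1 / (n : ℝ)) * ∫ K, cosetEntropy μ n K ∂lam}
        (furstenbergEntropy μ ν) ∧
      Tendsto (fun n : ℕ => ∫ K, (cosetEntropy μ (n + 1) K - cosetEntropy μ n K) ∂lam) atTop
        (𝓝 (furstenbergEntropy μ ν)) ∧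
      IsGLB {a : ℝ | ∃ n : ℕ, a = ∫ K, (cosetEntropy μ (n + 1) K - cosetEntropy μ n K) ∂lam}
        (furstenbergEntropy μ ν) := by
  have hsub : ∀ n : ℕ, ∫ K, (cosetEntropy μ (n + 1) K - cosetEntropy μ n K) ∂lam =
      ∫ K, cosetEntropy μ (n + 1) K ∂lam - ∫ K, cosetEntropy μ n K ∂lam := fun n =>
    integral_sub (integrable_cosetEntropy hH (n + 1)) (integrable_cosetEntropy hH n)
  refine ⟨exists_isPoissonBoundary μ lam, fun n K => entropy_cosetLaw_lt_top hH n K,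
    fun n => integrable_cosetEntropy hH n, ?_⟩
  intro B _ _ _ _ ν bnd hB
  have := hB.isProbabilityMeasure
  have hst := hB.stationary hlam
  simp only [hsub]
  exact ⟨nonsingular_of_stationary hμ hst, hst, integrable_logDensity hμ hst hH,
    hB.entropy_formula hμ hH hlam⟩
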